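/- **Setting.** Let $n\ge 2$, $B_r=\{x\in\mathbb R^n:|x|<r\}$, $0<\gamma<1$; write $e_n$ for the last coordinate vector, $x'$ for the first $n-1$ coordinates of $x$, and $s^+=\max(s,0)$, $s^-=\max(-s,0)$. For $u:B_1\to\mathbb R$ put $$B_1^+(u)=\{x\in B_1:u(x)>0\},\qquad B_1^-(u)=\{x\in B_1:u(x)\le 0\}^\circ,\qquad F(u)=\partial B_1^+(u)\cap B_1 .$$ Let $G:[0,\infty)\to(0,\infty)$ be $C^2$ and strictly increasing with $G(0)=1$ and $G(b)\to\infty$ as $b\to\infty$. For $\alpha>0$, $\beta\ge0$, a symmetric matrix $M$ with $Me_n=0$ and $a,b\in\mathbb R^n$, let $$P(x)=x_n-\tfrac12x^TMx,\qquad V(x)=\alpha(1+a\cdot x)P(x)^+-\beta(1+b\cdot x)P(x)^- .$$ Assume that $V$ is in the class $\mathcal V_{f_\pm,G}$, i.e. $2\alpha a_n-\alpha\,\mathrm{tr}M=f_+(0)$; if $\beta\ne0$, also $2\beta b_n-\beta\,\mathrm{tr}M=f_-(0)$ and $\alpha=G(\beta)$; and $\alpha\,a\cdot\tau=\beta G'(\beta)\,b\cdot\tau$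 for every $\tau\perp e_n$. If $\beta=0$, then $V$ does not depend on $b$, and we take $b=0$. A function $v$ is *$(V,\epsilon,\delta)$ flat in $B_1$* if $V(x-\epsilon e_n)\le v(x)\le V(x+\epsilon e_n)$ in $B_1$ and $|a|,|b'|,\|M\|\le\delta\epsilon^{1/2}$, $|b_n|\le\delta^2$, $|b_n|\|M\|\le\delta^2\epsilon$. The function $u$ is Lipschitz in $B_1$ with $\mathrm{Lip}(u)\le L$, $0\in F(u)$, $F(u)$ is $C^{1,\gamma}$, and $u$ is a classical solution of $\Delta u=f_+$ in $B_1^+(u)$ and, if $\beta>0$, of $\Delta u=f_-$ in $B_1^-(u)$. Moreover $\|f_+\|_{C^{0,\gamma}(B_1)}\le\Lambda$ (and $\|f_-\|_{C^{0,\gamma}(B_1)}\le\Lambda$ if $\beta>0$), $\|G\|_{C^2([0,L+1])}\le K$, $0\le\beta\le\beta_1$ and $1\le\alpha\le G(\beta_1)$. Constants depending only on $n,\gamma,L,\Lambda,K,\beta_1$ are called universal. Free boundary conditions are understood in the following viscosity sense. Let $\Gamma=\{x_n=\mathcal P(x')\}$, where $\mathcal P(x')=c+\xi'\cdot x'+\frac12x'^TNx'$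 with $N$ symmetric and $|c|,|\xi'|,\|N\|\le1$, and let $x_0\in F(u)\cap\Gamma\cap B_{2/3}$. If $\{x_n>\mathcal P\}\cap B_{2/3}\subset\{u>0\}$, the inequality "$\le$" of the condition holds at $x_0$; if $\{u>0\}\cap B_{2/3}\subset\{x_n>\mathcal P\}$, the inequality "$\ge$" holds at $x_0$. That is, $u_\nu^+\le G(u_\nu^-)$, resp. $u_\nu^+\ge G(u_\nu^-)$, for the condition $u^+_\nu=G(u^-_\nu)$; and $u_\nu^+-\alpha\le\kappa$, resp. $u^+_\nu-\alpha\ge-\kappa$, for the condition $|u^+_\nu-\alpha|\le\kappa$. Here $\nu$ is the unit normal at $x_0$ pointing into the positive phase, $u_\nu^+(x_0)$ and $u_\nu^-(x_0)$ are the one-sided derivatives of $u^+$ in the direction $\nu$ and of $u^-$ in the direction $-\nu$, and the derivatives that enter the condition are required to exist at these points. The renormalization of $u$ is $$\tilde u^\epsilon(x)=\begin{cases}\dfrac{u(x)-\alpha(1+a\cdot x)P(x)}{\alpha\epsilon},&x\in B_1^+(u)\cup F(u),\\[2mm]\dfrac{u(x)-\beta(1+b\cdot x)P(x)}{\beta\epsilon},&x\in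 B_1^-(u),\ \beta>0,\\[2mm]0,&x\in B_1^-(u),\ \beta=0.\end{cases}$$ **Lemma (Harnack inequality).** There are universal constants $\bar\epsilon,\bar\delta>0$, $\eta\in(0,1)$, $C>0$, $\theta\in(0,1)$ and a function $\sigma$, depending only on the same quantities, with $\sigma(\epsilon)\to0$ as $\epsilon\to0^+$, such that for every $0<\epsilon\le\bar\epsilon$ the following holds. 1. *Two-phase case, $\beta>0$.* Suppose that $u$ is $(V,\epsilon,\bar\delta)$ flat in $B_1$, that $|f_+(x)-f_+(0)|\le\bar\delta\epsilon$ and $|f_-(x)-f_-(0)|\le\beta\bar\delta\epsilon$ in $B_1$, and that $u_\nu^+=G(u_\nu^-)$ on $F(u)\cap B_{2/3}$ in the viscosity sense. Then either $u(x)\le V(x+(1-\eta)\epsilon e_n)$ in $B_\eta$, or $u(x)\ge V(x-(1-\eta)\epsilon e_n)$ in $B_\eta$. Moreover, $|\tilde u^\epsilon(x)-\tilde u^\epsilon(y)|\le C|x-y|^\theta$ for all $x,y\in B_{1/2}$ with $|x-y|\ge\sigma(\epsilon)$. 2. *One-phase case, $\beta=0$.* Suppose that $u^+$ is $(V,\epsilon,\bar\delta)$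 flat in $B_1$, that $|f_+(x)-f_+(0)|\le\bar\delta\epsilon$ in $B_1$, and that $|u_\nu^+-\alpha|\le\bar\delta^{1/2}\epsilon$ on $F(u)\cap B_{2/3}$ in the viscosity sense. Then either $u^+(x)\le V(x+(1-\eta)\epsilon e_n)$ in $B_\eta$, or $u^+(x)\ge V(x-(1-\eta)\epsilon e_n)$ in $B_\eta$. Moreover, $|\tilde u^\epsilon(x)-\tilde u^\epsilon(y)|\le C|x-y|^\theta$ for all $x,y\in B_{1/2}\cap(B_1^+(u)\cup F(u))$ with $|x-y|\ge\sigma(\epsilon)$. -/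

import Mathlib

open Filter Topology Metric Laplacian

noncomputable section

namespace TwoPhaseFB

/-- The space `ℝⁿ` with `n = d + 1`. -/
abbrev Eu (d : ℕ) : Type := EuclideanSpace ℝ (Fin (d + 1))

/-- The last coordinate vector `e_n`. -/
def eLast (d : ℕ) : Eu d := EuclideanSpace.single (Fin.last d) (1 : ℝ)

/-! ### Positive and negative phase, free boundary -/

/-- `B₁⁺(u) = {x ∈ B₁ : u x > 0}`. -/
def posPhase {d : ℕ} (u : Eu d → ℝ) : Set (Eu d) := {x | x ∈ ball 0 1 ∧ 0 < u x}

/-- `B₁⁻(u)`, the interior of `{x ∈ B₁ : u x ≤ 0}`. -/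
def negPhase {d : ℕ} (u : Eu d → ℝ) : Set (Eu d) := interior {x | x ∈ ball 0 1 ∧ u x ≤ 0}

/-- The free boundary `F(u) = ∂B₁⁺(u) ∩ B₁`. -/
def freeBdry {d : ℕ} (u : Eu d → ℝ) : Set (Eu d) := frontier (posPhase u) ∩ ball 0 1

/-- `F(u)` is of class `C^{1,γ}`: near each of its points, in suitable orthonormal coordinates,
the positive phase is the strict epigraph of a `C^{1,γ}` function `g` of the variables
orthogonal to a unit vector `ν`. -/
def FreeBdryC1Holder {d : ℕ} (γ : ℝ) (u : Eu d → ℝ) : Prop :=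
  ∀ x₀ ∈ freeBdry u, ∃ r : ℝ, 0 < r ∧ ∃ (ν : Eu d) (g : Eu d → ℝ) (C : ℝ),
    ‖ν‖ = 1 ∧ ContDiff ℝ 1 g ∧
    (∀ x y, ‖fderiv ℝ g x - fderiv ℝ g y‖ ≤ C * ‖x - y‖ ^ γ) ∧
    ∀ x ∈ ball x₀ r, (0 < u x ↔ g (x - inner ℝ x ν • ν) < inner ℝ x ν)

/-- `u` is a classical solution of `Δu = f` in the open set `Ω`. -/
def SolvesPoisson {d : ℕ} (u f : Eu d → ℝ) (Ω : Set (Eu d)) : Prop :=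
  ContDiffOn ℝ 2 u Ω ∧ ∀ x ∈ Ω, Δ u x = f x

/-- `f ∈ C^{0,γ}(B₁)`, with supremum and Hölder seminorm at most `Λ`. -/
def HolderBound {d : ℕ} (γ Λ : ℝ) (f : Eu d → ℝ) : Prop :=
  (∀ x ∈ ball (0 : Eu d) 1, |f x| ≤ Λ) ∧
  ∀ x ∈ ball (0 : Eu d) 1, ∀ y ∈ ball (0 : Eu d) 1, |f x - f y| ≤ Λ * ‖x - y‖ ^ γ

/-! ### The function `G` -/

/-- First derivative of `G` on `[0, ∞)` (one-sided at `0`). -/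
def derivG (G : ℝ → ℝ) (t : ℝ) : ℝ := derivWithin G (Set.Ici 0) t

/-- The standing assumptions on `G : [0, ∞) → (0, ∞)` (only the values of `G` on `[0, ∞)`
matter): `C²`, strictly increasing, `G 0 = 1`, `G → ∞`; and the bound `K` for the `C²` norm of
`G` on `[0, L + 1]`. -/
structure AdmissibleG (L K : ℝ) (G : ℝ → ℝ) : Prop where
  contDiffOn : ContDiffOn ℝ 2 G (Set.Ici 0)
  strictMonoOn : StrictMonoOn G (Set.Ici 0)
  map_zero : G 0 = 1
  tendsto : Tendsto G atTop atTop
  bound : ∀ t ∈ Set.Icc 0 (L + 1),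
    |G t| ≤ K ∧ |derivG G t| ≤ K ∧ |iteratedDerivWithin 2 G (Set.Ici 0) t| ≤ K

/-! ### Two-phase and one-phase polynomials -/

/-- `P_{M,ω}(x) = x·ω - ½ xᵀMx`. -/
def polyP {d : ℕ} (M : Eu d →L[ℝ] Eu d) (ω x : Eu d) : ℝ :=
  inner ℝ x ω - 1 / 2 * inner ℝ x (M x)

/-- `V^{α,β}_{M,ω,a,b}(x) = α (1 + a·x) P_{M,ω}(x)⁺ - β (1 + b·x) P_{M,ω}(x)⁻`. -/
def polyV {d : ℕ} (α β : ℝ) (M : Eu d →L[ℝ] Eu d) (ω a b x : Eu d) : ℝ :=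
  α * (1 + inner ℝ a x) * max (polyP M ω x) 0 - β * (1 + inner ℝ b x) * max (-polyP M ω x) 0

/-- The trace of a linear operator on `ℝⁿ`. -/
def opTrace {d : ℕ} (M : Eu d →L[ℝ] Eu d) : ℝ := LinearMap.trace ℝ (Eu d) (M : Eu d →ₗ[ℝ] Eu d)

/-- `V^{α,β}_{M,ω,a,b} ∈ 𝒱_{f±,G}`. If `β = 0`, neither `f₋` nor `G` nor `b` enters. -/
structure InClassV {d : ℕ} (fp fm : Eu d → ℝ) (G : ℝ → ℝ) (α β : ℝ) (M : Eu d →L[ℝ] Eu d)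
    (ω a b : Eu d) : Prop where
  norm_dir : ‖ω‖ = 1
  symm : (M : Eu d →ₗ[ℝ] Eu d).IsSymmetric
  map_dir : M ω = 0
  alpha_pos : 0 < α
  beta_nonneg : 0 ≤ β
  eq_pos : 2 * α * inner ℝ a ω - α * opTrace M = fp 0
  eq_neg : β ≠ 0 → 2 * β * inner ℝ b ω - β * opTrace M = fm 0
  eq_slope : β ≠ 0 → α = G β
  eq_tangential : ∀ v : Eu d, inner ℝ v ω = 0 →
    α * inner ℝ a v = β * derivG G β * inner ℝ b v

/-- `v` is `(V, ε, δ)` flat in `B₁`, for `V = V^{α,β}_{M,ω,a,b}`. Here `b·ω` is the component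
written `b_n` and `b - (b·ω)ω` is the component `b'`. -/
structure FlatB1 {d : ℕ} (v : Eu d → ℝ) (α β : ℝ) (M : Eu d →L[ℝ] Eu d) (ω a b : Eu d)
    (ε δ : ℝ) : Prop where
  lower : ∀ x ∈ ball (0 : Eu d) 1, polyV α β M ω a b (x - ε • ω) ≤ v x
  upper : ∀ x ∈ ball (0 : Eu d) 1, v x ≤ polyV α β M ω a b (x + ε • ω)
  norm_a : ‖a‖ ≤ δ * √ε
  norm_b' : ‖b - inner ℝ b ω • ω‖ ≤ δ * √ε
  norm_M : ‖M‖ ≤ δ * √ε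
  abs_bn : |inner ℝ b ω| ≤ δ ^ 2
  abs_bn_mul : |inner ℝ b ω| * ‖M‖ ≤ δ ^ 2 * ε

/-! ### The free boundary condition in the viscosity sense -/

/-- The quadratic polynomial `𝒫(x') = c + ξ·x' + ½ x'ᵀNx'`. -/
def quadPoly {d : ℕ} (c : ℝ) (ξ : Eu d) (N : Eu d →L[ℝ] Eu d) (x : Eu d) : ℝ :=
  c + inner ℝ ξ x + 1 / 2 * inner ℝ x (N x)

/-- `𝒫` depends on `x'` only and has coefficients of size at most `1`, so that
`Γ = {x_n = 𝒫}` is a smooth graph over the hyperplane `x_n = 0`. -/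
structure TestQuad {d : ℕ} (c : ℝ) (ξ : Eu d) (N : Eu d →L[ℝ] Eu d) : Prop where
  symm : (N : Eu d →ₗ[ℝ] Eu d).IsSymmetric
  xi_last : inner ℝ ξ (eLast d) = 0
  map_last : N (eLast d) = 0
  abs_c : |c| ≤ 1
  norm_xi : ‖ξ‖ ≤ 1
  norm_N : ‖N‖ ≤ 1

/-- The unit normal of `Γ = {x_n = 𝒫}` at `x₀`, pointing into `{x_n > 𝒫}`. At a point where `Γ`
touches a `C¹` free boundary it is the normal of `F(u)` that points into the positive phase. -/
def quadNormal {d : ℕ} (ξ : Eu d) (N : Eu d →L[ℝ] Eu d) (x₀ : Eu d) : Eu d :=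
  ‖eLast d - ξ - N x₀‖⁻¹ • (eLast d - ξ - N x₀)

/-- `Γ = {x_n = 𝒫}` touches `F(u)` at `x₀ ∈ F(u) ∩ B_{2/3}` by the positive side, globally in
`B_{2/3}`. -/
def TouchesPos {d : ℕ} (u : Eu d → ℝ) (c : ℝ) (ξ : Eu d) (N : Eu d →L[ℝ] Eu d)
    (x₀ : Eu d) : Prop :=
  x₀ ∈ freeBdry u ∩ ball 0 (2 / 3) ∧ inner ℝ x₀ (eLast d) = quadPoly c ξ N x₀ ∧
  ∀ x ∈ ball (0 : Eu d) (2 / 3), quadPoly c ξ N x < inner ℝ x (eLast d) → 0 < u x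

/-- `Γ = {x_n = 𝒫}` touches `F(u)` at `x₀ ∈ F(u) ∩ B_{2/3}` by the negative side, globally in
`B_{2/3}`. -/
def TouchesNeg {d : ℕ} (u : Eu d → ℝ) (c : ℝ) (ξ : Eu d) (N : Eu d →L[ℝ] Eu d)
    (x₀ : Eu d) : Prop :=
  x₀ ∈ freeBdry u ∩ ball 0 (2 / 3) ∧ inner ℝ x₀ (eLast d) = quadPoly c ξ N x₀ ∧
  ∀ x ∈ ball (0 : Eu d) (2 / 3), 0 < u x → quadPoly c ξ N x < inner ℝ x (eLast d)

/-- `u⁺_ν(x₀) = p`: derivative of the positive part of `u` at `x₀` in the inward direction `ν`. -/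
def PosSlope {d : ℕ} (u : Eu d → ℝ) (x₀ ν : Eu d) (p : ℝ) : Prop :=
  HasDerivWithinAt (fun t : ℝ => max (u (x₀ + t • ν)) 0) p (Set.Ici 0) 0

/-- `u⁻_ν(x₀) = q`: derivative of the negative part `u⁻ ≥ 0` of `u` at `x₀` in the direction
`-ν`, which points into the negative phase. -/
def NegSlope {d : ℕ} (u : Eu d → ℝ) (x₀ ν : Eu d) (q : ℝ) : Prop :=
  HasDerivWithinAt (fun t : ℝ => max (-u (x₀ - t • ν)) 0) q (Set.Ici 0) 0

/-- `u⁺_ν = G(u⁻_ν)` on `F(u) ∩ B_{2/3}`, in the viscosity sense. -/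
def TwoPhaseFBCond {d : ℕ} (G : ℝ → ℝ) (u : Eu d → ℝ) : Prop :=
  ∀ (c : ℝ) (ξ : Eu d) (N : Eu d →L[ℝ] Eu d), TestQuad c ξ N → ∀ x₀ : Eu d,
    (TouchesPos u c ξ N x₀ → ∃ p q : ℝ, PosSlope u x₀ (quadNormal ξ N x₀) p ∧
      NegSlope u x₀ (quadNormal ξ N x₀) q ∧ p ≤ G q) ∧
    (TouchesNeg u c ξ N x₀ → ∃ p q : ℝ, PosSlope u x₀ (quadNormal ξ N x₀) p ∧
      NegSlope u x₀ (quadNormal ξ N x₀) q ∧ G q ≤ p)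

/-- `|u⁺_ν - α| ≤ κ` on `F(u) ∩ B_{2/3}`, in the viscosity sense. -/
def OnePhaseFBCond {d : ℕ} (α κ : ℝ) (u : Eu d → ℝ) : Prop :=
  ∀ (c : ℝ) (ξ : Eu d) (N : Eu d →L[ℝ] Eu d), TestQuad c ξ N → ∀ x₀ : Eu d,
    (TouchesPos u c ξ N x₀ → ∃ p : ℝ, PosSlope u x₀ (quadNormal ξ N x₀) p ∧ p - α ≤ κ) ∧
    (TouchesNeg u c ξ N x₀ → ∃ p : ℝ, PosSlope u x₀ (quadNormal ξ N x₀) p ∧ -κ ≤ p - α)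

/-! ### The hypotheses in the two cases -/

/-- The two-phase case, `β > 0`, with direction of flatness `e_n`. -/
structure TwoPhaseCase {d : ℕ} (γ : ℝ) (L : NNReal) (Λ K β₁ ε δ : ℝ) (G : ℝ → ℝ)
    (fp fm u : Eu d → ℝ) (α β : ℝ) (M : Eu d →L[ℝ] Eu d) (a b : Eu d) : Prop where
  admissible : AdmissibleG L K G
  holder_fp : HolderBound γ Λ fp
  holder_fm : HolderBound γ Λ fm
  lipschitz : LipschitzOnWith L u (ball 0 1)
  solves_pos : SolvesPoisson u fp (posPhase u)
  solves_neg : SolvesPoisson u fm (negPhase u)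
  zero_mem : (0 : Eu d) ∈ freeBdry u
  freeBdry_reg : FreeBdryC1Holder γ u
  beta_pos : 0 < β
  beta_le : β ≤ β₁
  mem_class : InClassV fp fm G α β M (eLast d) a b
  flat : FlatB1 u α β M (eLast d) a b ε δ
  osc_fp : ∀ x ∈ ball (0 : Eu d) 1, |fp x - fp 0| ≤ δ * ε
  osc_fm : ∀ x ∈ ball (0 : Eu d) 1, |fm x - fm 0| ≤ β * δ * ε
  fb_cond : TwoPhaseFBCond G u

/-- The one-phase case, `β = 0`, with direction of flatness `e_n`. Nothing is required of `u` in
the negative phase besides Lipschitz continuity. -/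
structure OnePhaseCase {d : ℕ} (γ : ℝ) (L : NNReal) (Λ K β₁ ε δ : ℝ) (G : ℝ → ℝ)
    (fp u : Eu d → ℝ) (α : ℝ) (M : Eu d →L[ℝ] Eu d) (a : Eu d) : Prop where
  admissible : AdmissibleG L K G
  holder_fp : HolderBound γ Λ fp
  lipschitz : LipschitzOnWith L u (ball 0 1)
  solves_pos : SolvesPoisson u fp (posPhase u)
  zero_mem : (0 : Eu d) ∈ freeBdry u
  freeBdry_reg : FreeBdryC1Holder γ u
  one_le_alpha : 1 ≤ α
  alpha_le : α ≤ G β₁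
  mem_class : InClassV fp 0 G α 0 M (eLast d) a 0
  flat : FlatB1 (fun x => max (u x) 0) α 0 M (eLast d) a 0 ε δ
  osc_fp : ∀ x ∈ ball (0 : Eu d) 1, |fp x - fp 0| ≤ δ * ε
  fb_cond : OnePhaseFBCond α (√δ * ε) u

/-! ### The renormalization -/

open Classical in
/-- The renormalization `ũ^ε` of `u`, relative to `V^{α,β}_{M,e_n,a,b}`. -/
def renorm {d : ℕ} (u : Eu d → ℝ) (α β : ℝ) (M : Eu d →L[ℝ] Eu d) (a b : Eu d) (ε : ℝ)
    (x : Eu d) : ℝ :=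
  if x ∈ posPhase u ∪ freeBdry u then
    (u x - α * (1 + inner ℝ a x) * polyP M (eLast d) x) / (α * ε)
  else if x ∈ negPhase u ∧ 0 < β then
    (u x - β * (1 + inner ℝ b x) * polyP M (eLast d) x) / (β * ε)
  else 0

end TwoPhaseFB

end

/-! The proof is an improvement of flatness by barriers, iterated over scales. Near `x₀`, at radius
`r`, the solution lies between two copies of the profile in which `P` is replaced by `P + εl` and `P
+ εm`. The key claim (`Step.decay`) is that on the ball of radius `scaleC * r` one of the two levels
improves by the fixed fraction `decayC` of `m - l`. One step at the origin gives the dichotomy;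
iterating about each point of `B_{1/2}` gives the Hölder bound, since `l` and `m` also bracket the
renormalization up to the weights `1 + a·x` and `1 + b·x`.

One step. If `|P(x₀)|` is large compared with `r`, the smaller ball lies in a single phase. At `x₀`
the solution is at least half the width away from one of the two profiles, and an interior Harnack
inequality (`harnack_segment`, `gain`) spreads this gain, because solution and profile have the same
Laplacian up to a small multiple of `ε`. If `x₀` is close to the zero level, the same argument
starts at `x₀ + (r/2)eₙ`, inside the positive phase, and carries the gain to a surface `P + k = bTop
* r`, where `k` is `εl` or `εm`. A sliding barrier then transports it across the free boundary.

The barrier, with `σ = 1` for improvement from below and `σ = -1` from above, is a function of `Q_t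
= P + k + σμrt - σ(μ/r)|x' - x₀'|²`, with slope `1 + σμA` where `Q_t > 0`, slope `1 + σμ` where `Q_t
< 0`, and an additional term `σμB Q_t²/r`. Since `B = n` exceeds the number `n - 1` of tangential
directions, the normal curvature beats the tangential one, and the barrier is a strict sub- or
supersolution in each phase. Since `A` is large compared with the derivative of `G`, its two slopes
strictly violate the free boundary condition. Hence, while `t` runs from `-1` to `bT`, a first
contact can occur neither on the boundary of the comparison region, nor inside a phase, nor on
`F(u)` (`Near.gap_nonneg`).

The viscosity condition only admits quadratic graphs with bounded coefficients that touch globally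
in `B_{2/3}`. The induction therefore also carries a global statement: if `x₀` is near the zero
level, `F(u)` is trapped between two paraboloids of opening proportional to `ε(m - l)/r²`. The
required opening grows as `r` decreases, so what one step produces suffices for the next.
Boundedness of the coefficients and smallness of `μ` require `ε ≤ τr²`; this is where the iteration
stops and why `σ(ε) = √(ε/τ)`.

Both cases are reduced to one set of hypotheses, `Core`. In the two-phase case the free boundary
inequality comes from a Taylor expansion of `G` at `β`, whose first order term along the free
boundary is cancelled by the tangential compatibility of `a` and `b`. In the one-phase case the
solution is replaced by its positive part; contacts where both functions vanish identically are
harmless, because sliding only has to exclude contacts that are limits of points where the ordering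
fails. -/

noncomputable section
namespace TwoPhaseFB

/-! ### Calculus of gradients and Laplacians; second order condition at a minimum. -/

section Jets

variable {E : Type*} [NormedAddCommGroup E] [InnerProductSpace ℝ E] [FiniteDimensional ℝ E]

theorem laplacian_eq_sum_fderiv {ι : Type*} [Fintype ι] (b : OrthonormalBasis ι ℝ E)
    (f : E → ℝ) (x : E) : Δ f x = ∑ i, fderiv ℝ (fderiv ℝ f) x (b i) (b i) := by
  rw [InnerProductSpace.laplacian_eq_iteratedFDeriv_orthonormalBasis f b]
  simp [iteratedFDeriv_two_apply]

/-- `f` is `C²` at `x`, with gradient `g` and Laplacian `l` there. -/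
structure HasJet (f : E → ℝ) (x g : E) (l : ℝ) : Prop where
  contDiffAt : ContDiffAt ℝ 2 f x
  fderiv_eq : ∀ v, fderiv ℝ f x v = inner ℝ g v
  laplacian_eq : Δ f x = l

theorem HasJet.congr {f : E → ℝ} {x g g' : E} {l l' : ℝ} (h : HasJet f x g l) (hg : g = g')
    (hl : l = l') : HasJet f x g' l' := by subst hg hl; exact h

theorem HasJet.differentiableAt {f : E → ℝ} {x g : E} {l : ℝ} (h : HasJet f x g l) :
    DifferentiableAt ℝ f x := h.contDiffAt.differentiableAt (by norm_num)

theorem hasJet_const (c : ℝ) (x : E) : HasJet (fun _ => c) x 0 0 := by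
  refine ⟨contDiffAt_const, fun v => by simp, ?_⟩
  rw [laplacian_eq_sum_fderiv (stdOrthonormalBasis ℝ E)]
  have : fderiv ℝ (fun _ : E => c) = fun _ => 0 := by ext y v; simp
  simp [this]

theorem hasJet_inner (a x : E) : HasJet (fun y => inner ℝ a y) x a 0 := by
  have hd : ∀ y, HasFDerivAt (fun y : E => inner ℝ a y) (innerSL ℝ a) y := fun y =>
    (innerSL ℝ a).hasFDerivAt
  have hf : fderiv ℝ (fun y : E => inner ℝ a y) = fun _ => innerSL ℝ a :=
    funext fun y => (hd y).fderiv
  refine ⟨(innerSL ℝ a).contDiff.contDiffAt, fun v => by rw [hf]; rfl, ?_⟩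
  rw [laplacian_eq_sum_fderiv (stdOrthonormalBasis ℝ E), hf]
  simp

theorem hasJet_inner_map (M : E →L[ℝ] E) (hM : (M : E →ₗ[ℝ] E).IsSymmetric) (x : E) :
    HasJet (fun y => inner ℝ y (M y)) x ((2 : ℝ) • M x)
      (2 * LinearMap.trace ℝ E (M : E →ₗ[ℝ] E)) := by
  have hs : ∀ y z, inner ℝ (M y) z = inner ℝ y (M z) := hM
  set T : E →L[ℝ] E →L[ℝ] ℝ := (2 : ℝ) • (innerSL ℝ).comp M with hT
  have hTa : ∀ y v, T y v = 2 * inner ℝ (M y) v := fun y v => by simp [hT]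
  have hd : ∀ y, HasFDerivAt (fun y => inner ℝ y (M y)) (T y) y := by
    intro y
    have := (hasFDerivAt_id y).inner ℝ (M.hasFDerivAt (x := y))
    refine this.congr_fderiv (ContinuousLinearMap.ext fun v => ?_)
    rw [hTa]
    simp only [ContinuousLinearMap.comp_apply, ContinuousLinearMap.prod_apply,
      fderivInnerCLM_apply, ContinuousLinearMap.id_apply, id]
    rw [← hs y v, real_inner_comm (M y) v]; ring
  have hf : fderiv ℝ (fun y => inner ℝ y (M y)) = T := funext fun y => (hd y).fderiv
  refine ⟨(contDiff_id.inner ℝ M.contDiff).contDiffAt,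
    fun v => by rw [hf, hTa, inner_smul_left]; simp, ?_⟩
  rw [laplacian_eq_sum_fderiv (stdOrthonormalBasis ℝ E), hf,
      LinearMap.trace_eq_sum_inner _ (stdOrthonormalBasis ℝ E), Finset.mul_sum]
  refine Finset.sum_congr rfl fun i _ => ?_
  rw [T.fderiv, hTa, real_inner_comm]
  rfl

theorem HasJet.add {f h : E → ℝ} {x g k : E} {l m : ℝ} (hf : HasJet f x g l) (hh : HasJet h x k m) :
    HasJet (fun y => f y + h y) x (g + k) (l + m) := by
  refine ⟨hf.1.add hh.1, fun v => ?_, ?_⟩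
  · rw [fderiv_fun_add hf.differentiableAt hh.differentiableAt]
    simp [hf.2, hh.2, inner_add_left]
  · have := hf.1.laplacian_add hh.1
    rw [hf.3, hh.3] at this; exact this

theorem HasJet.const_mul {f : E → ℝ} {x g : E} {l : ℝ} (hf : HasJet f x g l) (c : ℝ) :
    HasJet (fun y => c * f y) x (c • g) (c * l) := by
  refine ⟨contDiffAt_const.mul hf.1, fun v => ?_, ?_⟩
  · rw [fderiv_const_mul hf.differentiableAt]
    simp [hf.2, inner_smul_left]
  · have := InnerProductSpace.laplacian_smul c hf.1
    rw [hf.3] at this; exact this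

theorem HasJet.sub {f h : E → ℝ} {x g k : E} {l m : ℝ} (hf : HasJet f x g l) (hh : HasJet h x k m) :
    HasJet (fun y => f y - h y) x (g - k) (l - m) := by
  have := hf.add (hh.const_mul (-1))
  simpa [sub_eq_add_neg] using this

theorem HasJet.mul {f h : E → ℝ} {x g k : E} {l m : ℝ} (hf : HasJet f x g l) (hh : HasJet h x k m) :
    HasJet (fun y => f y * h y) x (f x • k + h x • g) (f x * m + h x * l + 2 * inner ℝ g k) := by
  refine ⟨hf.1.mul hh.1, fun v => ?_, ?_⟩
  · rw [fderiv_fun_mul hf.differentiableAt hh.differentiableAt]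
    simp [hf.2, hh.2, inner_add_left, inner_smul_left]
  · have e1 : fderiv ℝ (fun y => f y * h y) =ᶠ[𝓝 x] fun y => f y • fderiv ℝ h y + h y • fderiv ℝ f y := by
      filter_upwards [hf.1.eventually (by simp), hh.1.eventually (by simp)] with y h1 h2
      exact fderiv_fun_mul (h1.differentiableAt (by norm_num)) (h2.differentiableAt (by norm_num))
    have d1 : DifferentiableAt ℝ (fderiv ℝ f) x :=
      (hf.1.fderiv_right (m := 1) (by norm_num)).differentiableAt (by norm_num)
    have d2 : DifferentiableAt ℝ (fderiv ℝ h) x :=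
      (hh.1.fderiv_right (m := 1) (by norm_num)).differentiableAt (by norm_num)
    set b := stdOrthonormalBasis ℝ E
    rw [laplacian_eq_sum_fderiv b, e1.fderiv_eq,
      fderiv_fun_add (hf.differentiableAt.fun_smul d2) (hh.differentiableAt.fun_smul d1),
      fderiv_fun_smul hf.differentiableAt d2, fderiv_fun_smul hh.differentiableAt d1,
      ← hf.3, ← hh.3, laplacian_eq_sum_fderiv b, laplacian_eq_sum_fderiv b,
      ← OrthonormalBasis.sum_inner_mul_inner b g k, Finset.mul_sum, Finset.mul_sum, Finset.mul_sum,
      ← Finset.sum_add_distrib, ← Finset.sum_add_distrib]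
    refine Finset.sum_congr rfl fun i _ => ?_
    simp only [add_apply, smul_apply, smul_eq_mul,
      ContinuousLinearMap.smulRight_apply, hf.2, hh.2]
    rw [real_inner_comm k (b i)]
    ring

/-- Restrict to a line in each basis direction. A negative second derivative would make the point
also a local maximum of the restriction, which would then be locally constant, with second
derivative zero. -/
theorem laplacian_nonneg_of_isLocalMin {f : E → ℝ} {x : E} (hf : ContDiffAt ℝ 2 f x)
    (hmin : IsLocalMin f x) : 0 ≤ Δ f x := by
  rw [laplacian_eq_sum_fderiv (stdOrthonormalBasis ℝ E)]
  refine Finset.sum_nonneg fun i _ => ?_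
  set v := stdOrthonormalBasis ℝ E i
  have hline : ∀ t : ℝ, HasDerivAt (fun t : ℝ => x + t • v) v t := fun t => by
    simpa using ((hasDerivAt_id t).smul_const v).const_add x
  have hc : Tendsto (fun t : ℝ => x + t • v) (𝓝 0) (𝓝 x) := by
    have := (hline 0).continuousAt.tendsto
    simpa using this
  have hd : deriv (fun t : ℝ => f (x + t • v)) =ᶠ[𝓝 0] fun t => fderiv ℝ f (x + t • v) v := by
    filter_upwards [hc.eventually (hf.eventually (by simp))] with t ht
    exact ((ht.differentiableAt (by norm_num)).hasFDerivAt.comp_hasDerivAt t (hline t)).deriv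
  have d1 : DifferentiableAt ℝ (fderiv ℝ f) x :=
    (hf.fderiv_right (m := 1) (by norm_num)).differentiableAt (by norm_num)
  have hdd : deriv (deriv (fun t : ℝ => f (x + t • v))) 0 = fderiv ℝ (fderiv ℝ f) x v v := by
    rw [hd.deriv_eq]
    have h0 : HasFDerivAt (fderiv ℝ f) (fderiv ℝ (fderiv ℝ f) x) (x + (0 : ℝ) • v) := by
      simpa using d1.hasFDerivAt
    have h1 := h0.comp_hasDerivAt (0 : ℝ) (hline 0)
    exact ((ContinuousLinearMap.apply ℝ ℝ v).hasFDerivAt.comp_hasDerivAt (0:ℝ) h1).deriv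
  by_contra hneg
  push Not at hneg
  have hm : IsLocalMin (fun t : ℝ => f (x + t • v)) 0 := by
    have := hc.eventually hmin
    filter_upwards [this] with t ht
    simpa using ht
  have hM := isLocalMax_of_deriv_deriv_neg (by rw [hdd]; exact hneg) hm.deriv_eq_zero
    (by
      have : ContinuousAt (fun t : ℝ => f (x + t • v)) 0 := by
        have h0 : ContinuousAt f (x + (0:ℝ) • v) := by simpa using hf.continuousAt
        exact ContinuousAt.comp (f := fun t : ℝ => x + t • v) h0 (hline 0).continuousAt
      exact this)
  have hconst : (fun t : ℝ => f (x + t • v)) =ᶠ[𝓝 0] fun _ => f (x + (0 : ℝ) • v) := by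
    filter_upwards [hm, hM] with t h1 h2 using le_antisymm h2 h1
  have h2 : deriv (deriv (fun t : ℝ => f (x + t • v))) 0 = 0 := by
    rw [(hconst.deriv).deriv_eq]; simp
  rw [hdd] at h2
  exact absurd h2 hneg.ne

end Jets


/-! ### Harnack inequality with bounded Laplacian, from weighted mean values. -/

section Harnack

set_option linter.unusedSectionVars false

open MeasureTheory

variable {E : Type*} [NormedAddCommGroup E] [InnerProductSpace ℝ E]

/-- Squaring removes the kink of the positive part, so `kern ^ 2` is differentiable everywhere and
can be used in an integration by parts. -/
theorem hasDerivAt_sq_max_zero (t : ℝ) : HasDerivAt (fun s : ℝ => (max s 0) ^ 2) (2 * max t 0) t := by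
  have key : ∀ s : ℝ, s ≠ 0 → HasDerivAt (fun s : ℝ => (max s 0) ^ 2) (2 * max s 0) s := by
    intro s hs
    rcases lt_or_gt_of_ne hs with h | h
    · have : (fun s : ℝ => (max s 0) ^ 2) =ᶠ[𝓝 s] fun _ => 0 := by
        filter_upwards [Iio_mem_nhds h] with u hu
        rw [max_eq_right (le_of_lt hu)]; norm_num
      rw [max_eq_right h.le, mul_zero]
      exact (hasDerivAt_const s (0 : ℝ)).congr_of_eventuallyEq this
    · have : (fun s : ℝ => (max s 0) ^ 2) =ᶠ[𝓝 s] fun u => u ^ 2 := by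
        filter_upwards [Ioi_mem_nhds h] with u hu
        rw [max_eq_left (le_of_lt hu)]
      rw [max_eq_left h.le]
      simpa using (hasDerivAt_pow 2 s).congr_of_eventuallyEq this
  rcases eq_or_ne t 0 with rfl | h
  · exact hasDerivAt_of_hasDerivAt_of_ne key (by fun_prop) (by fun_prop)
  · exact key t h

/-- A radial kernel supported in the unit ball. -/
def kern (y : E) : ℝ := max (1 - ‖y‖ ^ 2) 0

theorem kern_nonneg (y : E) : 0 ≤ kern y := le_max_right _ _

theorem kern_le_one (y : E) : kern y ≤ 1 :=
  max_le (by nlinarith [sq_nonneg ‖y‖]) zero_le_one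

theorem continuous_kern : Continuous (kern : E → ℝ) := by unfold kern; fun_prop

theorem kern_eq_zero {y : E} (h : 1 ≤ ‖y‖) : kern y = 0 :=
  max_eq_right (by nlinarith)

variable [FiniteDimensional ℝ E]

theorem hasCompactSupport_kern : HasCompactSupport (kern : E → ℝ) := by
  refine HasCompactSupport.intro (isCompact_closedBall (0 : E) 1) fun y hy => kern_eq_zero ?_
  simp only [mem_closedBall, dist_zero_right, not_le] at hy
  exact hy.le

/-- The field `-kern(y) y` is the gradient of `kern² / 4`. This is the reason for the choice of
kernel: radial derivatives weighted by `kern` turn into Laplacians weighted by a nonnegative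
function. -/
theorem hasFDerivAt_kern_sq (y : E) :
    HasFDerivAt (fun y : E => kern y ^ 2 / 4) (-(kern y • innerSL ℝ y)) y := by
  have h1 : HasFDerivAt (fun y : E => 1 - ‖y‖ ^ 2) (-(2 • innerSL ℝ y)) y := by
    simpa using ((hasStrictFDerivAt_norm_sq y).hasFDerivAt).const_sub 1
  have h2 := (hasDerivAt_sq_max_zero (1 - ‖y‖ ^ 2)).comp_hasFDerivAt y h1
  have h3 := h2.mul_const (1 / 4 : ℝ)
  refine (h3.congr_fderiv ?_).congr_of_eventuallyEq (Eventually.of_forall fun z => ?_)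
  · ext v
    simp [kern]
    ring
  · simp [kern, Function.comp]; ring

variable [MeasurableSpace E] [BorelSpace E] (μ : Measure E) [μ.IsAddHaarMeasure]

theorem integrable_kern_mul {f : E → ℝ} (hf : Continuous f) :
    Integrable (fun y => kern y * f y) μ :=
  (continuous_kern.mul hf).integrable_of_hasCompactSupport hasCompactSupport_kern.mul_right

theorem integrable_kern : Integrable (kern : E → ℝ) μ :=
  continuous_kern.integrable_of_hasCompactSupport hasCompactSupport_kern

theorem integral_kern_pos : 0 < ∫ y : E, kern y ∂μ := by
  refine continuous_kern.integral_pos_of_hasCompactSupport_nonneg_nonzero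
    hasCompactSupport_kern kern_nonneg (x := 0) ?_
  simp [kern]

/-- Integration by parts in each coordinate direction, moving the derivative off `kern² / 4`; the
chain rule for `y ↦ x + s y` supplies the factor `s`. -/
theorem integral_kern_mul_fderiv {h : E → ℝ} (hh : ContDiff ℝ 2 h) (x : E) (s : ℝ) :
    ∫ y, kern y * fderiv ℝ h (x + s • y) y ∂μ = s * ∫ y, kern y ^ 2 / 4 * Δ h (x + s • y) ∂μ := by
  set b := stdOrthonormalBasis ℝ E
  have hc1 : Continuous (fderiv ℝ h) := hh.continuous_fderiv (by norm_num)
  have hf1 : ContDiff ℝ 1 (fderiv ℝ h) := hh.fderiv_right (by norm_num)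
  have hc2 : Continuous (fderiv ℝ (fderiv ℝ h)) := hf1.continuous_fderiv (by norm_num)
  have hline : ∀ y, HasFDerivAt (fun y : E => x + s • y) (s • ContinuousLinearMap.id ℝ E) y :=
    fun y => ((hasFDerivAt_id y).const_smul s).const_add x
  have hg : ∀ i y, HasFDerivAt (fun y => fderiv ℝ h (x + s • y) (b i))
      (s • (ContinuousLinearMap.apply ℝ ℝ (b i)).comp (fderiv ℝ (fderiv ℝ h) (x + s • y))) y := by
    intro i y
    have h1 := ((hf1.differentiable (by norm_num)) (x + s • y)).hasFDerivAt.comp y (hline y)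
    have h2 := (ContinuousLinearMap.apply ℝ ℝ (b i)).hasFDerivAt.comp y h1
    refine h2.congr_fderiv (ContinuousLinearMap.ext fun v => ?_)
    simp
  have hψ : ∀ y : E, fderiv ℝ (fun y : E => kern y ^ 2 / 4) y = -(kern y • innerSL ℝ y) :=
    fun y => (hasFDerivAt_kern_sq y).fderiv
  have hcs : HasCompactSupport (fun y : E => kern y ^ 2 / 4) := by
    have := (hasCompactSupport_kern (E := E)).mul_right (f' := fun y : E => kern y / 4)
    have e : (fun y : E => kern y ^ 2 / 4) = kern * fun y : E => kern y / 4 := by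
      funext y; simp only [Pi.mul_apply]; ring
    rw [e]; exact this
  have hcψ : Continuous (fun y : E => kern y ^ 2 / 4) := by
    have := continuous_kern (E := E); fun_prop
  have key : ∀ i, ∫ y, kern y * (inner ℝ (b i) y * fderiv ℝ h (x + s • y) (b i)) ∂μ
      = s * ∫ y, kern y ^ 2 / 4 * fderiv ℝ (fderiv ℝ h) (x + s • y) (b i) (b i) ∂μ := by
    intro i
    have hi := integral_mul_fderiv_eq_neg_fderiv_mul_of_integrable (μ := μ) (𝕜 := ℝ)
      (f := fun y : E => kern y ^ 2 / 4) (g := fun y => fderiv ℝ h (x + s • y) (b i)) (v := b i)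
      ?_ ?_ ?_ (fun y _ => (hasFDerivAt_kern_sq y).differentiableAt)
      (fun y _ => (hg i y).differentiableAt)
    · rw [← integral_const_mul]
      calc _ = - ∫ y, fderiv ℝ (fun y : E => kern y ^ 2 / 4) y (b i) *
                fderiv ℝ h (x + s • y) (b i) ∂μ := by
            rw [← integral_neg]
            refine integral_congr_ae (Eventually.of_forall fun y => ?_)
            simp only [hψ]
            simp [real_inner_comm]
            ring
        _ = _ := by
            rw [← hi]
            refine integral_congr_ae (Eventually.of_forall fun y => ?_)
            simp only [(hg i y).fderiv]
            simp
            ring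
    · have : Continuous fun y => -(inner ℝ y (b i)) * fderiv ℝ h (x + s • y) (b i) := by fun_prop
      refine (integrable_kern_mul μ this).congr (Eventually.of_forall fun y => ?_)
      simp only [hψ]
      simp
      ring
    · refine Continuous.integrable_of_hasCompactSupport ?_ hcs.mul_right
      simp only [(hg i _).fderiv]
      refine hcψ.mul ?_
      simp only [smul_apply, ContinuousLinearMap.comp_apply,
        ContinuousLinearMap.apply_apply]
      fun_prop
    · refine Continuous.integrable_of_hasCompactSupport ?_ hcs.mul_right
      fun_prop
  have e1 : ∀ y, kern y * fderiv ℝ h (x + s • y) y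
      = ∑ i, kern y * (inner ℝ (b i) y * fderiv ℝ h (x + s • y) (b i)) := by
    intro y
    rw [← Finset.mul_sum]
    congr 1
    have : fderiv ℝ h (x + s • y) y = fderiv ℝ h (x + s • y) (∑ i, inner ℝ (b i) y • b i) := by
      rw [b.sum_repr' y]
    rw [this, map_sum]
    simp
  have e2 : ∀ y, kern y ^ 2 / 4 * Δ h (x + s • y)
      = ∑ i, kern y ^ 2 / 4 * fderiv ℝ (fderiv ℝ h) (x + s • y) (b i) (b i) := by
    intro y
    rw [laplacian_eq_sum_fderiv b, Finset.mul_sum]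
  simp only [e1, e2]
  rw [integral_finsetSum, integral_finsetSum, Finset.mul_sum]
  · exact Finset.sum_congr rfl fun i _ => key i
  · intro i _
    refine Continuous.integrable_of_hasCompactSupport ?_ hcs.mul_right
    fun_prop
  · intro i _
    refine integrable_kern_mul μ ?_
    fun_prop

theorem hasDerivAt_integral_kern {h : E → ℝ} (hh : ContDiff ℝ 2 h) (x : E) (s : ℝ) :
    HasDerivAt (fun s : ℝ => ∫ y, kern y * h (x + s • y) ∂μ)
      (∫ y, kern y * fderiv ℝ h (x + s • y) y ∂μ) s := by
  have hc1 : Continuous (fderiv ℝ h) := hh.continuous_fderiv (by norm_num)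
  have hc := hh.continuous
  obtain ⟨C, hC⟩ := (isCompact_closedBall x (|s| + 1)).exists_bound_of_continuousOn
    (f := fderiv ℝ h) hc1.continuousOn
  refine (hasDerivAt_integral_of_dominated_loc_of_deriv_le (μ := μ)
    (F := fun s y => kern y * h (x + s • y)) (F' := fun s y => kern y * fderiv ℝ h (x + s • y) y)
    (bound := fun y => kern y * C)
    (s := ball s 1) (ball_mem_nhds s one_pos) ?_ ?_ ?_ ?_ ?_ ?_).2
  · refine Eventually.of_forall fun t => ?_
    have : Continuous fun y => h (x + t • y) := by fun_prop
    exact (integrable_kern_mul μ this).aestronglyMeasurable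
  · have : Continuous fun y => h (x + s • y) := by fun_prop
    exact integrable_kern_mul μ this
  · have : Continuous fun y => fderiv ℝ h (x + s • y) y := by fun_prop
    exact (integrable_kern_mul μ this).aestronglyMeasurable
  · refine Eventually.of_forall fun y t ht => ?_
    rw [norm_mul, Real.norm_of_nonneg (kern_nonneg y)]
    rcases le_or_gt 1 ‖y‖ with hy | hy
    · simp [kern_eq_zero hy]
    · refine mul_le_mul_of_nonneg_left ?_ (kern_nonneg y)
      have ht' : |t| ≤ |s| + 1 := by
        have h1 : |t - s| < 1 := by simpa [Real.dist_eq] using ht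
        have := abs_add_le (t - s) s
        rw [sub_add_cancel] at this; linarith
      have hm : x + t • y ∈ closedBall x (|s| + 1) := by
        simp only [mem_closedBall, dist_self_add_left, norm_smul, Real.norm_eq_abs]
        nlinarith [abs_nonneg t, norm_nonneg y]
      have h2 := hC _ hm
      calc ‖fderiv ℝ h (x + t • y) y‖ ≤ ‖fderiv ℝ h (x + t • y)‖ * ‖y‖ :=
            ContinuousLinearMap.le_opNorm _ _
        _ ≤ C * 1 := mul_le_mul h2 hy.le (norm_nonneg _) ((norm_nonneg _).trans h2)
        _ = C := mul_one C
  · exact (integrable_kern μ).mul_const C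
  · refine Eventually.of_forall fun y t _ => ?_
    have h1 : HasDerivAt (fun t : ℝ => x + t • y) y t := by
      simpa using ((hasDerivAt_id t).smul_const y).const_add x
    have h2 := ((hh.differentiable (by norm_num)) (x + t • y)).hasFDerivAt.comp_hasDerivAt t h1
    exact h2.const_mul (kern y)

/-- Approximate mean value property. The weighted mean over the ball of radius `s` has derivative `s
∫ (kern² / 4) Δh`, which is at most `R κ ∫ kern` because `kern² / 4 ≤ kern`; integrate from `0` to
`R`. -/
theorem abs_integral_kern_sub_le {h : E → ℝ} (hh : ContDiff ℝ 2 h) {x : E} {R κ : ℝ} (hR : 0 ≤ R)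
    (hΔ : ∀ z ∈ closedBall x R, |Δ h z| ≤ κ) :
    |(∫ y, kern y * h (x + R • y) ∂μ) - h x * ∫ y, kern y ∂μ|
      ≤ R ^ 2 * κ * ∫ y, kern y ∂μ := by
  set I := ∫ y : E, kern y ∂μ
  have hκ : 0 ≤ κ := (abs_nonneg _).trans (hΔ x (mem_closedBall_self hR))
  have hd : ∀ s ∈ Set.Icc 0 R, HasDerivWithinAt (fun s : ℝ => ∫ y, kern y * h (x + s • y) ∂μ)
      (s * ∫ y, kern y ^ 2 / 4 * Δ h (x + s • y) ∂μ) (Set.Icc 0 R) s := fun s _ => by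
    rw [← integral_kern_mul_fderiv μ hh x s]
    exact (hasDerivAt_integral_kern μ hh x s).hasDerivWithinAt
  have hb : ∀ s ∈ Set.Icc 0 R, ‖s * ∫ y, kern y ^ 2 / 4 * Δ h (x + s • y) ∂μ‖ ≤ R * (κ * I) := by
    intro s hs
    rw [norm_mul, Real.norm_of_nonneg hs.1]
    refine mul_le_mul hs.2 ?_ (norm_nonneg _) hR
    rw [← integral_const_mul]
    refine norm_integral_le_of_norm_le ((integrable_kern μ).const_mul κ)
      (Eventually.of_forall fun y => ?_)
    rcases le_or_gt 1 ‖y‖ with hy | hy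
    · simp [kern_eq_zero hy]
    · have hm : x + s • y ∈ closedBall x R := by
        simp only [mem_closedBall, dist_self_add_left, norm_smul, Real.norm_of_nonneg hs.1]
        nlinarith [hs.1, hs.2, norm_nonneg y]
      have h0 := kern_nonneg y
      have h1 := kern_le_one y
      rw [norm_mul, Real.norm_of_nonneg (by positivity), Real.norm_eq_abs]
      have h2 := hΔ _ hm
      calc kern y ^ 2 / 4 * |Δ h (x + s • y)| ≤ kern y * κ :=
            mul_le_mul (by nlinarith) h2 (abs_nonneg _) h0
        _ = κ * kern y := mul_comm _ _
  have := (convex_Icc 0 R).norm_image_sub_le_of_norm_hasDerivWithin_le hd hb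
    (Set.left_mem_Icc.2 hR) (Set.right_mem_Icc.2 hR)
  simp only [zero_smul, add_zero, sub_zero, Real.norm_eq_abs, abs_of_nonneg hR] at this
  rw [integral_mul_const, mul_comm I (h x)] at this
  calc _ ≤ _ := this
    _ = _ := by ring

/-- The constant in the Harnack inequality on a small ball. -/
def harnackConst (E : Type*) [NormedAddCommGroup E] [InnerProductSpace ℝ E] : ℝ :=
  5 / 9 * (1 / 3) ^ Module.finrank ℝ E

theorem harnackConst_pos : 0 < harnackConst E := by unfold harnackConst; positivity

theorem harnackConst_le : harnackConst E ≤ 5 / 9 := by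
  unfold harnackConst
  have : ((1 : ℝ) / 3) ^ Module.finrank ℝ E ≤ 1 := pow_le_one₀ (by norm_num) (by norm_num)
  linarith

/-- As `h ≥ 0`, the mean about `y` at radius `3r` dominates a fixed multiple of the mean about `x`
at radius `r`. Passing from means to point values costs `r²κ` at `x` and `9r²κ` at `y`, hence the
constant `10`. -/
theorem harnack_of_contDiff (μ : Measure E) [μ.IsAddHaarMeasure] {h : E → ℝ} (hh : ContDiff ℝ 2 h) {x y : E} {r κ : ℝ} (hr : 0 < r)
    (hxy : dist y x < r) (h0 : ∀ z ∈ ball x (4 * r), 0 ≤ h z)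
    (hΔ : ∀ z ∈ ball x (4 * r), |Δ h z| ≤ κ) :
    harnackConst E * h x - 10 * r ^ 2 * κ ≤ h y := by
  set I := ∫ y : E, kern y ∂μ with hI
  have hIpos : 0 < I := integral_kern_pos μ
  have hκ : 0 ≤ κ := (abs_nonneg _).trans (hΔ x (mem_ball_self (by linarith)))
  have hy := abs_integral_kern_sub_le μ hh (x := y) (R := 3 * r) (κ := κ) (by linarith)
    (fun z hz => hΔ z (by
      rw [mem_ball]; rw [mem_closedBall] at hz
      linarith [dist_triangle z y x]))
  have hx := abs_integral_kern_sub_le μ hh (x := x) (R := r) (κ := κ) hr.le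
    (fun z hz => hΔ z (by rw [mem_ball]; rw [mem_closedBall] at hz; linarith))
  have hcont := hh.continuous
  have hcomp : harnackConst E * ∫ z, kern z * h (x + r • z) ∂μ
      ≤ ∫ z, kern z * h (y + (3 * r) • z) ∂μ := by
    -- In units of `3r` about `y`, the ball of radius `r` about `x` has centre `v` and radius `1/3`.
    -- Translating by `v` and rescaling by `1/3` makes both integrals sample `h` at `x + r z`.
    set v := (3 * r)⁻¹ • (x - y) with hv
    have e1 : ∫ z, kern z * h (y + (3 * r) • z) ∂μ
        = ∫ z, kern (v + z) * h (y + (3 * r) • (v + z)) ∂μ :=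
      (integral_add_left_eq_self (fun z => kern z * h (y + (3 * r) • z)) v).symm
    have e2 := Measure.integral_comp_smul μ
      (fun z => kern (v + z) * h (y + (3 * r) • (v + z))) (1 / 3 : ℝ)
    have e3 : ∫ z, kern z * h (y + (3 * r) • z) ∂μ = (1 / 3) ^ Module.finrank ℝ E *
        ∫ z, kern (v + (1 / 3 : ℝ) • z) * h (x + r • z) ∂μ := by
      have e4 : ∀ z, y + (3 * r) • (v + (1 / 3 : ℝ) • z) = x + r • z := by
        intro z
        rw [hv, smul_add, smul_smul, smul_smul, mul_inv_cancel₀ (by positivity), one_smul]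
        have : 3 * r * (1 / 3) = r := by ring
        rw [this]; abel
      simp only [e4] at e2
      rw [e2, e1, smul_eq_mul, ← mul_assoc, abs_of_pos (by positivity), mul_inv_cancel₀ (by positivity), one_mul]
    rw [e3, harnackConst, mul_assoc, mul_left_comm, ← integral_const_mul]
    refine mul_le_mul_of_nonneg_left ?_ (by positivity)
    have hvn : ‖v‖ < 1 / 3 := by
      rw [hv, norm_smul, norm_inv, Real.norm_of_nonneg (by positivity), ← dist_eq_norm, dist_comm,
        inv_mul_lt_iff₀ (by positivity)]
      linarith
    refine integral_mono ?_ ?_ fun z => ?_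
    · have : Continuous fun z => h (x + r • z) := by fun_prop
      exact (integrable_kern_mul μ this).const_mul _
    · refine Continuous.integrable_of_hasCompactSupport ?_ ?_
      · have := continuous_kern (E := E)
        fun_prop
      · refine HasCompactSupport.intro (isCompact_closedBall (0 : E) 6) fun z hz => ?_
        simp only [mem_closedBall, dist_zero_right, not_le] at hz
        rw [kern_eq_zero, zero_mul]
        have := norm_sub_norm_le ((1 / 3 : ℝ) • z) (-v)
        rw [norm_neg, sub_neg_eq_add, add_comm _ v, norm_smul] at this
        norm_num at this
        linarith
    · have h3 : ‖(1 / 3 : ℝ) • z‖ = ‖z‖ / 3 := by rw [norm_smul]; norm_num; ring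
      have h4 : ‖z‖ / 3 ≤ ‖v + (1 / 3 : ℝ) • z‖ + ‖v‖ := by
        have := norm_sub_le (v + (1 / 3 : ℝ) • z) v
        rwa [add_sub_cancel_left, h3] at this
      have h5 : ‖v + (1 / 3 : ℝ) • z‖ ≤ ‖v‖ + ‖z‖ / 3 := by
        have := norm_add_le v ((1 / 3 : ℝ) • z); rwa [h3] at this
      show 5 / 9 * (kern z * h (x + r • z)) ≤ kern (v + (1 / 3 : ℝ) • z) * h (x + r • z)
      rcases le_or_gt 1 ‖v + (1 / 3 : ℝ) • z‖ with hw | hw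
      · rw [kern_eq_zero hw, kern_eq_zero (y := z) (by linarith)]; simp
      · have hpos : 0 ≤ h (x + r • z) := by
          refine h0 _ ?_
          rw [mem_ball, dist_self_add_left, norm_smul, Real.norm_of_nonneg hr.le]
          nlinarith
        rcases le_or_gt 1 ‖z‖ with hz | hz
        · rw [kern_eq_zero hz]
          have := mul_nonneg (kern_nonneg (v + (1 / 3 : ℝ) • z)) hpos
          linarith
        -- The argument has norm less than `1/3 + 1/3`, and `1 - (2/3)² = 5/9`.
        · have hk : 5 / 9 ≤ kern (v + (1 / 3 : ℝ) • z) := by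
            refine le_trans ?_ (le_max_left _ _)
            nlinarith [norm_nonneg (v + (1 / 3 : ℝ) • z)]
          have hk1 := kern_le_one z
          rw [← mul_assoc]
          exact mul_le_mul_of_nonneg_right (by linarith) hpos
  have hc := harnackConst_pos (E := E)
  have hc' := harnackConst_le (E := E)
  rw [abs_le] at hx hy
  refine le_of_mul_le_mul_right ?_ hIpos
  have h1 : harnackConst E * (h x * I - r ^ 2 * κ * I) ≤ h y * I + (3 * r) ^ 2 * κ * I :=
    (mul_le_mul_of_nonneg_left (by linarith) hc.le).trans (hcomp.trans (by linarith))
  have h2 : harnackConst E * (r ^ 2 * κ * I) ≤ 1 * (r ^ 2 * κ * I) :=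
    mul_le_mul_of_nonneg_right (by linarith) (by positivity)
  nlinarith

/-- Harnack inequality on a small ball, for functions that are `C²` near that ball only. -/
theorem harnack_ball (μ : Measure E) [μ.IsAddHaarMeasure] {h : E → ℝ} {x y : E} {r κ : ℝ}
    (hr : 0 < r) (hxy : dist y x < r)
    (hh : ∀ z ∈ ball x (5 * r), ContDiffAt ℝ 2 h z) (h0 : ∀ z ∈ ball x (5 * r), 0 ≤ h z)
    (hΔ : ∀ z ∈ ball x (5 * r), |Δ h z| ≤ κ) :
    harnackConst E * h x - 10 * r ^ 2 * κ ≤ h y := by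
  -- A cutoff equal to `1` on the ball of radius `4r` and supported in radius `4.5r` turns `h` into
  -- a global `C²` function without changing it where the previous lemma looks.
  let χ : ContDiffBump x := ⟨4 * r, 4.5 * r, by linarith, by linarith⟩
  have hχ1 : ∀ z ∈ ball x (4 * r), (fun z => χ z * h z) =ᶠ[𝓝 z] h := by
    intro z hz
    filter_upwards [isOpen_ball.mem_nhds hz] with w hw
    rw [χ.one_of_mem_closedBall (ball_subset_closedBall hw), one_mul]
  have hcd : ContDiff ℝ 2 fun z => χ z * h z := by
    rw [contDiff_iff_contDiffAt]
    intro z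
    by_cases hz : z ∈ ball x (5 * r)
    · exact (χ.contDiff.contDiffAt).mul (hh z hz)
    · have : (fun z => χ z * h z) =ᶠ[𝓝 z] fun _ => 0 := by
        have hz' : z ∈ (closedBall x (4.5 * r))ᶜ := by
          simp only [Set.mem_compl_iff, mem_closedBall, mem_ball, not_le, not_lt] at hz ⊢
          linarith
        filter_upwards [isClosed_closedBall.isOpen_compl.mem_nhds hz'] with w hw
        have : χ w = 0 := χ.zero_of_le_dist (by
          simp only [Set.mem_compl_iff, mem_closedBall, not_le] at hw
          exact hw.le)
        rw [this, zero_mul]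
      exact contDiffAt_const.congr_of_eventuallyEq this
  have hsub : ball x (4 * r) ⊆ ball x (5 * r) := ball_subset_ball (by linarith)
  have := harnack_of_contDiff μ hcd (x := x) (y := y) (κ := κ) hr hxy
    (fun z hz => by rw [(hχ1 z hz).eq_of_nhds]; exact h0 z (hsub hz))
    (fun z hz => by
      rw [(InnerProductSpace.laplacian_congr_nhds (hχ1 z hz)).eq_of_nhds]; exact hΔ z (hsub hz))
  have hy4 : y ∈ ball x (4 * r) := by rw [mem_ball]; linarith
  rwa [(hχ1 x (mem_ball_self (by linarith))).eq_of_nhds, (hχ1 y hy4).eq_of_nhds] at this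

/-- Harnack inequality along a segment, by a chain of `N` balls of radius `r`. -/
theorem harnack_segment (μ : Measure E) [μ.IsAddHaarMeasure] {h : E → ℝ} {x y : E} {r κ : ℝ}
    (hr : 0 < r) {N : ℕ} (hN : dist y x < N * r)
    (hh : ∀ p ∈ segment ℝ x y, ∀ z ∈ ball p (5 * r),
      ContDiffAt ℝ 2 h z ∧ 0 ≤ h z ∧ |Δ h z| ≤ κ) :
    harnackConst E ^ N * h x - 30 * r ^ 2 * κ ≤ h y := by
  have hc := harnackConst_pos (E := E)
  have hc' := harnackConst_le (E := E)
  have hN0 : (0 : ℝ) < N := by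
    have h1 := dist_nonneg (x := y) (y := x)
    by_contra hcon
    have : (N : ℝ) ≤ 0 := not_lt.1 hcon
    nlinarith
  have hκ : 0 ≤ κ := (abs_nonneg _).trans
    (hh x (left_mem_segment ℝ x y) x (mem_ball_self (by linarith))).2.2
  set p : ℕ → E := fun k => AffineMap.lineMap x y ((k : ℝ) / N) with hp
  have hstep : ∀ k : ℕ, k ≤ N → harnackConst E ^ k * h x - 30 * r ^ 2 * κ ≤ h (p k) := by
    intro k
    induction k with
    | zero =>
      intro _
      have : p 0 = x := by simp [hp]
      rw [this]
      have : 0 ≤ 30 * r ^ 2 * κ := by positivity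
      simp only [pow_zero, one_mul]
      linarith
    | succ k ih =>
      intro hk
      have ih := ih (by omega)
      have hkN : ((k : ℝ) + 1) ≤ N := by exact_mod_cast hk
      have hmem : p k ∈ segment ℝ x y := by
        rw [segment_eq_image_lineMap]
        exact ⟨_, ⟨by positivity, by rw [div_le_one hN0]; linarith⟩, rfl⟩
      have hd : dist (p (k + 1)) (p k) < r := by
        rw [hp]
        simp only [dist_lineMap_lineMap, Real.dist_eq]
        push_cast
        rw [← sub_div, add_sub_cancel_left, abs_of_pos (by positivity), one_div,
          inv_mul_lt_iff₀ hN0, dist_comm]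
        exact hN
      have := harnack_ball μ hr hd (κ := κ) (fun z hz => (hh _ hmem z hz).1)
        (fun z hz => (hh _ hmem z hz).2.1) (fun z hz => (hh _ hmem z hz).2.2)
      have h1 : harnackConst E * (harnackConst E ^ k * h x - 30 * r ^ 2 * κ)
          ≤ harnackConst E * h (p k) := mul_le_mul_of_nonneg_left ih hc.le
      -- The accumulated error stays below `30r²κ` for every number of steps, since `(5/9)·30 + 10 ≤
      -- 30`.
      have h2 : harnackConst E * (30 * r ^ 2 * κ) ≤ 5 / 9 * (30 * r ^ 2 * κ) :=
        mul_le_mul_of_nonneg_right hc' (by positivity)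
      have h3 : 0 ≤ r ^ 2 * κ := by positivity
      rw [pow_succ]
      nlinarith
  have := hstep N le_rfl
  have e : p N = y := by simp [hp, div_self hN0.ne']
  rwa [e] at this

end Harnack


/-! ### Tangential projection, the polynomial `P` with a tangential paraboloid, and their jets. -/

section Geometry

variable {d : ℕ}

theorem norm_eLast : ‖eLast d‖ = 1 := by simp [eLast]

theorem inner_eLast_self : inner ℝ (eLast d) (eLast d) = (1 : ℝ) := by
  rw [real_inner_self_eq_norm_sq, norm_eLast]; norm_num

theorem abs_inner_eLast_le (x : Eu d) : |inner ℝ x (eLast d)| ≤ ‖x‖ := by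
  have := abs_real_inner_le_norm x (eLast d)
  rwa [norm_eLast, mul_one] at this

/-- Orthogonal projection onto the hyperplane `x_n = 0`. -/
def tproj (d : ℕ) : Eu d →L[ℝ] Eu d :=
  ContinuousLinearMap.id ℝ (Eu d) - (innerSL ℝ (eLast d)).smulRight (eLast d)

theorem tproj_apply (x : Eu d) : tproj d x = x - inner ℝ (eLast d) x • eLast d := by
  simp [tproj]

theorem inner_tproj_left (x y : Eu d) :
    inner ℝ (tproj d x) y = inner ℝ x y - inner ℝ (eLast d) x * inner ℝ (eLast d) y := by
  rw [tproj_apply, inner_sub_left, inner_smul_left]; simp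

theorem inner_tproj_right (x y : Eu d) :
    inner ℝ x (tproj d y) = inner ℝ x y - inner ℝ (eLast d) x * inner ℝ (eLast d) y := by
  rw [real_inner_comm, inner_tproj_left, real_inner_comm y x]; ring

theorem tproj_symm : (tproj d : Eu d →ₗ[ℝ] Eu d).IsSymmetric := fun x y => by
  change inner ℝ (tproj d x) y = inner ℝ x (tproj d y)
  rw [inner_tproj_left, inner_tproj_right]

theorem tproj_eLast : tproj d (eLast d) = 0 := by
  rw [tproj_apply, inner_eLast_self]; simp

theorem inner_tproj_eLast (x : Eu d) : inner ℝ (tproj d x) (eLast d) = (0 : ℝ) := by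
  rw [inner_tproj_left, inner_eLast_self, real_inner_comm]; simp

/-- Square of the length of the tangential part. -/
def tang (y : Eu d) : ℝ := inner ℝ y (tproj d y)

theorem tang_eq (y : Eu d) : tang y = ‖y‖ ^ 2 - (inner ℝ y (eLast d)) ^ 2 := by
  rw [tang, inner_tproj_right, real_inner_self_eq_norm_sq, real_inner_comm y (eLast d)]; ring

theorem tang_eq_norm_sq (y : Eu d) : tang y = ‖tproj d y‖ ^ 2 := by
  rw [tang, ← real_inner_self_eq_norm_sq, inner_tproj_left, inner_tproj_right, inner_tproj_right,
    inner_eLast_self]; ring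

theorem tang_nonneg (y : Eu d) : 0 ≤ tang y := by rw [tang_eq_norm_sq]; positivity

theorem tang_le (y : Eu d) : tang y ≤ ‖y‖ ^ 2 := by
  rw [tang_eq]; nlinarith [sq_nonneg (inner ℝ y (eLast d))]

theorem norm_tproj_le (y : Eu d) : ‖tproj d y‖ ≤ ‖y‖ := by
  have h := tang_le y
  rw [tang_eq_norm_sq] at h
  exact (sq_le_sq₀ (norm_nonneg _) (norm_nonneg _)).1 h

theorem opNorm_tproj_le : ‖tproj d‖ ≤ 1 :=
  ContinuousLinearMap.opNorm_le_bound _ zero_le_one fun y => by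
    rw [one_mul]; exact norm_tproj_le y

theorem continuous_tang : Continuous (tang : Eu d → ℝ) := by unfold tang; fun_prop

theorem tang_sub (x x₀ : Eu d) : tang (x - x₀)
    = inner ℝ x (tproj d x) - 2 * inner ℝ (tproj d x₀) x + tang x₀ := by
  unfold tang
  have h1 : inner ℝ x (tproj d x₀) = inner ℝ (tproj d x₀) x := real_inner_comm _ _
  have h2 : inner ℝ x₀ (tproj d x) = inner ℝ (tproj d x₀) x := (tproj_symm x₀ x).symm
  rw [map_sub, inner_sub_left, inner_sub_right, inner_sub_right, h1, h2]
  ring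

theorem opTrace_tproj : opTrace (tproj d) = d := by
  rw [opTrace, LinearMap.trace_eq_sum_inner _ (stdOrthonormalBasis ℝ (Eu d))]
  set b := stdOrthonormalBasis ℝ (Eu d)
  have h : ∀ i, inner ℝ (b i) ((tproj d : Eu d →ₗ[ℝ] Eu d) (b i))
      = 1 - inner ℝ (eLast d) (b i) * inner ℝ (b i) (eLast d) := by
    intro i
    change inner ℝ (b i) (tproj d (b i)) = _
    rw [inner_tproj_right, real_inner_self_eq_norm_sq, b.orthonormal.1 i,
      real_inner_comm (eLast d) (b i)]; norm_num
  simp only [h]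
  rw [Finset.sum_sub_distrib, b.sum_inner_mul_inner, inner_eLast_self]
  simp

theorem abs_opTrace_le (M : Eu d →L[ℝ] Eu d) : |opTrace M| ≤ (d + 1) * ‖M‖ := by
  rw [opTrace, LinearMap.trace_eq_sum_inner _ (stdOrthonormalBasis ℝ (Eu d))]
  set b := stdOrthonormalBasis ℝ (Eu d)
  calc _ ≤ ∑ i, |inner ℝ (b i) ((M : Eu d →ₗ[ℝ] Eu d) (b i))| := Finset.abs_sum_le_sum_abs _ _
    _ ≤ ∑ i, ‖M‖ := by
        refine Finset.sum_le_sum fun i _ => (abs_real_inner_le_norm _ _).trans ?_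
        have := M.le_opNorm (b i)
        rw [b.orthonormal.1 i, mul_one] at this
        rw [b.orthonormal.1 i, one_mul]; exact this
    _ = _ := by simp

/-- The polynomial `P` lowered by a tangential paraboloid centred at `x₀`. -/
def paraQ (M : Eu d →L[ℝ] Eu d) (x₀ : Eu d) (k m : ℝ) (x : Eu d) : ℝ :=
  polyP M (eLast d) x + k - m * tang (x - x₀)

theorem continuous_polyP (M : Eu d →L[ℝ] Eu d) (ω : Eu d) : Continuous (polyP M ω) := by
  unfold polyP; fun_prop

theorem continuous_paraQ (M : Eu d →L[ℝ] Eu d) (x₀ : Eu d) (k m : ℝ) :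
    Continuous (paraQ M x₀ k m) := by
  have := continuous_tang (d := d)
  have := continuous_polyP M (eLast d)
  unfold paraQ; fun_prop

/-- Gradient of `paraQ`. -/
def gradQ (M : Eu d →L[ℝ] Eu d) (x₀ : Eu d) (m : ℝ) (x : Eu d) : Eu d :=
  eLast d - M x - (2 * m) • tproj d (x - x₀)

theorem hasJet_polyP {M : Eu d →L[ℝ] Eu d} (hM : (M : Eu d →ₗ[ℝ] Eu d).IsSymmetric) (x : Eu d) :
    HasJet (polyP M (eLast d)) x (eLast d - M x) (-opTrace M) := by
  have h := (hasJet_inner (eLast d) x).sub ((hasJet_inner_map M hM x).const_mul (1 / 2))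
  have e : polyP M (eLast d) = fun y => inner ℝ (eLast d) y - 1 / 2 * inner ℝ y (M y) := by
    funext y; rw [polyP, real_inner_comm]
  rw [e]
  refine h.congr ?_ ?_
  · rw [smul_smul]; norm_num
  · rw [opTrace]; ring

theorem hasJet_paraQ {M : Eu d →L[ℝ] Eu d} (hM : (M : Eu d →ₗ[ℝ] Eu d).IsSymmetric)
    (x₀ : Eu d) (k m : ℝ) (x : Eu d) :
    HasJet (paraQ M x₀ k m) x (gradQ M x₀ m x) (-opTrace M - 2 * m * d) := by
  have h1 := (hasJet_polyP hM x).add (hasJet_const k x)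
  have h2 := (((hasJet_inner_map (tproj d) tproj_symm x).sub
    ((hasJet_inner (tproj d x₀) x).const_mul 2)).add (hasJet_const (tang x₀) x)).const_mul m
  have h := h1.sub h2
  have e : paraQ M x₀ k m = fun y => polyP M (eLast d) y + k -
      m * (inner ℝ y (tproj d y) - 2 * inner ℝ (tproj d x₀) y + tang x₀) := by
    funext y; rw [paraQ, tang_sub]
  rw [e]
  refine h.congr ?_ ?_
  · rw [gradQ, map_sub]; module
  · have := opTrace_tproj (d := d)
    rw [opTrace] at this
    rw [this]; ring

/-- The weighted quadratic function of `paraQ` used as a barrier on one side. -/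
def barW (M : Eu d →L[ℝ] Eu d) (x₀ : Eu d) (k m : ℝ) (A : Eu d) (p m₂ : ℝ) (x : Eu d) : ℝ :=
  (1 + inner ℝ A x) * (p * paraQ M x₀ k m x + m₂ * (paraQ M x₀ k m x * paraQ M x₀ k m x))

theorem hasJet_barW {M : Eu d →L[ℝ] Eu d} (hM : (M : Eu d →ₗ[ℝ] Eu d).IsSymmetric)
    (x₀ : Eu d) (k m : ℝ) (A : Eu d) (p m₂ : ℝ) (x : Eu d) :
    HasJet (barW M x₀ k m A p m₂) x
      ((1 + inner ℝ A x) • ((p + 2 * m₂ * paraQ M x₀ k m x) • gradQ M x₀ m x)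
        + (p * paraQ M x₀ k m x + m₂ * (paraQ M x₀ k m x * paraQ M x₀ k m x)) • A)
      ((1 + inner ℝ A x) * ((p + 2 * m₂ * paraQ M x₀ k m x) * (-opTrace M - 2 * m * d)
        + 2 * m₂ * ‖gradQ M x₀ m x‖ ^ 2)
        + 2 * (p + 2 * m₂ * paraQ M x₀ k m x) * inner ℝ A (gradQ M x₀ m x)) := by
  have hQ := hasJet_paraQ hM x₀ k m x
  have hF := (hQ.const_mul p).add ((hQ.mul hQ).const_mul m₂)
  have hA := (hasJet_const 1 x).add (hasJet_inner A x)
  refine (hA.mul hF).congr ?_ ?_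
  · rw [zero_add]; module
  · rw [zero_add, zero_add, inner_add_right, inner_smul_right, inner_smul_right, inner_add_right,
      inner_smul_right, real_inner_self_eq_norm_sq]; ring

theorem inner_map_eLast {M : Eu d →L[ℝ] Eu d} (hM : (M : Eu d →ₗ[ℝ] Eu d).IsSymmetric)
    (h0 : M (eLast d) = 0) (x : Eu d) : inner ℝ (M x) (eLast d) = (0 : ℝ) := by
  have := hM x (eLast d)
  simp only [ContinuousLinearMap.coe_coe] at this
  rw [this, h0, inner_zero_right]

/-- Both `M x` and the tangential projection are orthogonal to `eₙ`, so Pythagoras applies. In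
particular the gradient never has norm below `1`. -/
theorem norm_gradQ_sq {M : Eu d →L[ℝ] Eu d} (hM : (M : Eu d →ₗ[ℝ] Eu d).IsSymmetric)
    (h0 : M (eLast d) = 0) (x₀ : Eu d) (m : ℝ) (x : Eu d) :
    ‖gradQ M x₀ m x‖ ^ 2 = 1 + ‖M x + (2 * m) • tproj d (x - x₀)‖ ^ 2 := by
  rw [gradQ, sub_sub, norm_sub_sq_real, norm_eLast, real_inner_comm, inner_add_left,
    inner_map_eLast hM h0, inner_smul_left, inner_tproj_eLast]
  simp

theorem one_le_norm_gradQ {M : Eu d →L[ℝ] Eu d} (hM : (M : Eu d →ₗ[ℝ] Eu d).IsSymmetric)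
    (h0 : M (eLast d) = 0) (x₀ : Eu d) (m : ℝ) (x : Eu d) : 1 ≤ ‖gradQ M x₀ m x‖ := by
  have := norm_gradQ_sq hM h0 x₀ m x
  nlinarith [sq_nonneg ‖M x + (2 * m) • tproj d (x - x₀)‖, norm_nonneg (gradQ M x₀ m x)]

end Geometry

/-! ### The scalar inequality behind the strict sub- and supersolution property. -/

section Estimates

/-- The leading term is `2(μ/r)(B G - D)`, where `D` counts tangential directions and `G ≥ 1` is the
squared gradient; with `B = D + 1` it is of size `μ/r` with the right sign. Errors proportional to
`κμ` are absorbed by a quarter of `μ/r`, errors proportional to `κε` by `hμε`. -/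
theorem barrier_laplacian_scalar {σ μ r κ ε n C B D s z tr G Ae AM Aπ : ℝ}
    (hσ : σ = 1 ∨ σ = -1) (hμ : 0 < μ) (hr : 0 < r) (hr1 : r ≤ 1) (hκ : 0 ≤ κ) (hε : 0 < ε)
    (hn : 0 ≤ n) (hC : 0 ≤ C) (hB : B = D + 1) (hD : 0 ≤ D) (hs : |s| ≤ κ) (hz : |z| ≤ C)
    (htr : |tr| ≤ n * κ) (htrs : |tr * s| ≤ n * (κ * ε)) (hG : 1 ≤ G) (hAe : |Ae| ≤ κ)
    (hAM : |AM| ≤ κ * ε) (hAπ : |Aπ| ≤ κ * r)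
    (hDμ : D * (μ * C) ≤ 1 / 4) (hμC : μ * C ≤ 1 / 4) (hκ1 : κ ≤ 1 / 4)
    (hκ2 : κ * ((n + 2) * C + 8) ≤ 1 / 4) (hμε : κ * ε * (2 * n + 5) < μ / (2 * r)) :
    κ * ε < σ * ((1 + s) * ((1 + σ * μ * z) * (-tr - 2 * (σ * μ / r) * D)
        + 2 * (σ * μ * B / r) * G)
      + 2 * (1 + σ * μ * z) * (Ae - AM - 2 * (σ * μ / r) * Aπ) - (2 * Ae - tr)) := by
  have hσ2 : σ * σ = 1 := by rcases hσ with rfl | rfl <;> norm_num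
  have hσa : |σ| = 1 := by rcases hσ with rfl | rfl <;> norm_num
  have hσn : σ ^ 2 = 1 := by rw [pow_two, hσ2]
  have hμr : 0 < μ / r := by positivity
  have hμr' : μ ≤ μ / r := by rw [le_div_iff₀ hr]; nlinarith
  have hz1 : |μ * z| ≤ μ * C := by
    rw [abs_mul, abs_of_pos hμ]; exact mul_le_mul_of_nonneg_left hz hμ.le
  have e : σ * ((1 + s) * ((1 + σ * μ * z) * (-tr - 2 * (σ * μ / r) * D)
        + 2 * (σ * μ * B / r) * G)
      + 2 * (1 + σ * μ * z) * (Ae - AM - 2 * (σ * μ / r) * Aπ) - (2 * Ae - tr))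
      = (1 + s) * (2 * (μ / r)) * (B * G - D * (1 + σ * (μ * z)))
        - (tr * (μ * z) + σ * (tr * s) + (tr * s) * (μ * z))
        + (2 * (μ * z) * Ae - 2 * σ * AM - 2 * (μ * z) * AM - 4 * (μ / r) * Aπ
          - 4 * (σ * (μ * z)) * ((μ / r) * Aπ)) := by
    have : σ * σ = 1 := hσ2
    linear_combination (-(s * tr * (μ * z)) - tr * (μ * z) - 2 * (μ / r) * D * (1 + s)
      - 2 * (μ / r) * D * (1 + s) * (σ * (μ * z)) + 2 * (μ / r) * B * G * (1 + s)
      + 2 * (μ * z) * Ae - 2 * (μ * z) * AM - 4 * (μ / r) * Aπ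
      - 4 * (σ * (μ * z)) * ((μ / r) * Aπ)) * this
  rw [e]
  set y := μ * z with hy
  have hy4 : |y| ≤ 1 / 4 := hz1.trans hμC
  have hσy : |σ * y| ≤ μ * C := by rw [abs_mul, hσa, one_mul]; exact hz1
  -- Half of `μ/r` is reserved for the `κε` errors and a quarter for the `κμ` errors.
  have hmain : (1 / 2) * (μ / r) + (1 / 4) * (μ / r) ≤ (1 + s) * (2 * (μ / r)) * (B * G - D * (1 + σ * y)) := by
    have h1 : 3 / 4 ≤ B * G - D * (1 + σ * y) := by
      have h2 : D * (σ * y) ≤ D * (μ * C) := mul_le_mul_of_nonneg_left ((le_abs_self _).trans hσy) hD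
      have h3 : B * 1 ≤ B * G := mul_le_mul_of_nonneg_left hG (by linarith)
      linarith
    have h4 : 3 / 4 ≤ 1 + s := by linarith [(abs_le.1 hs).1]
    have h5 : (3 / 4) * (2 * (μ / r)) ≤ (1 + s) * (2 * (μ / r)) :=
      mul_le_mul_of_nonneg_right h4 (by positivity)
    calc _ ≤ (3 / 4) * (2 * (μ / r)) * (3 / 4) := by linarith
      _ ≤ _ := mul_le_mul h5 h1 (by norm_num) (by positivity)
  have a1 : |tr * y| ≤ n * κ * (μ * C) := by
    rw [abs_mul]; exact mul_le_mul htr hz1 (abs_nonneg _) (by positivity)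
  have a2 : |σ * (tr * s)| ≤ n * (κ * ε) := by rw [abs_mul, hσa, one_mul]; exact htrs
  have a3 : |tr * s * y| ≤ n * (κ * ε) * (1 / 4) := by
    rw [abs_mul]; exact mul_le_mul htrs hy4 (abs_nonneg _) (by positivity)
  have a4 : |y * Ae| ≤ μ * C * κ := by
    rw [abs_mul]; exact mul_le_mul hz1 hAe (abs_nonneg _) (by positivity)
  have a5 : |σ * AM| ≤ κ * ε := by rw [abs_mul, hσa, one_mul]; exact hAM
  have a6 : |y * AM| ≤ 1 / 4 * (κ * ε) := by
    rw [abs_mul]; exact mul_le_mul hy4 hAM (abs_nonneg _) (by norm_num)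
  have a7 : |μ / r * Aπ| ≤ κ * μ := by
    rw [abs_mul, abs_of_pos hμr]
    calc μ / r * |Aπ| ≤ μ / r * (κ * r) := mul_le_mul_of_nonneg_left hAπ hμr.le
      _ = κ * μ := by field_simp
  have a8 : |σ * y * (μ / r * Aπ)| ≤ 1 / 4 * (κ * μ) := by
    rw [abs_mul]
    exact mul_le_mul (hσy.trans hμC) a7 (abs_nonneg _) (by norm_num)
  rw [abs_le] at a1 a2 a3 a4 a5 a6 a7 a8
  have h9 : κ * ((n + 2) * C + 8) * μ ≤ 1 / 4 * (μ / r) := by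
    calc _ ≤ 1 / 4 * μ := mul_le_mul_of_nonneg_right hκ2 hμ.le
      _ ≤ _ := by linarith
  have h10 : μ / (2 * r) = 1 / 2 * (μ / r) := by ring
  rw [h10] at hμε
  have p1 := mul_nonneg hκ hμ.le
  have p2 := mul_nonneg hκ hε.le
  have p3 := mul_nonneg hn (mul_nonneg hκ hε.le)
  linarith [a1.2, a2.2, a3.2, a4.1, a5.2, a6.2, a7.2, a8.2]

end Estimates


/-! ### Sliding, one-sided slopes, the barrier profile, and phases. -/

section Tools

/-- Sliding: if `g t₀ ≥ 0` on the compact set `D` and no contact point with `g t ≥ 0` is a limit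
of points where `g` is negative, then `g t₁ ≥ 0` on `D`. -/
theorem sliding {E : Type*} [TopologicalSpace E] {D : Set E} (hD : IsCompact D) {g : ℝ → E → ℝ}
    {t₀ t₁ : ℝ} (ht : t₀ ≤ t₁)
    (hg : ContinuousOn (fun p : ℝ × E => g p.1 p.2) (Set.univ ×ˢ D))
    (h0 : ∀ x ∈ D, 0 ≤ g t₀ x)
    (hno : ∀ t ∈ Set.Ico t₀ t₁, ∀ x ∈ D, (∀ y ∈ D, 0 ≤ g t y) → g t x = 0 →
      (t, x) ∈ closure {p : ℝ × E | p.2 ∈ D ∧ g p.1 p.2 < 0} → False) :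
    ∀ x ∈ D, 0 ≤ g t₁ x := by
  set S : Set ℝ := {t | ∀ x ∈ D, 0 ≤ g t x} with hS
  have hcl : IsClosed (S ∩ Set.Icc t₀ t₁) := by
    refine IsClosed.inter ?_ isClosed_Icc
    have : S = ⋂ x ∈ D, {t | 0 ≤ g t x} := by ext t; simp [hS]
    rw [this]
    refine isClosed_biInter fun x hx => isClosed_le continuous_const ?_
    rw [← continuousOn_univ]
    exact hg.comp (f := fun t : ℝ => (t, x)) (by fun_prop) fun t _ => ⟨trivial, hx⟩
  have := hcl.Icc_subset_of_forall_mem_nhdsWithin h0 ?_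
  · exact this (Set.right_mem_Icc.2 ht)
  · rintro t ⟨htS, htI⟩
    refine mem_nhdsWithin_of_mem_nhds ?_
    have := hD.eventually_forall_of_forall_eventually (x₀ := t)
      (P := fun s x => x ∈ D → 0 ≤ g s x) ?_
    · filter_upwards [this] with s hs x hx using hs x hx hx
    · intro x hx
      -- Openness to the right: near a point with positive gap continuity suffices, and near a
      -- contact point the gap stays nonnegative for all close times and points, unless the contact
      -- is a limit of violations. Compactness makes this uniform in `x`.
      rcases (htS x hx).eq_or_lt with h | h
      · have hc : (t, x) ∉ closure {p : ℝ × E | p.2 ∈ D ∧ g p.1 p.2 < 0} :=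
          fun hc => hno t htI x hx htS h.symm hc
        filter_upwards [isClosed_closure.isOpen_compl.mem_nhds hc] with p hp hpD
        by_contra hneg
        exact hp (subset_closure ⟨hpD, not_le.1 hneg⟩)
      · have h1 := (hg (t, x) ⟨trivial, hx⟩).eventually (lt_mem_nhds h)
        rw [eventually_nhdsWithin_iff] at h1
        filter_upwards [h1] with p hp hpD using (hp ⟨trivial, hpD⟩).le

theorem hasDerivWithinAt_le_of_eventually_le {φ ψ : ℝ → ℝ} {p q : ℝ}
    (hφ : HasDerivWithinAt φ p (Set.Ici 0) 0) (hψ : HasDerivWithinAt ψ q (Set.Ici 0) 0)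
    (h0 : φ 0 = ψ 0) (h : ∀ᶠ t in 𝓝[>] (0 : ℝ), φ t ≤ ψ t) : p ≤ q := by
  have h1 := hasDerivWithinAt_iff_tendsto_slope.1 (hφ.mono Set.Ioi_subset_Ici_self)
  have h2 := hasDerivWithinAt_iff_tendsto_slope.1 (hψ.mono Set.Ioi_subset_Ici_self)
  have e : Set.Ioi (0 : ℝ) \ {0} = Set.Ioi 0 := by ext; simp
  rw [e] at h1 h2
  refine le_of_tendsto_of_tendsto h1 h2 ?_
  filter_upwards [h, self_mem_nhdsWithin] with t ht ht0
  simp only [slope_def_field, h0]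
  have : (0 : ℝ) < t := ht0
  gcongr

/-- The profile of the barrier. -/
def barF (A B r m y : ℝ) : ℝ :=
  max ((1 + m * A) * y + m * B / r * (y * y)) 0 - max (-((1 + m) * y + m * B / r * (y * y))) 0

theorem continuous_barF (A B r m : ℝ) : Continuous (barF A B r m) := by unfold barF; fun_prop

/-- The perturbation of the identity is relatively at most `1/4` on `|y| ≤ r`. This keeps the sign
of `y`, so the phases of the barrier are those of `Q`. -/
theorem abs_profile_le {c B r m y : ℝ} (hr : 0 < r) (hB : 0 ≤ B) (hc : 0 ≤ c)
    (hm : |m| * (c + B) ≤ 1 / 4) (hy : |y| ≤ r) :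
    |(1 + m * c) * y + m * B / r * (y * y) - y| ≤ |y| / 4 := by
  have e : (1 + m * c) * y + m * B / r * (y * y) - y = m * (c + B * (y / r)) * y := by
    field_simp; ring
  rw [e, abs_mul, abs_mul]
  have h1 : |c + B * (y / r)| ≤ c + B := by
    have h2 : |y / r| ≤ 1 := by rw [abs_div, abs_of_pos hr]; exact (div_le_one hr).2 hy
    calc _ ≤ |c| + |B * (y / r)| := abs_add_le _ _
      _ ≤ c + B * 1 := by
        rw [abs_of_nonneg hc, abs_mul, abs_of_nonneg hB]
        have := mul_le_mul_of_nonneg_left h2 hB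
        linarith
      _ = _ := by ring
  have h3 : |m| * |c + B * (y / r)| ≤ 1 / 4 :=
    (mul_le_mul_of_nonneg_left h1 (abs_nonneg m)).trans hm
  have := mul_le_mul_of_nonneg_right h3 (abs_nonneg y)
  linarith

variable {A B r m y : ℝ}

theorem barF_of_nonneg (hr : 0 < r) (hB : 0 ≤ B) (hA : 1 ≤ A) (hm : |m| * (A + B) ≤ 1 / 4)
    (hyr : |y| ≤ r) (hy : 0 ≤ y) :
    barF A B r m y = (1 + m * A) * y + m * B / r * (y * y) ∧ y / 2 ≤ barF A B r m y := by
  have h1 := abs_profile_le hr hB (by linarith) hm hyr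
  have h2 := abs_profile_le (c := 1) hr hB (by linarith)
    (le_trans (by gcongr) hm) hyr
  rw [abs_of_nonneg hy, abs_le] at h1 h2
  have e : barF A B r m y = (1 + m * A) * y + m * B / r * (y * y) := by
    rw [barF, max_eq_left (by linarith), max_eq_right (by rw [mul_one] at h2; linarith), sub_zero]
  exact ⟨e, by rw [e]; linarith⟩

theorem barF_of_nonpos (hr : 0 < r) (hB : 0 ≤ B) (hA : 1 ≤ A) (hm : |m| * (A + B) ≤ 1 / 4)
    (hyr : |y| ≤ r) (hy : y ≤ 0) :
    barF A B r m y = (1 + m) * y + m * B / r * (y * y) ∧ barF A B r m y ≤ y / 2 := by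
  have h1 := abs_profile_le hr hB (by linarith) hm hyr
  have h2 := abs_profile_le (c := 1) hr hB (by linarith)
    (le_trans (by gcongr) hm) hyr
  rw [abs_of_nonpos hy, abs_le] at h1 h2
  rw [mul_one] at h2
  have e : barF A B r m y = (1 + m) * y + m * B / r * (y * y) := by
    rw [barF, max_eq_right (by linarith), max_eq_left (by linarith)]; ring
  exact ⟨e, by rw [e]; linarith⟩

theorem barF_pos_iff (hr : 0 < r) (hB : 0 ≤ B) (hA : 1 ≤ A) (hm : |m| * (A + B) ≤ 1 / 4)
    (hyr : |y| ≤ r) : 0 < barF A B r m y ↔ 0 < y := by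
  constructor
  · intro h
    by_contra hy
    have := (barF_of_nonpos hr hB hA hm hyr (not_lt.1 hy)).2
    linarith [not_lt.1 hy]
  · intro h
    have := (barF_of_nonneg hr hB hA hm hyr h.le).2
    linarith

theorem barF_neg_iff (hr : 0 < r) (hB : 0 ≤ B) (hA : 1 ≤ A) (hm : |m| * (A + B) ≤ 1 / 4)
    (hyr : |y| ≤ r) : barF A B r m y < 0 ↔ y < 0 := by
  constructor
  · intro h
    by_contra hy
    have := (barF_of_nonneg hr hB hA hm hyr (not_lt.1 hy)).2
    linarith [not_lt.1 hy]
  · intro h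
    have := (barF_of_nonpos hr hB hA hm hyr h.le).2
    linarith

/-- The two-phase profile: `V(x) = Psi x (P x)`. -/
def Psi {d : ℕ} (α β : ℝ) (a b x : Eu d) (y : ℝ) : ℝ :=
  α * (1 + inner ℝ a x) * max y 0 - β * (1 + inner ℝ b x) * max (-y) 0

theorem polyV_eq_Psi {d : ℕ} (α β : ℝ) (M : Eu d →L[ℝ] Eu d) (ω a b x : Eu d) :
    polyV α β M ω a b x = Psi α β a b x (polyP M ω x) := rfl

section

variable {d : ℕ} {α β : ℝ} {a b x : Eu d} {y z : ℝ}

theorem Psi_of_nonneg (hy : 0 ≤ y) : Psi α β a b x y = α * (1 + inner ℝ a x) * y := by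
  rw [Psi, max_eq_left hy, max_eq_right (by linarith)]; ring

theorem Psi_of_nonpos (hy : y ≤ 0) : Psi α β a b x y = β * (1 + inner ℝ b x) * y := by
  rw [Psi, max_eq_right hy, max_eq_left (by linarith)]; ring

theorem Psi_mono (hα : 0 < α) (hβ : 0 ≤ β) (ha : 0 < 1 + inner ℝ a x) (hb : 0 < 1 + inner ℝ b x)
    (h : y ≤ z) : Psi α β a b x y ≤ Psi α β a b x z := by
  unfold Psi
  gcongr

/-- When `β = 0` the profile is constant on the negative side; strictness then needs the smaller
argument to be nonnegative. -/
theorem Psi_lt (hα : 0 < α) (ha : 0 < 1 + inner ℝ a x) (hb : 0 < 1 + inner ℝ b x)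
    (h : y < z) (hy : 0 < β ∨ 0 ≤ y) : Psi α β a b x y < Psi α β a b x z := by
  rcases le_or_gt 0 y with h0 | h0
  · rw [Psi_of_nonneg h0, Psi_of_nonneg (h0.trans h.le)]; gcongr
  · have hβ' : 0 < β := hy.resolve_right (not_le.2 h0)
    rcases le_or_gt z 0 with h1 | h1
    · rw [Psi_of_nonpos h0.le, Psi_of_nonpos h1]; gcongr
    · rw [Psi_of_nonpos h0.le, Psi_of_nonneg h1.le]
      have h2 : β * (1 + inner ℝ b x) * y < 0 := mul_neg_of_pos_of_neg (by positivity) h0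
      have h3 : 0 < α * (1 + inner ℝ a x) * z := by positivity
      linarith

theorem Psi_pos_iff (hα : 0 < α) (hβ : 0 ≤ β) (ha : 0 < 1 + inner ℝ a x)
    (hb : 0 < 1 + inner ℝ b x) : 0 < Psi α β a b x y ↔ 0 < y := by
  constructor
  · intro h
    by_contra hy
    rw [Psi_of_nonpos (not_lt.1 hy)] at h
    have : β * (1 + inner ℝ b x) * y ≤ 0 :=
      mul_nonpos_of_nonneg_of_nonpos (by positivity) (not_lt.1 hy)
    linarith
  · intro h
    rw [Psi_of_nonneg h.le]; positivity

end

theorem continuous_Psi {d : ℕ} (α β : ℝ) (a b : Eu d) :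
    Continuous fun p : Eu d × ℝ => Psi α β a b p.1 p.2 := by unfold Psi; fun_prop

theorem isOpen_posPhase {d : ℕ} {v : Eu d → ℝ} (hv : ContinuousOn v (ball 0 1)) :
    IsOpen (posPhase v) := by
  have := hv.isOpen_inter_preimage isOpen_ball (isOpen_Ioi (a := (0 : ℝ)))
  exact this

theorem mem_negPhase_or_mem_freeBdry {d : ℕ} {v : Eu d → ℝ} {x : Eu d} (hx : x ∈ ball (0 : Eu d) 1)
    (hv : v x ≤ 0) : x ∈ negPhase v ∨ x ∈ freeBdry v := by
  by_cases h : x ∈ closure (posPhase v)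
  · right
    exact ⟨⟨h, fun hi => absurd (interior_subset hi).2 (not_lt.2 hv)⟩, hx⟩
  · left
    rw [negPhase, mem_interior_iff_mem_nhds]
    filter_upwards [isClosed_closure.isOpen_compl.mem_nhds h, isOpen_ball.mem_nhds hx] with y hy hy1
    exact ⟨hy1, not_lt.1 fun hp => hy (subset_closure ⟨hy1, hp⟩)⟩

theorem eq_zero_of_mem_freeBdry {d : ℕ} {v : Eu d → ℝ} (hv : ContinuousOn v (ball 0 1)) {x : Eu d}
    (hx : x ∈ freeBdry v) : v x = 0 := by
  have hc : ContinuousAt v x := hv.continuousAt (isOpen_ball.mem_nhds hx.2)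
  have hno : ¬ 0 < v x := fun h => by
    have h1 := hx.1.2
    rw [(isOpen_posPhase hv).interior_eq] at h1
    exact h1 ⟨hx.2, h⟩
  refine le_antisymm (not_lt.1 hno) ?_
  by_contra hneg
  have h2 := hc.eventually (gt_mem_nhds (not_le.1 hneg))
  obtain ⟨y, hy, hy2⟩ := (mem_closure_iff_nhds.1 hx.1.1) _ h2
  exact absurd hy2.2 (not_lt.2 (le_of_lt hy))

end Tools

/-- The common abstract form of the two-phase and one-phase hypotheses. -/
structure Core {d : ℕ} (v : Eu d → ℝ) (α β ε κ K₁ s₀ : ℝ) (M : Eu d →L[ℝ] Eu d) (a b : Eu d) :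
    Prop where
  alpha_pos : 0 < α
  beta_nonneg : 0 ≤ β
  eps_pos : 0 < ε
  kappa_nonneg : 0 ≤ κ
  cont : ContinuousOn v (ball 0 1)
  symm : (M : Eu d →ₗ[ℝ] Eu d).IsSymmetric
  map_dir : M (eLast d) = 0
  norm_a : ‖a‖ ≤ κ
  norm_b : ‖b‖ ≤ κ
  norm_M : ‖M‖ ≤ κ
  norm_aM : ‖a‖ * ‖M‖ ≤ κ * ε
  norm_bM : ‖b‖ * ‖M‖ ≤ κ * ε
  norm_MM : ‖M‖ ^ 2 ≤ κ * ε
  pos : ∀ x ∈ posPhase v, ContDiffAt ℝ 2 v x ∧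
    |Δ v x - α * (2 * inner ℝ a (eLast d) - opTrace M)| ≤ α * (κ * ε)
  neg : 0 < β → ∀ x ∈ negPhase v, ContDiffAt ℝ 2 v x ∧
    |Δ v x - β * (2 * inner ℝ b (eLast d) - opTrace M)| ≤ β * (κ * ε)
  nonneg : β = 0 → ∀ x, 0 ≤ v x
  -- For `σ = 1`: a negative slope at most `1 + s` times that of the profile forces a positive slope
  -- at most `1 + K₁s + κε` times that of the profile, where `K₁` accounts for the variation of `G`.
  -- For `σ = -1` the inequalities are mirrored. With `β = 0` the premise can be met with `q = 0`.
  fb : ∀ σ : ℝ, (σ = 1 ∨ σ = -1) → ∀ (c : ℝ) (ξ : Eu d) (N : Eu d →L[ℝ] Eu d) (x₀ : Eu d),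
    TestQuad c ξ N → (σ = 1 → TouchesPos v c ξ N x₀) → (σ = -1 → TouchesNeg v c ξ N x₀) →
    |polyP M (eLast d) x₀| ≤ 5 * ε →
    ∃ p q : ℝ, PosSlope v x₀ (quadNormal ξ N x₀) p ∧ NegSlope v x₀ (quadNormal ξ N x₀) q ∧
      ∀ s : ℝ, 0 ≤ s → s ≤ s₀ → σ * (q - β * (1 + inner ℝ b x₀) * (1 + σ * s)) ≤ 0 →
        σ * (p - α * (1 + inner ℝ a x₀) * (1 + σ * (K₁ * s + κ * ε))) ≤ 0


/-! ### Constants of the barrier and its position relative to the flatness level. -/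

section Constants

/-- Curvature coefficient of the barrier. -/
def bB (d : ℕ) : ℝ := d + 1
/-- Extra slope of the barrier in the positive phase. -/
def bA (K₁ : ℝ) : ℝ := 4 * K₁ + 4
/-- Relative height of the region where the barrier is used. -/
def bTop (d : ℕ) (K₁ : ℝ) : ℝ := 1 / (8 * (bA K₁ + bB d))
/-- Final relative height of the barrier. -/
def bT (d : ℕ) : ℝ := 1 / (32 * bB d)
/-- The relative distance to the free boundary below which the barrier is used. -/
def bν (d : ℕ) (K₁ : ℝ) : ℝ := bTop d K₁ * bT d / 64

variable {d : ℕ} {K₁ : ℝ}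

theorem one_le_bB : 1 ≤ bB d := by unfold bB; have : (0 : ℝ) ≤ d := d.cast_nonneg; linarith
theorem eight_le_bA (hK : 1 ≤ K₁) : 8 ≤ bA K₁ := by unfold bA; linarith
theorem bTop_pos (hK : 1 ≤ K₁) : 0 < bTop d K₁ := by
  have := one_le_bB (d := d); have := eight_le_bA hK; unfold bTop; positivity
theorem bTop_mul (hK : 1 ≤ K₁) : bTop d K₁ * (bA K₁ + bB d) = 1 / 8 := by
  have := one_le_bB (d := d); have := eight_le_bA hK; unfold bTop; field_simp
theorem bTop_le (hK : 1 ≤ K₁) : bTop d K₁ ≤ 1 / 72 := by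
  have := one_le_bB (d := d); have := eight_le_bA hK
  have := bTop_mul (d := d) hK; have := bTop_pos (d := d) hK
  nlinarith
theorem bT_pos : 0 < bT d := by have := one_le_bB (d := d); unfold bT; positivity
theorem bT_mul : bT d * bB d = 1 / 32 := by
  have := one_le_bB (d := d); unfold bT; field_simp
theorem bT_le : bT d ≤ 1 / 32 := by
  have := one_le_bB (d := d); have := bT_mul (d := d); have := bT_pos (d := d); nlinarith
theorem bν_pos (hK : 1 ≤ K₁) : 0 < bν d K₁ := by
  have := bTop_pos (d := d) hK; have := bT_pos (d := d); unfold bν; positivity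
theorem bν_le_bT (hK : 1 ≤ K₁) : bν d K₁ ≤ bT d / 4000 := by
  have := bTop_le (d := d) hK; have := bT_pos (d := d); unfold bν; nlinarith
theorem bν_le_bTop (hK : 1 ≤ K₁) : bν d K₁ ≤ bTop d K₁ / 2000 := by
  have := bTop_pos (d := d) hK; have := bT_le (d := d); unfold bν; nlinarith
theorem bν_mul_le (hK : 1 ≤ K₁) : bν d K₁ * (bA K₁ + bB d) ≤ 1 / 10000 := by
  have h1 := bTop_mul (d := d) hK; have h2 := bT_le (d := d)
  have : bν d K₁ * (bA K₁ + bB d) = (bTop d K₁ * (bA K₁ + bB d)) * bT d / 64 := by unfold bν; ring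
  rw [this, h1]; linarith
theorem bν_mul_bB_le (hK : 1 ≤ K₁) : bν d K₁ * bB d ≤ 1 / 10000 := by
  have := bν_mul_le (d := d) hK; have := bν_pos (d := d) hK; have := eight_le_bA hK
  nlinarith
theorem bν_mul_mul_le (hK : 1 ≤ K₁) : bB d * (bν d K₁ * (bA K₁ + 2 * bB d)) ≤ 1 / 4 := by
  have h1 := bTop_mul (d := d) hK; have h2 := bT_mul (d := d)
  have h3 := one_le_bB (d := d); have h4 := eight_le_bA hK
  have h5 : bB d * (bν d K₁ * (bA K₁ + bB d)) = 1 / 8 * (1 / 32) / 64 := by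
    rw [← h1, ← h2]; unfold bν; ring
  have h6 : bB d * (bν d K₁ * (bA K₁ + 2 * bB d)) ≤ bB d * (bν d K₁ * (2 * (bA K₁ + bB d))) := by
    have := bν_pos (d := d) hK
    gcongr; linarith
  nlinarith

variable {r μ σ Q Y tg t : ℝ}

theorem barF_sub_of_nonneg {A B : ℝ} (hr : 0 < r)
    (hQ : Q = Y + σ * μ * r * t - σ * μ / r * tg)
    (hF : barF A B r (σ * μ) Q = (1 + σ * μ * A) * Q + σ * μ * B / r * (Q * Q))
    (hσ : σ * σ = 1) :
    σ * (barF A B r (σ * μ) Q - Y) = μ * (r * (t - tg / r ^ 2) + Q * (A + B * (Q / r))) := by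
  rw [hF]
  have : σ * ((1 + σ * μ * A) * Q + σ * μ * B / r * (Q * Q) - Y)
      = σ * (Q - Y) + σ * σ * (μ * (Q * (A + B * (Q / r)))) := by ring
  rw [this, hQ]
  have h2 : σ * (Y + σ * μ * r * t - σ * μ / r * tg - Y)
      = σ * σ * (μ * (r * (t - tg / r ^ 2))) := by field_simp; ring
  rw [h2, hσ]; ring

theorem abs_sub_le_of_eq (hσ : σ = 1 ∨ σ = -1) (hr : 0 < r) (hμ : 0 < μ)
    (htg : 0 ≤ tg) (htg' : tg ≤ r ^ 2 / 4) (ht : -1 ≤ t) (ht' : t ≤ 1)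
    (hQ : Q = Y + σ * μ * r * t - σ * μ / r * tg) : |Q - Y| ≤ 2 * μ * r := by
  have e : Q - Y = σ * (μ * r * (t - tg / r ^ 2)) := by rw [hQ]; field_simp; ring
  have hσa : |σ| = 1 := by rcases hσ with rfl | rfl <;> norm_num
  have h1 : tg / r ^ 2 ≤ 1 / 4 := by rw [div_le_iff₀ (by positivity)]; linarith
  have h2 : 0 ≤ tg / r ^ 2 := by positivity
  have h3 : |t - tg / r ^ 2| ≤ 2 := abs_le.2 ⟨by linarith, by linarith⟩
  rw [e, abs_mul, hσa, one_mul, abs_mul, abs_of_pos (by positivity)]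
  have := mul_le_mul_of_nonneg_left h3 (show 0 ≤ μ * r by positivity)
  linarith

/-- `Q - Y = σμr(t - tg/r²)`, so at `t = -1`, and on the lateral side where `tg/r² = 1/4`, the
paraboloid already pushes the barrier to the harmless side. On the bottom the lower order term is
about `-r/(8B)`, while `t` contributes at most `r/(32B)`: this fixes `bT`. Towards the top, `Q(A +
B)` is at most about `r/8`: this fixes `bTop`, and leaves an excess of at most `μr/4`, less than the
Harnack gain available there. -/
theorem barF_bracket (hK : 1 ≤ K₁) (hσ : σ = 1 ∨ σ = -1) (hr : 0 < r) (hμ : 0 < μ)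
    (hμν : μ ≤ bν d K₁) (htg : 0 ≤ tg) (htg' : tg ≤ r ^ 2 / 4) (ht : -1 ≤ t) (ht' : t ≤ bT d)
    (hY : -(r / (4 * bB d)) ≤ Y) (hY' : Y ≤ bTop d K₁ * r)
    (hQ : Q = Y + σ * μ * r * t - σ * μ / r * tg) :
    |Q| ≤ r ∧ σ * (barF (bA K₁) (bB d) r (σ * μ) Q - Y) ≤ μ * r / 4 ∧
    (tg = r ^ 2 / 4 ∨ Y = -(r / (4 * bB d)) ∨ t = -1 →
      σ * (barF (bA K₁) (bB d) r (σ * μ) Q - Y) < 0) := by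
  have hσσ : σ * σ = 1 := by rcases hσ with rfl | rfl <;> norm_num
  have hσa : |σ| = 1 := by rcases hσ with rfl | rfl <;> norm_num
  have hB := one_le_bB (d := d)
  have hA := eight_le_bA hK
  have hT := bTop_pos (d := d) hK
  have hT1 := bTop_le (d := d) hK
  have hTm := bTop_mul (d := d) hK
  have ht1 := bT_le (d := d)
  have ht0 := bT_pos (d := d)
  have htm := bT_mul (d := d)
  have hν := bν_mul_le (d := d) hK
  have hνB := bν_mul_bB_le (d := d) hK
  have hν0 := bν_pos (d := d) hK
  have hd := abs_sub_le_of_eq hσ hr hμ htg htg' ht (by linarith) hQ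
  rw [abs_le] at hd
  have hμr : 0 < μ * r := by positivity
  have hμ1 : μ ≤ 1 / 1000 := by
    have := bν_le_bT (d := d) hK
    linarith
  have hB4 : r / (4 * bB d) ≤ r / 4 := by gcongr; linarith
  have hB4' : 0 < r / (4 * bB d) := by positivity
  have hB4m : r / (4 * bB d) * bB d = r / 4 := by field_simp
  have hμrr : μ * r ≤ r / 1000 := by
    have := mul_le_mul_of_nonneg_right hμ1 hr.le
    linarith
  have hμBr : μ * r * bB d ≤ r / 10000 := by
    have : μ * bB d ≤ 1 / 10000 := (mul_le_mul_of_nonneg_right hμν (by linarith)).trans hνB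
    have := mul_le_mul_of_nonneg_right this hr.le
    linarith
  have hTr : bTop d K₁ * r ≤ r / 72 := by
    have := mul_le_mul_of_nonneg_right hT1 hr.le
    linarith
  have hQr : |Q| ≤ r := abs_le.2 ⟨by linarith, by linarith⟩
  have hm : |σ * μ| * (bA K₁ + bB d) ≤ 1 / 4 := by
    rw [abs_mul, hσa, one_mul, abs_of_pos hμ]
    have : μ * (bA K₁ + bB d) ≤ bν d K₁ * (bA K₁ + bB d) := by gcongr
    linarith
  have hz : 0 ≤ tg / r ^ 2 := by positivity
  -- `X` stands for the contribution of the slope and curvature terms, divided by `μ`; the estimate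
  -- is the same for both signs of `Q`.
  have hcase : ∀ X : ℝ, ∀ c : ℝ, c ≤ 1 / 8 + 1 / 1000 → X ≤ r * c →
      μ * (r * (t - tg / r ^ 2) + X) ≤ μ * r / 4 ∧ (tg = r ^ 2 / 4 ∨ t = -1 →
        μ * (r * (t - tg / r ^ 2) + X) < 0) := by
    intro X c hc hX
    have hX' : X ≤ r * (1 / 8 + 1 / 1000) := hX.trans (mul_le_mul_of_nonneg_left hc hr.le)
    constructor
    · have h1 : r * (t - tg / r ^ 2) ≤ r * (1 / 32) :=
        mul_le_mul_of_nonneg_left (by linarith) hr.le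
      have h2 := mul_le_mul_of_nonneg_left (show r * (t - tg / r ^ 2) + X ≤ r / 4 by linarith) hμ.le
      linarith
    · rintro (h | h)
      · have h3 : tg / r ^ 2 = 1 / 4 := by rw [h]; field_simp
        have h1 : r * (t - tg / r ^ 2) ≤ r * (1 / 32 - 1 / 4) :=
          mul_le_mul_of_nonneg_left (by linarith) hr.le
        exact mul_neg_of_pos_of_neg hμ (by linarith)
      · have h1 : r * (t - tg / r ^ 2) ≤ r * (-1) :=
          mul_le_mul_of_nonneg_left (by linarith) hr.le
        exact mul_neg_of_pos_of_neg hμ (by linarith)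
  refine ⟨hQr, ?_⟩
  rcases le_total 0 Q with hQ0 | hQ0
  · have hF := (barF_of_nonneg hr (by linarith) (by linarith) hm hQr hQ0).1
    have e := barF_sub_of_nonneg hr hQ hF hσσ
    have hQA : Q * (bA K₁ + bB d * (Q / r)) ≤ r * (1 / 8 + 1 / 1000) := by
      have h1 : Q / r ≤ 1 := (div_le_one hr).2 ((le_abs_self Q).trans hQr)
      have h2 : bA K₁ + bB d * (Q / r) ≤ bA K₁ + bB d := by
        have := mul_le_mul_of_nonneg_left h1 (by linarith : 0 ≤ bB d)
        linarith
      have h3 : Q ≤ (bTop d K₁ + 2 * μ) * r := by linarith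
      calc _ ≤ (bTop d K₁ + 2 * μ) * r * (bA K₁ + bB d) := by
            refine mul_le_mul h3 h2 ?_ (by positivity)
            have : 0 ≤ Q / r := by positivity
            positivity
        _ = r * (bTop d K₁ * (bA K₁ + bB d) + 2 * (μ * (bA K₁ + bB d))) := by ring
        _ ≤ _ := by
            have : μ * (bA K₁ + bB d) ≤ bν d K₁ * (bA K₁ + bB d) := by gcongr
            rw [hTm]; gcongr; linarith
    rw [e]
    have hc := hcase _ _ le_rfl hQA
    refine ⟨hc.1, ?_⟩
    rintro (h | h | h)
    · exact hc.2 (Or.inl h)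
    · exfalso
      have : 2 * μ * r < r / (4 * bB d) := by
        rw [lt_div_iff₀ (by positivity)]; linarith
      linarith
    · exact hc.2 (Or.inr h)
  · have hF := (barF_of_nonpos hr (by linarith) (by linarith) hm hQr hQ0).1
    -- For `Q ≤ 0` the positive slope does not enter, so the profile may be replaced by the one with
    -- `A = 1` and the formula already proved can be reused.
    have hF' : barF (bA K₁) (bB d) r (σ * μ) Q
        = barF 1 (bB d) r (σ * μ) Q := by
      rw [hF]
      have hm1 : |σ * μ| * (1 + bB d) ≤ 1 / 4 := le_trans (by gcongr; linarith) hm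
      exact ((barF_of_nonpos hr (by linarith) le_rfl hm1 hQr hQ0).1).symm
    have hF1 : barF 1 (bB d) r (σ * μ) Q = (1 + σ * μ * 1) * Q + σ * μ * bB d / r * (Q * Q) := by
      rw [← hF', hF, mul_one]
    have e := barF_sub_of_nonneg hr hQ hF1 hσσ
    have hlow : -(r / (4 * bB d)) - 2 * μ * r ≤ Q := by linarith
    have h1 : 1 / 2 ≤ 1 + bB d * (Q / r) := by
      have : -(1 / 2) ≤ bB d * (Q / r) := by
        rw [← mul_div_assoc, le_div_iff₀ hr]
        have := mul_le_mul_of_nonneg_left hlow (by linarith : 0 ≤ bB d)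
        linarith
      linarith
    have hQA : Q * (1 + bB d * (Q / r)) ≤ Q / 2 := by
      have := mul_le_mul_of_nonpos_left h1 hQ0
      linarith
    rw [hF', e]
    have hc := hcase (Q * (1 + bB d * (Q / r))) 0 (by norm_num) (by linarith)
    refine ⟨hc.1, ?_⟩
    rintro (h | h | h)
    · exact hc.2 (Or.inl h)
    · refine mul_neg_of_pos_of_neg hμ ?_
      have h2 : bT d * r = r / (4 * bB d) / 8 := by unfold bT; field_simp; norm_num
      have h3 : 2 * μ * r ≤ r / (4 * bB d) / 4 := by
        rw [div_div, le_div_iff₀ (by positivity)]; linarith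
      have h4 : r * (t - tg / r ^ 2) ≤ r * bT d :=
        mul_le_mul_of_nonneg_left (by linarith) hr.le
      linarith
    · exact hc.2 (Or.inr h)

/-- At the final time and near the centre, `t - tg/r²` is at least `bT - ν`, while a negative `Q`
costs at most `6ν r`. As `ν` is tiny compared with `bT`, a quarter of `bT` survives. -/
theorem barF_gain (hK : 1 ≤ K₁) (hσ : σ = 1 ∨ σ = -1) (hr : 0 < r) (hμ : 0 < μ)
    (hμν : μ ≤ bν d K₁) (htg : 0 ≤ tg) (htg' : tg ≤ (bν d K₁ * r) ^ 2)
    (hY : |Y| ≤ 4 * bν d K₁ * r)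
    (hQ : Q = Y + σ * μ * r * bT d - σ * μ / r * tg) :
    μ * r * bT d / 4 ≤ σ * (barF (bA K₁) (bB d) r (σ * μ) Q - Y) := by
  have hσσ : σ * σ = 1 := by rcases hσ with rfl | rfl <;> norm_num
  have hσa : |σ| = 1 := by rcases hσ with rfl | rfl <;> norm_num
  have hB := one_le_bB (d := d)
  have hA := eight_le_bA hK
  have ht1 := bT_le (d := d)
  have ht0 := bT_pos (d := d)
  have hν := bν_mul_le (d := d) hK
  have hνB := bν_mul_bB_le (d := d) hK
  have hν0 := bν_pos (d := d) hK
  have hνT := bν_le_bT (d := d) hK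
  have hν1 : bν d K₁ ≤ 1 / 1000 := by linarith
  have hν2 : bν d K₁ ^ 2 ≤ bν d K₁ := by nlinarith
  have htg5 : tg ≤ bν d K₁ * r ^ 2 := by
    rw [mul_pow] at htg'
    exact htg'.trans (mul_le_mul_of_nonneg_right hν2 (sq_nonneg r))
  have htg4 : tg ≤ r ^ 2 / 4 := by
    have := mul_le_mul_of_nonneg_right hν1 (sq_nonneg r)
    linarith [sq_nonneg r]
  have hd := abs_sub_le_of_eq hσ hr hμ htg htg4 (by linarith) (by linarith) hQ
  rw [abs_le] at hd hY
  have hμr : μ * r ≤ bν d K₁ * r := by gcongr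
  have hνr : bν d K₁ * r ≤ r / 1000 := by
    have := mul_le_mul_of_nonneg_right hν1 hr.le
    linarith
  have hQr : |Q| ≤ r := abs_le.2 ⟨by linarith, by linarith⟩
  have hm : |σ * μ| * (bA K₁ + bB d) ≤ 1 / 4 := by
    rw [abs_mul, hσa, one_mul, abs_of_pos hμ]
    have : μ * (bA K₁ + bB d) ≤ bν d K₁ * (bA K₁ + bB d) := by gcongr
    linarith
  have hz : tg / r ^ 2 ≤ bν d K₁ := by
    rw [div_le_iff₀ (by positivity)]
    exact htg5
  rcases le_total 0 Q with hQ0 | hQ0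
  · have hF := (barF_of_nonneg hr (by linarith) (by linarith) hm hQr hQ0).1
    rw [barF_sub_of_nonneg hr hQ hF hσσ]
    have h1 : 0 ≤ Q * (bA K₁ + bB d * (Q / r)) := by
      have : 0 ≤ Q / r := by positivity
      positivity
    have h2 : r * (bT d / 4) ≤ r * (bT d - tg / r ^ 2) := by gcongr; linarith
    have : μ * (r * bT d / 4) ≤ μ * (r * (bT d - tg / r ^ 2) + Q * (bA K₁ + bB d * (Q / r))) := by
      gcongr; linarith
    linarith
  · have hF := (barF_of_nonpos hr (by linarith) (by linarith) hm hQr hQ0).1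
    have hF' : barF (bA K₁) (bB d) r (σ * μ) Q
        = barF 1 (bB d) r (σ * μ) Q := by
      rw [hF]
      have hm1 : |σ * μ| * (1 + bB d) ≤ 1 / 4 := le_trans (by gcongr; linarith) hm
      exact ((barF_of_nonpos hr (by linarith) le_rfl hm1 hQr hQ0).1).symm
    have hF1 : barF 1 (bB d) r (σ * μ) Q = (1 + σ * μ * 1) * Q + σ * μ * bB d / r * (Q * Q) := by
      rw [← hF', hF, mul_one]
    rw [hF', barF_sub_of_nonneg hr hQ hF1 hσσ]
    have h1 : bB d * (Q / r) ≤ 0 :=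
      mul_nonpos_of_nonneg_of_nonpos (by linarith) (div_nonpos_of_nonpos_of_nonneg hQ0 hr.le)
    have h2 : Q ≤ Q * (1 + bB d * (Q / r)) := by
      have := mul_nonneg_of_nonpos_of_nonpos hQ0 h1
      linarith
    have h4 : -(6 * bν d K₁ * r) ≤ Q := by linarith
    have h3 : r * (bT d / 4) ≤ r * (bT d - bν d K₁ - 6 * bν d K₁) := by gcongr; linarith
    have h5 : r * (bT d - bν d K₁) ≤ r * (bT d - tg / r ^ 2) := by gcongr
    have : μ * (r * bT d / 4) ≤ μ * (r * (bT d - tg / r ^ 2) + Q * (1 + bB d * (Q / r))) := by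
      gcongr; linarith
    linarith

end Constants


/-! ### `P` is almost the coordinate `xₙ`. -/

section PolyP

variable {d : ℕ} {M : Eu d →L[ℝ] Eu d}

theorem map_eq_map_tproj (h0 : M (eLast d) = 0) (y : Eu d) : M y = M (tproj d y) := by
  rw [tproj_apply, map_sub, map_smul, h0, smul_zero, sub_zero]

/-- `M eₙ = 0` and symmetry make the quadratic part depend on the tangential displacement only, so
the error carries a factor `‖M‖` and is independent of the vertical displacement. -/
theorem abs_polyP_sub_le (hM : (M : Eu d →ₗ[ℝ] Eu d).IsSymmetric) (h0 : M (eLast d) = 0)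
    (x x₀ : Eu d) :
    |polyP M (eLast d) x - polyP M (eLast d) x₀ - inner ℝ (x - x₀) (eLast d)|
      ≤ ‖M‖ * ‖tproj d (x - x₀)‖ * (‖x₀‖ + ‖tproj d (x - x₀)‖) := by
  obtain ⟨y, rfl⟩ : ∃ y, x = x₀ + y := ⟨x - x₀, by abel⟩
  rw [add_sub_cancel_left]
  set p := tproj d y with hp
  have hMy : M y = M p := map_eq_map_tproj h0 y
  have h1 : inner ℝ x₀ (M y) = inner ℝ y (M x₀) := by
    have := hM x₀ y
    simp only [ContinuousLinearMap.coe_coe] at this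
    rw [← this, real_inner_comm]
  have h2 : inner ℝ y (M y) = inner ℝ p (M p) := by
    have e : y = p + inner ℝ (eLast d) y • eLast d := by rw [hp, tproj_apply]; abel
    have h3 := inner_map_eLast hM h0 p
    rw [hMy]
    conv_lhs => rw [e]
    rw [inner_add_left, inner_smul_left, real_inner_comm (M p) (eLast d), h3]; simp
  have e : polyP M (eLast d) (x₀ + y) - polyP M (eLast d) x₀ - inner ℝ y (eLast d)
      = -(inner ℝ x₀ (M p) + 1 / 2 * inner ℝ p (M p)) := by
    unfold polyP
    rw [map_add, inner_add_left, inner_add_left, inner_add_right, inner_add_right, h2, ← h1, hMy]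
    ring
  have hMp : ‖M p‖ ≤ ‖M‖ * ‖p‖ := M.le_opNorm p
  have h4 : |inner ℝ x₀ (M p)| ≤ ‖x₀‖ * (‖M‖ * ‖p‖) :=
    (abs_real_inner_le_norm _ _).trans (by gcongr)
  have h5 : |inner ℝ p (M p)| ≤ ‖p‖ * (‖M‖ * ‖p‖) :=
    (abs_real_inner_le_norm _ _).trans (by gcongr)
  rw [e, abs_neg]
  calc _ ≤ |inner ℝ x₀ (M p)| + |1 / 2 * inner ℝ p (M p)| := abs_add_le _ _
    _ = |inner ℝ x₀ (M p)| + 1 / 2 * |inner ℝ p (M p)| := by rw [abs_mul]; norm_num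
    _ ≤ ‖x₀‖ * (‖M‖ * ‖p‖) + ‖p‖ * (‖M‖ * ‖p‖) := by
        linarith [abs_nonneg (inner ℝ p (M p))]
    _ = _ := by ring

theorem abs_polyP_sub_le_two_mul (hM : (M : Eu d →ₗ[ℝ] Eu d).IsSymmetric) (h0 : M (eLast d) = 0)
    (hM1 : ‖M‖ ≤ 1 / 2) {x x₀ : Eu d} (hx₀ : ‖x₀‖ ≤ 1) (hx : ‖x - x₀‖ ≤ 1) :
    |polyP M (eLast d) x - polyP M (eLast d) x₀| ≤ 2 * ‖x - x₀‖ := by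
  have h1 := abs_polyP_sub_le hM h0 x x₀
  have h2 := norm_tproj_le (x - x₀)
  have h3 := abs_inner_eLast_le (x - x₀)
  have h4 : ‖M‖ * ‖tproj d (x - x₀)‖ * (‖x₀‖ + ‖tproj d (x - x₀)‖) ≤ 1 / 2 * ‖x - x₀‖ * (1 + 1) := by
    gcongr; linarith
  rw [abs_le] at *
  constructor <;> linarith

theorem dist_lt_of_tang_le (hM : (M : Eu d →ₗ[ℝ] Eu d).IsSymmetric) (h0 : M (eLast d) = 0)
    {r : ℝ} (hr : 0 < r) (hr1 : r ≤ 1) (hM1 : ‖M‖ ≤ 1 / 100) {x x₀ : Eu d} (hx₀ : ‖x₀‖ ≤ 1)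
    (ht : tang (x - x₀) ≤ r ^ 2 / 4)
    (hP : |polyP M (eLast d) x - polyP M (eLast d) x₀| ≤ r * (3 / 10)) : dist x x₀ < 4 / 5 * r := by
  have h1 := abs_polyP_sub_le hM h0 x x₀
  have h2 : ‖tproj d (x - x₀)‖ ≤ r / 2 := by
    rw [tang_eq_norm_sq] at ht
    exact (sq_le_sq₀ (norm_nonneg _) (by positivity)).1 (by linarith [div_pow r 2 2])
  have h4 : ‖M‖ * ‖tproj d (x - x₀)‖ * (‖x₀‖ + ‖tproj d (x - x₀)‖)
      ≤ 1 / 100 * (r / 2) * (1 + 1) := by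
    gcongr; linarith
  have h5 : |inner ℝ (x - x₀) (eLast d)| ≤ r * (32 / 100) := by
    rw [abs_le] at *
    constructor <;> linarith
  have h6 : inner ℝ (x - x₀) (eLast d) ^ 2 ≤ (r * (32 / 100)) ^ 2 := by
    rw [← sq_abs]; gcongr
  rw [tang_eq] at ht
  rw [dist_eq_norm]
  refine (sq_lt_sq₀ (norm_nonneg _) (by positivity)).1 ?_
  have : 0 < r ^ 2 := by positivity
  nlinarith

end PolyP

/-- Hypotheses for the improvement of flatness from one side near the free boundary, at scale `r`
about `x₀`; `σ = 1` for the lower and `σ = -1` for the upper side. -/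
structure Near {d : ℕ} (v : Eu d → ℝ) (α β ε κ K₁ s₀ : ℝ) (M : Eu d →L[ℝ] Eu d) (a b : Eu d)
    (σ r k μ : ℝ) (x₀ : Eu d) : Prop where
  core : Core v α β ε κ K₁ s₀ M a b
  sign : σ = 1 ∨ σ = -1
  one_le_K : 1 ≤ K₁
  norm_x₀ : ‖x₀‖ ≤ 1 / 2
  r_pos : 0 < r
  r_le : r ≤ 1 / 8
  mu_pos : 0 < μ
  mu_le : μ ≤ bν d K₁
  mu_le_s₀ : 2 * μ ≤ s₀
  mu_le_r : μ ≤ r / 8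
  kap_le : κ ≤ bν d K₁
  kap_lap : κ * ε * (2 * (d + 1) + 5) < μ / (2 * r)
  kap_eps : κ * ε ≤ μ / 4
  kap_const : κ * ((d + 1 + 2) * (bA K₁ + 2 * bB d) + 8) ≤ 1 / 4
  level : |k| ≤ bν d K₁ * r
  level_eps : |k| + 2 * μ * r ≤ 5 * ε
  near : |polyP M (eLast d) x₀| ≤ bν d K₁ * r
  flat : ∀ x ∈ ball x₀ r, 0 ≤ σ * (v x - Psi α β a b x (polyP M (eLast d) x + k))
  -- Known only for paraboloids of opening `μ / (2r)`. The barrier has opening `μ / r`, and the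
  -- difference pays for its vertical shift outside the comparison region.
  glob : ∀ x ∈ ball (0 : Eu d) (2 / 3),
    (σ = 1 → 0 < polyP M (eLast d) x + k - μ / (2 * r) * tang (x - x₀) → 0 < v x) ∧
    (σ = -1 → 0 < v x → 0 < polyP M (eLast d) x + k + μ / (2 * r) * tang (x - x₀))
  -- The gain `μr/2` on the top surface, supplied by Harnack, beats the excess `μr/4` of the barrier
  -- there.
  top : ∀ x ∈ ball x₀ r, tang (x - x₀) ≤ r ^ 2 / 4 → polyP M (eLast d) x + k = bTop d K₁ * r →
    0 ≤ σ * (v x - α * (1 + inner ℝ a x) * (bTop d K₁ * r + σ * (μ * r / 2)))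

/-! ### The comparison region and the strict differential inequality for the barrier. -/

namespace Near

variable {d : ℕ} {v : Eu d → ℝ} {α β ε κ K₁ s₀ : ℝ} {M : Eu d →L[ℝ] Eu d} {a b : Eu d}
  {σ r k μ : ℝ} {x₀ : Eu d}

/-- The zero level of the barrier at time `t`. -/
def Q (M : Eu d →L[ℝ] Eu d) (σ r k μ : ℝ) (x₀ : Eu d) (t : ℝ) (x : Eu d) : ℝ :=
  paraQ M x₀ (k + σ * μ * r * t) (σ * μ / r) x

theorem Q_eq (t : ℝ) (x : Eu d) : Q M σ r k μ x₀ t x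
    = (polyP M (eLast d) x + k) + σ * μ * r * t - σ * μ / r * tang (x - x₀) := by
  unfold Q paraQ; ring

/-- The region where the barrier is compared with `v`. -/
def dom (M : Eu d →L[ℝ] Eu d) (K₁ r k : ℝ) (x₀ : Eu d) : Set (Eu d) :=
  {x | tang (x - x₀) ≤ r ^ 2 / 4 ∧ -(r / (4 * bB d)) ≤ polyP M (eLast d) x + k ∧
    polyP M (eLast d) x + k ≤ bTop d K₁ * r}

/-- The signed difference of `v` and the barrier at time `t`. -/
def gap (v : Eu d → ℝ) (α β K₁ : ℝ) (M : Eu d →L[ℝ] Eu d) (a b : Eu d) (σ r k μ : ℝ) (x₀ : Eu d)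
    (t : ℝ) (x : Eu d) : ℝ :=
  σ * (v x - Psi α β a b x (barF (bA K₁) (bB d) r (σ * μ) (Q M σ r k μ x₀ t x)))

variable (h : Near v α β ε κ K₁ s₀ M a b σ r k μ x₀)
include h

theorem kap_small : κ ≤ 1 / 1000 := by
  have h1 := h.kap_le
  have h2 := bν_le_bT (d := d) h.one_le_K
  have h3 := bT_le (d := d)
  linarith

/-- Bounded tangential distance and bounded `P` bound the full distance, because `P` differs little
from the height. Hence the curved cylinder stays in the ball where flatness is known. -/
theorem ball_of_dom {x : Eu d} (hx : x ∈ dom M K₁ r k x₀) :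
    x ∈ ball x₀ r ∧ x ∈ ball (0 : Eu d) (2 / 3) := by
  obtain ⟨h1, h2, h3⟩ := hx
  have hr := h.r_pos
  have hT := bTop_le (d := d) h.one_le_K
  have hB := one_le_bB (d := d)
  have hν := bν_le_bT (d := d) h.one_le_K
  have hT' := bT_le (d := d)
  have hκ := h.kap_small
  have hl := abs_le.1 h.level
  have hn := abs_le.1 h.near
  have hB4 : r / (4 * bB d) ≤ r / 4 := by gcongr; linarith
  have hTr : bTop d K₁ * r ≤ 1 / 72 * r := by gcongr
  have hνr : bν d K₁ * r ≤ 1 / 1000 * r := by gcongr; linarith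
  have hd : dist x x₀ < 4 / 5 * r := by
    refine dist_lt_of_tang_le h.core.symm h.core.map_dir hr (by linarith [h.r_le])
      (by linarith [h.core.norm_M]) (by linarith [h.norm_x₀]) h1 (abs_le.2 ⟨?_, ?_⟩) <;> linarith
  refine ⟨by rw [mem_ball]; linarith, ?_⟩
  rw [mem_ball]
  have := dist_triangle x x₀ 0
  rw [dist_zero_right x₀] at this
  linarith [h.norm_x₀, h.r_le]

theorem one_add_pos {x : Eu d} (hx : x ∈ ball (0 : Eu d) 1) :
    0 < 1 + inner ℝ a x ∧ 0 < 1 + inner ℝ b x := by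
  have hκ := h.kap_small
  rw [mem_ball, dist_zero_right] at hx
  have h1 := abs_real_inner_le_norm a x
  have h2 := abs_real_inner_le_norm b x
  have h3 : ‖a‖ * ‖x‖ ≤ 1 / 1000 * 1 := by
    have := h.core.norm_a; gcongr; linarith
  have h4 : ‖b‖ * ‖x‖ ≤ 1 / 1000 * 1 := by
    have := h.core.norm_b; gcongr; linarith
  rw [abs_le] at h1 h2
  constructor <;> linarith

theorem abs_mu_le : |σ * μ| * (bA K₁ + bB d) ≤ 1 / 4 := by
  have hσa : |σ| = 1 := by rcases h.sign with rfl | rfl <;> norm_num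
  rw [abs_mul, hσa, one_mul, abs_of_pos h.mu_pos]
  have h1 := bν_mul_le (d := d) h.one_le_K
  have h2 : μ * (bA K₁ + bB d) ≤ bν d K₁ * (bA K₁ + bB d) := by
    have := eight_le_bA h.one_le_K
    have := one_le_bB (d := d)
    have := h.mu_le
    gcongr
  linarith

theorem bracket {x : Eu d} (hx : x ∈ dom M K₁ r k x₀) {t : ℝ} (ht : -1 ≤ t) (ht' : t ≤ bT d) :
    |Q M σ r k μ x₀ t x| ≤ r ∧
    σ * (barF (bA K₁) (bB d) r (σ * μ) (Q M σ r k μ x₀ t x) - (polyP M (eLast d) x + k))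
      ≤ μ * r / 4 ∧
    (tang (x - x₀) = r ^ 2 / 4 ∨ polyP M (eLast d) x + k = -(r / (4 * bB d)) ∨ t = -1 →
      σ * (barF (bA K₁) (bB d) r (σ * μ) (Q M σ r k μ x₀ t x) - (polyP M (eLast d) x + k)) < 0) :=
  barF_bracket (Q := Q M σ r k μ x₀ t x) h.one_le_K h.sign h.r_pos h.mu_pos h.mu_le
    (tang_nonneg (x - x₀)) hx.1 ht ht' hx.2.1 hx.2.2 (Q_eq t x)

/-- The barrier is a strict sub- or supersolution. -/
theorem laplacian_barW {A : Eu d} (hA : ‖A‖ ≤ κ) (hAM : ‖A‖ * ‖M‖ ≤ κ * ε) {c : ℝ} (hc : 0 ≤ c)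
    (hcA : c ≤ bA K₁) {x : Eu d} (hx : x ∈ dom M K₁ r k x₀) {t : ℝ} (ht : -1 ≤ t)
    (ht' : t ≤ bT d) :
    κ * ε < σ * (Δ (barW M x₀ (k + σ * μ * r * t) (σ * μ / r) A (1 + σ * μ * c)
      (σ * μ * bB d / r)) x - (2 * inner ℝ A (eLast d) - opTrace M)) := by
  have hj := hasJet_barW h.core.symm x₀ (k + σ * μ * r * t) (σ * μ / r) A (1 + σ * μ * c)
    (σ * μ * bB d / r) x
  rw [hj.laplacian_eq]
  have hQ : |Q M σ r k μ x₀ t x| ≤ r := (h.bracket hx ht ht').1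
  have hr := h.r_pos
  have hK := h.one_le_K
  have hB := one_le_bB (d := d)
  have hA8 := eight_le_bA hK
  have hν := h.mu_le
  have hx1 : ‖x‖ ≤ 1 := by
    have := (h.ball_of_dom hx).2
    rw [mem_ball, dist_zero_right] at this; linarith
  have hxr : ‖x - x₀‖ ≤ r := by
    have := (h.ball_of_dom hx).1
    rw [mem_ball, dist_eq_norm] at this; exact this.le
  have hκ0 := h.core.kappa_nonneg
  have hd : (0 : ℝ) ≤ d := d.cast_nonneg
  have hD : (d : ℝ) ≤ bB d := by unfold bB; linarith
  have htr := abs_opTrace_le M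
  have hs : |inner ℝ A x| ≤ ‖A‖ := by
    have := abs_real_inner_le_norm A x
    nlinarith [norm_nonneg A]
  have hin : inner ℝ A (gradQ M x₀ (σ * μ / r) x)
      = inner ℝ A (eLast d) - inner ℝ A (M x) - 2 * (σ * μ / r) * inner ℝ A (tproj d (x - x₀)) := by
    rw [gradQ, inner_sub_right, inner_sub_right, inner_smul_right]
  set q := paraQ M x₀ (k + σ * μ * r * t) (σ * μ / r) x with hq
  have hQ' : |q| ≤ r := hQ
  have hz : 1 + σ * μ * c + 2 * (σ * μ * bB d / r) * q
      = 1 + σ * μ * (c + 2 * bB d * (q / r)) := by ring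
  rw [hz, hin]
  have key := barrier_laplacian_scalar (σ := σ) (μ := μ) (r := r) (κ := κ) (ε := ε)
    (n := (d : ℝ) + 1) (C := bA K₁ + 2 * bB d) (B := bB d) (D := d) (s := inner ℝ A x)
    (z := c + 2 * bB d * (q / r)) (tr := opTrace M) (G := ‖gradQ M x₀ (σ * μ / r) x‖ ^ 2)
    (Ae := inner ℝ A (eLast d)) (AM := inner ℝ A (M x)) (Aπ := inner ℝ A (tproj d (x - x₀)))
    h.sign h.mu_pos hr (by linarith [h.r_le]) hκ0 h.core.eps_pos (by linarith) (by linarith)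
    (by unfold bB; ring) hd (hs.trans hA) ?_ ?_ ?_ ?_ ?_ ?_ ?_ ?_ ?_ (by linarith [h.kap_small])
    h.kap_const (by have := h.kap_lap; linarith)
  · convert key using 3
  · have h1 : |q / r| ≤ 1 := by rw [abs_div, abs_of_pos hr]; exact (div_le_one hr).2 hQ'
    calc _ ≤ |c| + |2 * bB d * (q / r)| := abs_add_le _ _
      _ = c + 2 * bB d * |q / r| := by
        rw [abs_of_nonneg hc, abs_mul, abs_of_nonneg (by linarith : 0 ≤ 2 * bB d)]
      _ ≤ bA K₁ + 2 * bB d * 1 := by gcongr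
      _ = _ := by ring
  · exact htr.trans (by have := h.core.norm_M; gcongr)
  · rw [abs_mul]
    calc _ ≤ ((d : ℝ) + 1) * ‖M‖ * ‖A‖ := by gcongr
      _ = (d + 1) * (‖A‖ * ‖M‖) := by ring
      _ ≤ _ := by gcongr
  · have := one_le_norm_gradQ h.core.symm h.core.map_dir x₀ (σ * μ / r) x
    nlinarith
  · have := abs_real_inner_le_norm A (eLast d)
    rw [norm_eLast, mul_one] at this
    exact this.trans hA
  · calc _ ≤ ‖A‖ * ‖M x‖ := abs_real_inner_le_norm _ _
      _ ≤ ‖A‖ * (‖M‖ * 1) := by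
        gcongr
        exact (M.le_opNorm x).trans (by gcongr)
      _ ≤ _ := by rw [mul_one]; exact hAM
  · calc _ ≤ ‖A‖ * ‖tproj d (x - x₀)‖ := abs_real_inner_le_norm _ _
      _ ≤ κ * r := by
        gcongr
        exact (norm_tproj_le _).trans hxr
  · have h1 := bν_mul_mul_le (d := d) hK
    have h2 : (d : ℝ) * (μ * (bA K₁ + 2 * bB d)) ≤ bB d * (bν d K₁ * (bA K₁ + 2 * bB d)) := by
      have := h.mu_pos
      gcongr
    linarith
  · have h1 := bν_mul_mul_le (d := d) hK
    have h2 : 1 * (μ * (bA K₁ + 2 * bB d)) ≤ bB d * (bν d K₁ * (bA K₁ + 2 * bB d)) := by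
      have := h.mu_pos
      gcongr
    linarith

end Near


/-! ### Contradictions at a contact point: slopes and Laplacians. -/

section Slopes

theorem eventually_pos_of_hasDerivAt {f : ℝ → ℝ} {p : ℝ} (hf : HasDerivAt f p 0) (h0 : f 0 = 0)
    (hp : 0 < p) : ∀ᶠ s in 𝓝[>] (0 : ℝ), 0 < f s := by
  have h1 := hasDerivWithinAt_iff_tendsto_slope.1 (hf.hasDerivWithinAt (s := Set.Ioi 0))
  have e : Set.Ioi (0 : ℝ) \ {0} = Set.Ioi 0 := by ext; simp
  rw [e] at h1
  filter_upwards [h1.eventually (lt_mem_nhds hp), self_mem_nhdsWithin] with s hs hs0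
  have hs0' : (0 : ℝ) < s := hs0
  rw [slope_def_field, h0, sub_zero, sub_zero] at hs
  exact (div_pos_iff_of_pos_right hs0').1 hs

theorem HasJet.hasDerivAt_line {E : Type*} [NormedAddCommGroup E] [InnerProductSpace ℝ E]
    [FiniteDimensional ℝ E] {f : E → ℝ} {x g : E} {l : ℝ} (h : HasJet f x g l) (w : E) :
    HasDerivAt (fun s : ℝ => f (x + s • w)) (inner ℝ g w) 0 := by
  have h1 : HasDerivAt (fun s : ℝ => x + s • w) w 0 := by
    simpa using ((hasDerivAt_id (0 : ℝ)).smul_const w).const_add x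
  have h2 : HasFDerivAt f (fderiv ℝ f x) (x + (0 : ℝ) • w) := by
    simpa using h.differentiableAt.hasFDerivAt
  have h3 := h2.comp_hasDerivAt (0 : ℝ) h1
  rw [h.fderiv_eq] at h3
  exact h3

/-- For `σ = 1` the barrier's negative slope `(1 + μ)G` is at most `1 + 2μ`, so the free boundary
condition with `s = 2μ` allows a positive slope factor of at most `1 + 2K₁μ + κε`. Contact from
below forces at least `1 + (4K₁ + 4)μ`. For `σ = -1` the upper bound on `G` keeps the barrier's
positive slope too small. -/
theorem slope_contradiction {σ α β sa sb G μ K₁ κε p q s₀ : ℝ} (hσ : σ = 1 ∨ σ = -1) (hα : 0 < α)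
    (hβ : 0 ≤ β) (hsa : 0 < sa) (hsb : 0 < sb) (hμ : 0 < μ) (hμ1 : μ ≤ 1 / 8) (hK : 1 ≤ K₁)
    (hs₀ : 2 * μ ≤ s₀) (hκ0 : 0 ≤ κε) (hκ : κε ≤ μ / 4) (hA : μ * (4 * K₁ + 4) ≤ 1) (hG1 : 1 ≤ G)
    (hG : G ≤ 1 + κε + μ ^ 2)
    (hp : 0 ≤ σ * (p - α * sa * ((1 + σ * μ * (4 * K₁ + 4)) * G)))
    (hq : σ * (q - β * sb * ((1 + σ * μ) * G)) ≤ 0)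
    (hfb : ∀ s : ℝ, 0 ≤ s → s ≤ s₀ → σ * (q - β * sb * (1 + σ * s)) ≤ 0 →
      σ * (p - α * sa * (1 + σ * (K₁ * s + κε))) ≤ 0) : False := by
  have hμ2 : μ ^ 2 ≤ μ / 8 := by nlinarith
  have hG2 : G ≤ 1 + 3 / 8 * μ := by linarith
  have hβs : 0 ≤ β * sb := by positivity
  have hαs : 0 < α * sa := by positivity
  have hstep : σ * (q - β * sb * (1 + σ * (2 * μ))) ≤ 0 := by
    rcases hσ with rfl | rfl
    · have : (1 + 1 * μ) * G ≤ 1 + 1 * (2 * μ) := by nlinarith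
      have := mul_le_mul_of_nonneg_left this hβs
      linarith
    · have : 1 + -1 * (2 * μ) ≤ (1 + -1 * μ) * G := by nlinarith
      have := mul_le_mul_of_nonneg_left this hβs
      linarith
  have h1 := hfb (2 * μ) (by linarith) hs₀ hstep
  have hKμ : μ ≤ K₁ * μ := by nlinarith
  rcases hσ with rfl | rfl
  · have : 1 + 1 * (K₁ * (2 * μ) + κε) < (1 + 1 * μ * (4 * K₁ + 4)) * G := by nlinarith
    have := mul_lt_mul_of_pos_left this hαs
    linarith
  · have : (1 + -1 * μ * (4 * K₁ + 4)) * G < 1 + -1 * (K₁ * (2 * μ) + κε) := by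
      have h2 : 0 ≤ 1 + -1 * μ * (4 * K₁ + 4) := by linarith
      have h3 : (1 + -1 * μ * (4 * K₁ + 4)) * G
          ≤ (1 + -1 * μ * (4 * K₁ + 4)) * (1 + 3 / 8 * μ) := mul_le_mul_of_nonneg_left hG2 h2
      nlinarith
    have := mul_lt_mul_of_pos_left this hαs
    linarith

/-- At the contact point the signed difference has a local minimum, hence a nonnegative Laplacian;
the strict inequality for `w` outweighs the error in the equation for `f` and makes it negative. -/
theorem laplacian_contact {E : Type*} [NormedAddCommGroup E] [InnerProductSpace ℝ E]
    [FiniteDimensional ℝ E] {f w : E → ℝ} {x : E} {γ T e σ : ℝ} (hσ : σ = 1 ∨ σ = -1) (hγ : 0 < γ)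
    (hf : ContDiffAt ℝ 2 f x) (hw : ContDiffAt ℝ 2 w x) (hΔf : |Δ f x - γ * T| ≤ γ * e)
    (hΔw : e < σ * (Δ w x - T)) (heq : σ * (f x - γ * w x) = 0)
    (hmin : ∀ᶠ y in 𝓝 x, 0 ≤ σ * (f y - γ * w y)) : False := by
  have hJf : HasJet f x (gradient f x) (Δ f x) := ⟨hf, fun v => by simp [gradient], rfl⟩
  have hJw : HasJet w x (gradient w x) (Δ w x) := ⟨hw, fun v => by simp [gradient], rfl⟩
  have hJ := (hJf.sub (hJw.const_mul γ)).const_mul σ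
  have h1 := laplacian_nonneg_of_isLocalMin hJ.1 (by
    filter_upwards [hmin] with y hy
    rw [heq]; exact hy)
  rw [hJ.3] at h1
  rw [abs_le] at hΔf
  have h2 := mul_lt_mul_of_pos_left hΔw hγ
  rcases hσ with rfl | rfl <;> linarith

end Slopes

/-! ### Excluding contact on the boundary of the region and inside the phases. -/

namespace Near

variable {d : ℕ} {v : Eu d → ℝ} {α β ε κ K₁ s₀ : ℝ} {M : Eu d →L[ℝ] Eu d} {a b : Eu d}
  {σ r k μ : ℝ} {x₀ : Eu d}

theorem continuous_Q (t : ℝ) : Continuous (Q M σ r k μ x₀ t) := continuous_paraQ _ _ _ _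

theorem hasJet_Q (h : Near v α β ε κ K₁ s₀ M a b σ r k μ x₀) (t : ℝ) (x : Eu d) :
    HasJet (Q M σ r k μ x₀ t) x (gradQ M x₀ (σ * μ / r) x)
      (-opTrace M - 2 * (σ * μ / r) * d) := hasJet_paraQ h.core.symm _ _ _ _

theorem barW_eq (A : Eu d) (t p m₂ : ℝ) (x : Eu d) :
    barW M x₀ (k + σ * μ * r * t) (σ * μ / r) A p m₂ x = (1 + inner ℝ A x) *
      (p * Q M σ r k μ x₀ t x + m₂ * (Q M σ r k μ x₀ t x * Q M σ r k μ x₀ t x)) := rfl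

variable (h : Near v α β ε κ K₁ s₀ M a b σ r k μ x₀)
include h

theorem Psi_of_Q_nonneg {x : Eu d} (hx : x ∈ dom M K₁ r k x₀) {t : ℝ} (ht : -1 ≤ t)
    (ht' : t ≤ bT d) (hQ : 0 ≤ Q M σ r k μ x₀ t x) :
    Psi α β a b x (barF (bA K₁) (bB d) r (σ * μ) (Q M σ r k μ x₀ t x))
      = α * barW M x₀ (k + σ * μ * r * t) (σ * μ / r) a (1 + σ * μ * bA K₁) (σ * μ * bB d / r) x := by
  have hB := one_le_bB (d := d)
  have hA := eight_le_bA h.one_le_K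
  obtain ⟨e, hpos⟩ := barF_of_nonneg h.r_pos (by linarith) (by linarith) h.abs_mu_le
    (h.bracket hx ht ht').1 hQ
  rw [Psi_of_nonneg (by linarith), e, barW_eq]; ring

theorem Psi_of_Q_nonpos {x : Eu d} (hx : x ∈ dom M K₁ r k x₀) {t : ℝ} (ht : -1 ≤ t)
    (ht' : t ≤ bT d) (hQ : Q M σ r k μ x₀ t x ≤ 0) :
    Psi α β a b x (barF (bA K₁) (bB d) r (σ * μ) (Q M σ r k μ x₀ t x))
      = β * barW M x₀ (k + σ * μ * r * t) (σ * μ / r) b (1 + σ * μ * 1) (σ * μ * bB d / r) x := by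
  have hB := one_le_bB (d := d)
  have hA := eight_le_bA h.one_le_K
  obtain ⟨e, hneg⟩ := barF_of_nonpos h.r_pos (by linarith) (by linarith) h.abs_mu_le
    (h.bracket hx ht ht').1 hQ
  rw [Psi_of_nonpos (by linarith), e, barW_eq]; ring

theorem barF_Q_pos_iff {x : Eu d} (hx : x ∈ dom M K₁ r k x₀) {t : ℝ} (ht : -1 ≤ t)
    (ht' : t ≤ bT d) :
    0 < barF (bA K₁) (bB d) r (σ * μ) (Q M σ r k μ x₀ t x) ↔ 0 < Q M σ r k μ x₀ t x :=
  barF_pos_iff h.r_pos (by linarith [one_le_bB (d := d)]) (by linarith [eight_le_bA h.one_le_K])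
    h.abs_mu_le (h.bracket hx ht ht').1

theorem barF_Q_neg_iff {x : Eu d} (hx : x ∈ dom M K₁ r k x₀) {t : ℝ} (ht : -1 ≤ t)
    (ht' : t ≤ bT d) :
    barF (bA K₁) (bB d) r (σ * μ) (Q M σ r k μ x₀ t x) < 0 ↔ Q M σ r k μ x₀ t x < 0 :=
  barF_neg_iff h.r_pos (by linarith [one_le_bB (d := d)]) (by linarith [eight_le_bA h.one_le_K])
    h.abs_mu_le (h.bracket hx ht ht').1

theorem weights_pos {x : Eu d} (hx : x ∈ dom M K₁ r k x₀) :
    0 < 1 + inner ℝ a x ∧ 0 < 1 + inner ℝ b x :=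
  h.one_add_pos (ball_subset_ball (by norm_num) (h.ball_of_dom hx).2)

theorem Psi_Q_pos_iff {x : Eu d} (hx : x ∈ dom M K₁ r k x₀) {t : ℝ} (ht : -1 ≤ t)
    (ht' : t ≤ bT d) :
    0 < Psi α β a b x (barF (bA K₁) (bB d) r (σ * μ) (Q M σ r k μ x₀ t x))
      ↔ 0 < Q M σ r k μ x₀ t x := by
  rw [Psi_pos_iff h.core.alpha_pos h.core.beta_nonneg (h.weights_pos hx).1 (h.weights_pos hx).2,
    h.barF_Q_pos_iff hx ht ht']

/-- The barrier's phase lies globally on the right side of that of `v`. -/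
theorem global_touch {t : ℝ} (ht : -1 ≤ t) (ht' : t ≤ bT d)
    (hgap : ∀ y ∈ dom M K₁ r k x₀, 0 ≤ gap v α β K₁ M a b σ r k μ x₀ t y) :
    ∀ x ∈ ball (0 : Eu d) (2 / 3), (σ = 1 → 0 < Q M σ r k μ x₀ t x → 0 < v x) ∧
      (σ = -1 → 0 < v x → 0 < Q M σ r k μ x₀ t x) := by
  intro x hx
  have hr := h.r_pos
  have hμ := h.mu_pos
  have hK := h.one_le_K
  have hg := h.glob x hx
  have htg := tang_nonneg (x - x₀)
  have hB := one_le_bB (d := d)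
  have hTl := bT_le (d := d)
  have hμr : 0 < μ * r := by positivity
  have hνB := bν_mul_bB_le (d := d) hK
  have hνT := bν_le_bTop (d := d) hK
  have hTpos := bTop_pos (d := d) hK
  have hsmall1 : 2 * μ * r < r / (4 * bB d) := by
    rw [lt_div_iff₀ (by positivity)]
    have h1 : μ * bB d ≤ 1 / 10000 :=
      (mul_le_mul_of_nonneg_right h.mu_le (by linarith)).trans hνB
    have := mul_le_mul_of_nonneg_right h1 hr.le
    linarith
  have hsmall2 : 2 * μ * r < bTop d K₁ * r := by
    have : 2 * μ < bTop d K₁ := by linarith [h.mu_le]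
    exact mul_lt_mul_of_pos_right this hr
  set Y := polyP M (eLast d) x + k with hY
  set tg := tang (x - x₀) with htgd
  have e1 : μ / r * tg = 2 * (μ / (2 * r) * tg) := by field_simp
  have htr : μ * r * t ≤ μ * r * (1 / 32) := by gcongr; linarith
  have htr' : μ * r * (-1) ≤ μ * r * t := by gcongr
  have hnn : 0 ≤ μ / (2 * r) * tg := by positivity
  have hQ := Q_eq (M := M) (σ := σ) (r := r) (k := k) (μ := μ) (x₀ := x₀) t x
  rw [← hY, ← htgd] at hQ
  have hQ1 : σ = 1 → Q M σ r k μ x₀ t x = Y + μ * r * t - 2 * (μ / (2 * r) * tg) := by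
    intro hs; rw [hQ, hs, ← e1]; ring
  have hQ2 : σ = -1 → Q M σ r k μ x₀ t x = Y - μ * r * t + 2 * (μ / (2 * r) * tg) := by
    intro hs; rw [hQ, hs, ← e1]; ring
  -- Beyond the lateral side, `μ/(2r)` times `tang` is at least `μr/8`, more than the shift `μrt ≤
  -- μr/32`, so the known paraboloid of half the opening decides. Below and above the region the
  -- level of `P` decides; inside it the ordering of the functions does.
  by_cases hside : r ^ 2 / 4 < tg
  · have h8 : μ * r * (1 / 8) ≤ μ / (2 * r) * tg := by
      have : μ / (2 * r) * (r ^ 2 / 4) ≤ μ / (2 * r) * tg := by gcongr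
      calc _ = μ / (2 * r) * (r ^ 2 / 4) := by field_simp; norm_num
        _ ≤ _ := this
    refine ⟨fun hs hpos => hg.1 hs ?_, fun hs hpos => ?_⟩
    · rw [hQ1 hs] at hpos; linarith
    · have := hg.2 hs hpos
      rw [hQ2 hs]; linarith
  · have hside' := not_lt.1 hside
    have h8 : μ / (2 * r) * tg ≤ μ * r * (1 / 8) := by
      have : μ / (2 * r) * tg ≤ μ / (2 * r) * (r ^ 2 / 4) := by gcongr
      calc _ ≤ μ / (2 * r) * (r ^ 2 / 4) := this
        _ = _ := by field_simp; norm_num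
    by_cases hlow : Y < -(r / (4 * bB d))
    · refine ⟨fun hs hpos => ?_, fun hs hpos => ?_⟩
      · rw [hQ1 hs] at hpos; linarith
      · have := hg.2 hs hpos
        linarith
    · by_cases hhigh : bTop d K₁ * r < Y
      · refine ⟨fun hs hpos => hg.1 hs (by linarith), fun hs hpos => ?_⟩
        rw [hQ2 hs]; linarith
      · have hD : x ∈ dom M K₁ r k x₀ := ⟨hside', not_lt.1 hlow, not_lt.1 hhigh⟩
        have hgx := hgap x hD
        refine ⟨fun hs hpos => ?_, fun hs hpos => ?_⟩
        · have := (h.Psi_Q_pos_iff hD ht ht').2 hpos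
          rw [gap, hs, one_mul] at hgx
          rw [hs] at this
          linarith
        · refine (h.Psi_Q_pos_iff hD ht ht').1 ?_
          rw [gap] at hgx
          have hs' : σ = -1 := hs
          nlinarith

/-- On the lateral side and the bottom the barrier is strictly on the harmless side of the flatness
level, hence of `v`, provided the profile is strictly monotone there; `hN` guarantees this when `β =
0`. On the top the Harnack gain separates the two. -/
theorem interior_of_contact {t : ℝ} (ht : -1 ≤ t) (ht' : t ≤ bT d) {x : Eu d}
    (hx : x ∈ dom M K₁ r k x₀) (h0 : gap v α β K₁ M a b σ r k μ x₀ t x = 0)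
    (hN : 0 < β ∨ (σ = 1 ∧ 0 ≤ Q M σ r k μ x₀ t x) ∨ (σ = -1 ∧ 0 ≤ polyP M (eLast d) x + k)) :
    dom M K₁ r k x₀ ∈ 𝓝 x := by
  obtain ⟨-, hb1, hb2⟩ := h.bracket hx ht ht'
  have hxr := (h.ball_of_dom hx).1
  have hfl := h.flat x hxr
  have ⟨hwa, hwb⟩ := h.weights_pos hx
  have hα := h.core.alpha_pos
  have hβ := h.core.beta_nonneg
  have hμr : 0 < μ * r := mul_pos h.mu_pos h.r_pos
  have hFneg := h.barF_Q_neg_iff hx ht ht'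
  set F := barF (bA K₁) (bB d) r (σ * μ) (Q M σ r k μ x₀ t x) with hF
  set Y := polyP M (eLast d) x + k with hY
  have hσne : σ ≠ 0 := by rcases h.sign with rfl | rfl <;> norm_num
  have hv : v x = Psi α β a b x F := by
    rw [gap] at h0
    have := (mul_eq_zero.1 h0).resolve_left hσne
    linarith
  have hstrict : ¬ σ * (F - Y) < 0 := by
    intro hlt
    rw [hv] at hfl
    rcases h.sign with hs | hs
    · rw [hs] at hlt hfl
      have : Psi α β a b x F < Psi α β a b x Y := by
        refine Psi_lt hα hwa hwb (by linarith) ?_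
        rcases hN with h1 | h1 | h1
        · exact Or.inl h1
        · exact Or.inr (not_lt.1 fun hn => absurd (hFneg.1 hn) (not_lt.2 h1.2))
        · exact absurd (hs.symm.trans h1.1) (by norm_num)
      linarith
    · rw [hs] at hlt hfl
      have : Psi α β a b x Y < Psi α β a b x F := by
        refine Psi_lt hα hwa hwb (by linarith) ?_
        rcases hN with h1 | h1 | h1
        · exact Or.inl h1
        · exact absurd (hs.symm.trans h1.1) (by norm_num)
        · exact Or.inr h1.2
      linarith
  have hside : tang (x - x₀) < r ^ 2 / 4 :=
    lt_of_le_of_ne hx.1 fun he => hstrict (hb2 (Or.inl he))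
  have hbot : -(r / (4 * bB d)) < Y :=
    lt_of_le_of_ne hx.2.1 fun he => hstrict (hb2 (Or.inr (Or.inl he.symm)))
  have htop : Y < bTop d K₁ * r := by
    refine lt_of_le_of_ne hx.2.2 fun he => ?_
    have h1 := h.top x hxr hx.1 he
    have hTr : 0 < bTop d K₁ * r := mul_pos (bTop_pos h.one_le_K) h.r_pos
    have hνT := bν_le_bTop (d := d) h.one_le_K
    have hμT : μ * r ≤ bTop d K₁ * r := by
      have := h.r_pos
      have : μ ≤ bTop d K₁ := by linarith [h.mu_le, bTop_pos (d := d) h.one_le_K]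
      gcongr
    rw [hv] at h1
    have hαw : 0 < α * (1 + inner ℝ a x) := by positivity
    rcases h.sign with hs | hs
    · rw [hs] at h1 hb1
      have h2 : Psi α β a b x F ≤ Psi α β a b x (bTop d K₁ * r + μ * r / 4) :=
        Psi_mono hα hβ hwa hwb (by linarith)
      rw [Psi_of_nonneg (y := bTop d K₁ * r + μ * r / 4) (by linarith)] at h2
      nlinarith
    · rw [hs] at h1 hb1
      have h2 : Psi α β a b x (bTop d K₁ * r - μ * r / 4) ≤ Psi α β a b x F :=
        Psi_mono hα hβ hwa hwb (by linarith)
      rw [Psi_of_nonneg (by linarith)] at h2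
      nlinarith
  have hcP : Continuous fun y => polyP M (eLast d) y + k := (continuous_polyP M _).add_const k
  have hct : Continuous fun y : Eu d => tang (y - x₀) :=
    continuous_tang.comp (continuous_id.sub continuous_const)
  filter_upwards [hct.continuousAt.eventually (gt_mem_nhds hside),
    hcP.continuousAt.eventually (lt_mem_nhds hbot),
    hcP.continuousAt.eventually (gt_mem_nhds htop)] with y h1 h2 h3
  exact ⟨h1.le, h2.le, h3.le⟩

theorem no_contact_pos {t : ℝ} (ht : -1 ≤ t) (ht' : t ≤ bT d)
    (hgap : ∀ y ∈ dom M K₁ r k x₀, 0 ≤ gap v α β K₁ M a b σ r k μ x₀ t y) {x : Eu d}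
    (hx : x ∈ dom M K₁ r k x₀) (hxn : dom M K₁ r k x₀ ∈ 𝓝 x)
    (h0 : gap v α β K₁ M a b σ r k μ x₀ t x = 0) (hpos : 0 < v x) : False := by
  have hσne : σ ≠ 0 := by rcases h.sign with rfl | rfl <;> norm_num
  have hv : v x = Psi α β a b x (barF (bA K₁) (bB d) r (σ * μ) (Q M σ r k μ x₀ t x)) := by
    rw [gap] at h0
    have := (mul_eq_zero.1 h0).resolve_left hσne
    linarith
  have hQ : 0 < Q M σ r k μ x₀ t x := (h.Psi_Q_pos_iff hx ht ht').1 (by rw [← hv]; exact hpos)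
  have hx1 : x ∈ posPhase v := ⟨ball_subset_ball (by norm_num) (h.ball_of_dom hx).2, hpos⟩
  have hA := eight_le_bA h.one_le_K
  obtain ⟨hc, hΔ⟩ := h.core.pos x hx1
  refine laplacian_contact h.sign h.core.alpha_pos hc
    (hasJet_barW h.core.symm x₀ (k + σ * μ * r * t) (σ * μ / r) a (1 + σ * μ * bA K₁)
      (σ * μ * bB d / r) x).1 hΔ
    (h.laplacian_barW h.core.norm_a h.core.norm_aM (by linarith) le_rfl hx ht ht') ?_ ?_
  · rw [← h.Psi_of_Q_nonneg hx ht ht' hQ.le]; exact h0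
  · filter_upwards [hxn, (continuous_Q t).continuousAt.eventually (lt_mem_nhds hQ)] with y hy hQy
    rw [← h.Psi_of_Q_nonneg hy ht ht' (le_of_lt hQy)]
    exact hgap y hy

/-- For `β > 0` the Laplacians are compared. For `β = 0` there is no equation in this phase, and the
contact is excluded by geometry: either `Q` would have a local maximum, or `v` would be positive
arbitrarily close to a point of the open negative phase. -/
theorem no_contact_neg {t : ℝ} (ht : -1 ≤ t) (ht' : t ≤ bT d)
    (hgap : ∀ y ∈ dom M K₁ r k x₀, 0 ≤ gap v α β K₁ M a b σ r k μ x₀ t y) {x : Eu d}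
    (hx : x ∈ dom M K₁ r k x₀) (hxn : dom M K₁ r k x₀ ∈ 𝓝 x)
    (h0 : gap v α β K₁ M a b σ r k μ x₀ t x = 0) (hneg : x ∈ negPhase v)
    (hN : 0 < β ∨ 0 ≤ Q M σ r k μ x₀ t x ∧ (σ = -1 → x ∈ closure {y | 0 < v y})) : False := by
  have hσne : σ ≠ 0 := by rcases h.sign with rfl | rfl <;> norm_num
  have hv : v x = Psi α β a b x (barF (bA K₁) (bB d) r (σ * μ) (Q M σ r k μ x₀ t x)) := by
    rw [gap] at h0
    have := (mul_eq_zero.1 h0).resolve_left hσne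
    linarith
  have hnear : ∀ᶠ y in 𝓝 x, v y ≤ 0 := by
    have := mem_interior_iff_mem_nhds.1 hneg
    filter_upwards [this] with y hy using hy.2
  have hball : ∀ᶠ y in 𝓝 x, y ∈ ball (0 : Eu d) (2 / 3) :=
    isOpen_ball.mem_nhds (h.ball_of_dom hx).2
  have hvx : v x ≤ 0 := hnear.self_of_nhds
  have hQ : Q M σ r k μ x₀ t x ≤ 0 := not_lt.1 fun hq => by
    have := (h.Psi_Q_pos_iff hx ht ht').2 hq
    linarith
  have hQ1 : σ = 1 → ∀ᶠ y in 𝓝 x, Q M σ r k μ x₀ t y ≤ 0 := by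
    intro hs
    filter_upwards [hnear, hball] with y hy hyb
    exact not_lt.1 fun hq => absurd ((h.global_touch ht ht' hgap y hyb).1 hs hq) (not_lt.2 hy)
  rcases hN with hβ | ⟨hQ0, hcl⟩
  · obtain ⟨hc, hΔ⟩ := h.core.neg hβ x hneg
    refine laplacian_contact h.sign hβ hc
      (hasJet_barW h.core.symm x₀ (k + σ * μ * r * t) (σ * μ / r) b (1 + σ * μ * 1)
        (σ * μ * bB d / r) x).1 hΔ
      (h.laplacian_barW h.core.norm_b h.core.norm_bM zero_le_one
        (by linarith [eight_le_bA h.one_le_K]) hx ht ht') ?_ ?_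
    · rw [← h.Psi_of_Q_nonpos hx ht ht' hQ]; exact h0
    · rcases h.sign with hs | hs
      · filter_upwards [hxn, hQ1 hs] with y hy hQy
        rw [← h.Psi_of_Q_nonpos hy ht ht' hQy]
        exact hgap y hy
      · filter_upwards [hxn, hnear] with y hy hvy
        rcases le_or_gt (Q M σ r k μ x₀ t y) 0 with hQy | hQy
        · rw [← h.Psi_of_Q_nonpos hy ht ht' hQy]
          exact hgap y hy
        -- Where `Q > 0` the barrier is given by the other formula. The extension of the negative
        -- formula is nonnegative there while `v ≤ 0`, so the ordering needed for the minimum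
        -- persists.
        · have hm : |σ * μ| * (1 + bB d) ≤ 1 / 4 :=
            le_trans (by gcongr; linarith [eight_le_bA h.one_le_K]) h.abs_mu_le
          have h1 := abs_profile_le h.r_pos (by linarith [one_le_bB (d := d)]) zero_le_one hm
            (h.bracket hy ht ht').1
          rw [abs_of_pos hQy, abs_le] at h1
          have h2 := (h.weights_pos hy).2
          have h3 : 0 ≤ β * barW M x₀ (k + σ * μ * r * t) (σ * μ / r) b (1 + σ * μ * 1)
              (σ * μ * bB d / r) y := by
            rw [barW_eq]
            exact mul_nonneg hβ.le (mul_nonneg h2.le (by linarith))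
          have : v y - β * barW M x₀ (k + σ * μ * r * t) (σ * μ / r) b (1 + σ * μ * 1)
              (σ * μ * bB d / r) y ≤ 0 := by linarith
          have hσn : σ ≤ 0 := by rw [hs]; norm_num
          exact mul_nonneg_of_nonpos_of_nonpos hσn this
  · rcases h.sign with hs | hs
    -- `Q ≤ 0` near `x` with equality at `x` contradicts the lower bound on the gradient of `Q`.
    · have hQ00 : Q M σ r k μ x₀ t x = 0 := le_antisymm hQ hQ0
      have hmax : IsLocalMax (Q M σ r k μ x₀ t) x := by
        filter_upwards [hQ1 hs] with y hy
        rw [hQ00]; exact hy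
      have h1 := hmax.fderiv_eq_zero
      have hJ := (h.hasJet_Q t x).fderiv_eq (gradQ M x₀ (σ * μ / r) x)
      rw [h1, real_inner_self_eq_norm_sq] at hJ
      have := one_le_norm_gradQ h.core.symm h.core.map_dir x₀ (σ * μ / r) x
      simp only [zero_apply] at hJ
      nlinarith
    · obtain ⟨y, hy, hy2⟩ := (mem_closure_iff_nhds.1 (hcl hs)) _ hnear
      exact absurd (show 0 < v y from hy2) (not_lt.2 hy)

end Near


/-! ### Excluding contact on the free boundary; conclusion of the sliding argument. -/

namespace Near

variable {d : ℕ} {v : Eu d → ℝ} {α β ε κ K₁ s₀ : ℝ} {M : Eu d →L[ℝ] Eu d} {a b : Eu d}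
  {σ r k μ : ℝ} {x₀ : Eu d}

variable (h : Near v α β ε κ K₁ s₀ M a b σ r k μ x₀)
include h

/-- The tangential part of the gradient is at most `‖M‖ + μ`, whose square is at most `2‖M‖² + 2μ²`
with `‖M‖² ≤ κε`; the square root halves this. A bound of second order in `μ` is what keeps the
slope comparison strict. -/
theorem norm_gradQ_le {x : Eu d} (hx : x ∈ dom M K₁ r k x₀) :
    ‖gradQ M x₀ (σ * μ / r) x‖ ≤ 1 + κ * ε + μ ^ 2 := by
  have hr := h.r_pos
  have hμ := h.mu_pos
  have hσa : |σ| = 1 := by rcases h.sign with rfl | rfl <;> norm_num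
  have hκε : 0 ≤ κ * ε := mul_nonneg h.core.kappa_nonneg h.core.eps_pos.le
  have h1 := norm_gradQ_sq h.core.symm h.core.map_dir x₀ (σ * μ / r) x
  have hx1 : ‖x‖ ≤ 1 := by
    have := (h.ball_of_dom hx).2
    rw [mem_ball, dist_zero_right] at this; linarith
  have h2 : ‖tproj d (x - x₀)‖ ≤ r / 2 := by
    have ht := hx.1
    rw [tang_eq_norm_sq] at ht
    exact (sq_le_sq₀ (norm_nonneg _) (by positivity)).1 (by linarith [div_pow r 2 2])
  have h3 : ‖M x + (2 * (σ * μ / r)) • tproj d (x - x₀)‖ ≤ ‖M‖ + μ := by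
    calc _ ≤ ‖M x‖ + ‖(2 * (σ * μ / r)) • tproj d (x - x₀)‖ := norm_add_le _ _
      _ ≤ ‖M‖ * 1 + 2 * (μ / r) * (r / 2) := by
        refine add_le_add ((M.le_opNorm x).trans (by gcongr)) ?_
        rw [norm_smul, Real.norm_eq_abs, abs_mul, abs_div, abs_mul, hσa, abs_of_pos hμ,
          abs_of_pos hr, one_mul, abs_of_pos (by norm_num : (0 : ℝ) < 2)]
        gcongr
      _ = _ := by field_simp
  have h4 : ‖M x + (2 * (σ * μ / r)) • tproj d (x - x₀)‖ ^ 2 ≤ (‖M‖ + μ) ^ 2 := by gcongr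
  have h5 := h.core.norm_MM
  have h6 : ‖gradQ M x₀ (σ * μ / r) x‖ ^ 2 ≤ (1 + κ * ε + μ ^ 2) ^ 2 := by
    rw [h1]
    nlinarith [sq_nonneg (‖M‖ - μ), sq_nonneg (κ * ε + μ ^ 2)]
  exact (sq_le_sq₀ (norm_nonneg _) (by positivity)).1 h6

/-- The zero set of `Q` is a quadratic graph over `xₙ = 0` (`quadPoly_eq`), and it is admissible
because `μ / r ≤ 1/8`. This bound is one reason why the iteration needs `ε` to be small compared
with `r²`. -/
theorem testQuad {t : ℝ} (ht : -1 ≤ t) (ht' : t ≤ bT d) :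
    TestQuad (-(k + σ * μ * r * t) + σ * μ / r * tang x₀) (-((2 * (σ * μ / r)) • tproj d x₀))
      (M + (2 * (σ * μ / r)) • tproj d) := by
  have hr := h.r_pos
  have hμ := h.mu_pos
  have hσa : |σ| = 1 := by rcases h.sign with rfl | rfl <;> norm_num
  have hm : |σ * μ / r| ≤ 1 / 8 := by
    rw [abs_div, abs_mul, hσa, one_mul, abs_of_pos hμ, abs_of_pos hr, div_le_iff₀ hr]
    linarith [h.mu_le_r]
  have hκ := h.kap_small
  have hM := h.core.norm_M
  have hx₀ := h.norm_x₀
  have h2m : |2 * (σ * μ / r)| ≤ 1 / 4 := by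
    rw [abs_mul, abs_of_pos (by norm_num : (0 : ℝ) < 2)]; linarith
  refine ⟨?_, ?_, ?_, ?_, ?_, ?_⟩
  · intro x y
    have h1 := h.core.symm x y
    have h2 := tproj_symm (d := d) x y
    simp only [ContinuousLinearMap.coe_coe] at h1 h2
    simp only [ContinuousLinearMap.coe_coe, add_apply, smul_apply, inner_add_left, inner_add_right,
      inner_smul_left, inner_smul_right, h1, h2]
    simp
  · rw [inner_neg_left, inner_smul_left, inner_tproj_eLast]; simp
  · rw [add_apply, smul_apply, h.core.map_dir, tproj_eLast]; simp
  · have h1 : |k| ≤ 1 / 8 := by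
      have := h.level
      have h3 := bν_le_bT (d := d) h.one_le_K
      have h4 := bT_le (d := d)
      have : bν d K₁ * r ≤ 1 * (1 / 8) := by
        have := h.r_le; gcongr; linarith
      linarith
    have h2 : |σ * μ * r * t| ≤ 1 / 8 := by
      rw [abs_mul, abs_mul, abs_mul, hσa, one_mul, abs_of_pos hμ, abs_of_pos hr]
      have h3 : |t| ≤ 1 := abs_le.2 ⟨ht, by linarith [bT_le (d := d)]⟩
      have h4 : μ * r * |t| ≤ 1 * (1 / 8) * 1 := by
        have := h.r_le; have := h.mu_le_r; gcongr; linarith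
      linarith
    have h3 : |σ * μ / r * tang x₀| ≤ 1 / 8 := by
      rw [abs_mul, abs_of_nonneg (tang_nonneg x₀)]
      have : tang x₀ ≤ 1 := (tang_le x₀).trans (by nlinarith [norm_nonneg x₀])
      have := tang_nonneg x₀
      calc |σ * μ / r| * tang x₀ ≤ 1 / 8 * 1 := by gcongr
        _ = 1 / 8 := by norm_num
    rw [abs_le] at *
    constructor <;> linarith
  · rw [norm_neg, norm_smul, Real.norm_eq_abs]
    have := norm_tproj_le x₀
    calc _ ≤ 1 / 4 * (1 / 2 : ℝ) := by gcongr; linarith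
      _ ≤ 1 := by norm_num
  · calc _ ≤ ‖M‖ + ‖(2 * (σ * μ / r)) • tproj d‖ := norm_add_le _ _
      _ ≤ 1 / 1000 + 1 / 4 * 1 := by
        rw [norm_smul, Real.norm_eq_abs]
        have := opNorm_tproj_le (d := d)
        gcongr
        linarith
      _ ≤ 1 := by norm_num

omit h in
theorem quadPoly_eq (t : ℝ) (x : Eu d) :
    quadPoly (-(k + σ * μ * r * t) + σ * μ / r * tang x₀) (-((2 * (σ * μ / r)) • tproj d x₀))
      (M + (2 * (σ * μ / r)) • tproj d) x = inner ℝ x (eLast d) - Q M σ r k μ x₀ t x := by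
  unfold quadPoly Q paraQ polyP
  rw [tang_sub, inner_neg_left, inner_smul_left, add_apply, smul_apply, inner_add_right,
    inner_smul_right]
  simp only [conj_trivial]
  ring

omit h in
theorem quadNormal_eq (x : Eu d) :
    quadNormal (-((2 * (σ * μ / r)) • tproj d x₀)) (M + (2 * (σ * μ / r)) • tproj d) x
      = ‖gradQ M x₀ (σ * μ / r) x‖⁻¹ • gradQ M x₀ (σ * μ / r) x := by
  have : eLast d - -((2 * (σ * μ / r)) • tproj d x₀) - (M + (2 * (σ * μ / r)) • tproj d) x
      = gradQ M x₀ (σ * μ / r) x := by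
    rw [gradQ, add_apply, smul_apply, map_sub]; module
  rw [quadNormal, this]

/-- At such a contact `Q` vanishes and its zero set touches `F(v)` globally in `B_{2/3}`, so the
viscosity condition applies. The ordering along the normal compares the one-sided slopes of `v` with
those of the barrier, and these are incompatible with the condition. -/
theorem no_contact_freeBdry {t : ℝ} (ht : -1 ≤ t) (ht' : t ≤ bT d)
    (hgap : ∀ y ∈ dom M K₁ r k x₀, 0 ≤ gap v α β K₁ M a b σ r k μ x₀ t y) {x : Eu d}
    (hx : x ∈ dom M K₁ r k x₀) (hxn : dom M K₁ r k x₀ ∈ 𝓝 x)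
    (h0 : gap v α β K₁ M a b σ r k μ x₀ t x = 0) (hfb : x ∈ freeBdry v)
    (hN : 0 < β ∨ 0 ≤ Q M σ r k μ x₀ t x) : False := by
  have hσne : σ ≠ 0 := by rcases h.sign with rfl | rfl <;> norm_num
  have hv : v x = Psi α β a b x (barF (bA K₁) (bB d) r (σ * μ) (Q M σ r k μ x₀ t x)) := by
    rw [gap] at h0
    have := (mul_eq_zero.1 h0).resolve_left hσne
    linarith
  have hv0 := eq_zero_of_mem_freeBdry h.core.cont hfb
  have ⟨hwa, hwb⟩ := h.weights_pos hx
  have hα := h.core.alpha_pos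
  have hβ := h.core.beta_nonneg
  have hxb := (h.ball_of_dom hx).2
  have hQle : Q M σ r k μ x₀ t x ≤ 0 := not_lt.1 fun hq => by
    have := (h.Psi_Q_pos_iff hx ht ht').2 hq
    linarith
  have hQ0 : Q M σ r k μ x₀ t x = 0 := by
    refine le_antisymm hQle ?_
    rcases hN with hN | hN
    · refine not_lt.1 fun hq => ?_
      have hF := (h.barF_Q_neg_iff hx ht ht').2 hq
      have := Psi_lt (α := α) (β := β) (a := a) (b := b) hα hwa hwb hF (Or.inl hN)
      rw [← hv, hv0, Psi_of_nonneg le_rfl, mul_zero] at this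
      exact lt_irrefl _ this
    · exact hN
  have hgt := h.global_touch ht ht' hgap
  have hqp := quadPoly_eq (M := M) (σ := σ) (r := r) (k := k) (μ := μ) (x₀ := x₀) t
  -- From `Q = 0`, `|Q - (P + k)| ≤ 2μr` and `level_eps`. Only at heights of order `ε` is the free
  -- boundary condition linearized in `Core`.
  have hP : |polyP M (eLast d) x| ≤ 5 * ε := by
    have h1 := Q_eq (M := M) (σ := σ) (r := r) (k := k) (μ := μ) (x₀ := x₀) t x
    have h2 := abs_sub_le_of_eq h.sign h.r_pos h.mu_pos (tang_nonneg (x - x₀)) hx.1 ht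
      (by linarith [bT_le (d := d)]) h1
    rw [hQ0] at h2
    have h3 := h.level_eps
    have h4 : |polyP M (eLast d) x| ≤ |0 - (polyP M (eLast d) x + k)| + |k| := by
      have := abs_add_le (polyP M (eLast d) x + k) (-k)
      rw [add_neg_cancel_right, abs_neg] at this
      rwa [zero_sub, abs_neg]
    linarith
  obtain ⟨p, q, hp, hq, hcond⟩ := h.core.fb σ h.sign _ _ _ x (h.testQuad ht ht')
    (fun hs => ⟨⟨hfb, hxb⟩, by rw [hqp, hQ0, sub_zero], fun y hy hlt => (hgt y hy).1 hs (by
      rw [hqp] at hlt; linarith)⟩)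
    (fun hs => ⟨⟨hfb, hxb⟩, by rw [hqp, hQ0, sub_zero], fun y hy hlt => by
      have := (hgt y hy).2 hs hlt
      rw [hqp]; linarith⟩) hP
  rw [quadNormal_eq] at hp hq
  set g := gradQ M x₀ (σ * μ / r) x with hg
  have hg1 : 1 ≤ ‖g‖ := one_le_norm_gradQ h.core.symm h.core.map_dir x₀ _ x
  set n := ‖g‖⁻¹ • g with hn
  have hgn : inner ℝ g n = ‖g‖ := by
    rw [hn, inner_smul_right, real_inner_self_eq_norm_sq]; field_simp
  have hline : ∀ w : Eu d, Tendsto (fun s : ℝ => x + s • w) (𝓝[>] 0) (𝓝 x) := by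
    intro w
    have : Continuous fun s : ℝ => x + s • w := by fun_prop
    have := this.tendsto 0
    simp only [zero_smul, add_zero] at this
    exact this.mono_left nhdsWithin_le_nhds
  have hQp : ∀ᶠ s in 𝓝[>] (0 : ℝ), 0 < Q M σ r k μ x₀ t (x + s • n) := by
    refine eventually_pos_of_hasDerivAt ((h.hasJet_Q t x).hasDerivAt_line n)
      (by simpa using hQ0) ?_
    rw [← hg, hgn]; linarith
  have hQm : ∀ᶠ s in 𝓝[>] (0 : ℝ), 0 < -Q M σ r k μ x₀ t (x + s • (-n)) := by
    refine eventually_pos_of_hasDerivAt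
      (f := fun s => -Q M σ r k μ x₀ t (x + s • (-n)))
      ((h.hasJet_Q t x).hasDerivAt_line (-n)).neg (by simpa using hQ0) ?_
    rw [← hg, inner_neg_right, hgn]; linarith
  have hJa := (hasJet_barW h.core.symm x₀ (k + σ * μ * r * t) (σ * μ / r) a (1 + σ * μ * bA K₁)
      (σ * μ * bB d / r) x).hasDerivAt_line n
  have hJb := (hasJet_barW h.core.symm x₀ (k + σ * μ * r * t) (σ * μ / r) b (1 + σ * μ * 1)
      (σ * μ * bB d / r) x).hasDerivAt_line (-n)
  have hQ00 : paraQ M x₀ (k + σ * μ * r * t) (σ * μ / r) x = 0 := hQ0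
  rw [hQ00] at hJa hJb
  simp only [mul_zero, add_zero, zero_smul, ← hg, inner_smul_left, inner_neg_right, hgn,
    conj_trivial] at hJa hJb
  have hWa := (hJa.const_mul α).hasDerivWithinAt (s := Set.Ici 0)
  have hWb := ((hJb.const_mul β).neg).hasDerivWithinAt (s := Set.Ici 0)
  have hW0 : ∀ (A : Eu d) (p₁ m₂ : ℝ),
      barW M x₀ (k + σ * μ * r * t) (σ * μ / r) A p₁ m₂ x = 0 := by
    intro A p₁ m₂; rw [barW_eq, hQ0]; ring
  have hq' : HasDerivWithinAt (fun s : ℝ => max (-v (x + s • (-n))) 0) q (Set.Ici 0) 0 := by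
    refine hq.congr_of_eventuallyEq (Eventually.of_forall fun s => ?_) ?_
    · simp [sub_eq_add_neg]
    · simp
  have hepos : ∀ᶠ s in 𝓝[>] (0 : ℝ), 0 ≤ σ * (max (v (x + s • n)) 0 -
      α * barW M x₀ (k + σ * μ * r * t) (σ * μ / r) a (1 + σ * μ * bA K₁)
        (σ * μ * bB d / r) (x + s • n)) := by
    filter_upwards [hQp, (hline n).eventually hxn] with s hs hD
    have h1 := hgap _ hD
    have h2 := (h.Psi_Q_pos_iff hD ht ht').2 hs
    rw [gap] at h1
    rw [h.Psi_of_Q_nonneg hD ht ht' hs.le] at h1 h2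
    have h3 := le_max_left (v (x + s • n)) 0
    rcases h.sign with hσ | hσ
    · rw [hσ] at h1 h2 ⊢; linarith
    · rw [hσ] at h1 h2 ⊢
      have : max (v (x + s • n)) 0 ≤ _ := max_le (by linarith) h2.le
      linarith
  have heneg : ∀ᶠ s in 𝓝[>] (0 : ℝ), σ * (max (-v (x + s • (-n))) 0 -
      -(β * barW M x₀ (k + σ * μ * r * t) (σ * μ / r) b (1 + σ * μ * 1)
        (σ * μ * bB d / r) (x + s • (-n)))) ≤ 0 := by
    filter_upwards [hQm, (hline (-n)).eventually hxn] with s hs hD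
    have h1 := hgap _ hD
    have h2 : ¬ 0 < Psi α β a b (x + s • (-n)) (barF (bA K₁) (bB d) r (σ * μ)
        (Q M σ r k μ x₀ t (x + s • (-n)))) := by
      rw [h.Psi_Q_pos_iff hD ht ht']; linarith
    rw [gap] at h1
    rw [h.Psi_of_Q_nonpos hD ht ht' (by linarith)] at h1 h2
    have h3 := le_max_left (-v (x + s • (-n))) 0
    rcases h.sign with hσ | hσ
    · rw [hσ] at h1 h2 ⊢
      have : max (-v (x + s • (-n))) 0 ≤ _ := max_le (by linarith) (by linarith [not_lt.1 h2] :
        0 ≤ -(β * barW M x₀ (k + 1 * μ * r * t) (1 * μ / r) b (1 + 1 * μ * 1)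
        (1 * μ * bB d / r) (x + s • (-n))))
      linarith
    · rw [hσ] at h1 ⊢; linarith
  have hz : x + (0 : ℝ) • n = x ∧ x + (0 : ℝ) • (-n) = x := by simp
  have hA : (bA K₁) = 4 * K₁ + 4 := rfl
  have hpb : 0 ≤ σ * (p - α * (1 + inner ℝ a x) * ((1 + σ * μ * (4 * K₁ + 4)) * ‖g‖)) := by
    have e : α * ((1 + inner ℝ a x) * ((1 + σ * μ * bA K₁) * ‖g‖))
      = α * (1 + inner ℝ a x) * ((1 + σ * μ * (4 * K₁ + 4)) * ‖g‖) := by rw [hA]; ring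
    rw [← e]
    rcases h.sign with hσ | hσ
    · rw [hσ] at hWa hepos hW0 ⊢
      have := hasDerivWithinAt_le_of_eventually_le hWa hp (by
        simp only [hz.1, hW0, hv0]; simp) (by
          filter_upwards [hepos] with s hs; linarith)
      linarith
    · rw [hσ] at hWa hepos hW0 ⊢
      have := hasDerivWithinAt_le_of_eventually_le hp hWa (by
        simp only [hz.1, hW0, hv0]; simp) (by
          filter_upwards [hepos] with s hs; linarith)
      linarith
  have hqb : σ * (q - β * (1 + inner ℝ b x) * ((1 + σ * μ) * ‖g‖)) ≤ 0 := by
    have e : -(β * ((1 + inner ℝ b x) * ((1 + σ * μ * 1) * -‖g‖)))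
      = β * (1 + inner ℝ b x) * ((1 + σ * μ) * ‖g‖) := by ring
    rw [← e]
    rcases h.sign with hσ | hσ
    · rw [hσ] at hWb heneg hW0 ⊢
      have := hasDerivWithinAt_le_of_eventually_le hq' hWb (by
        simp only [hz.2, hW0, hv0, Pi.neg_apply]; simp) (by
          filter_upwards [heneg] with s hs; simp only [Pi.neg_apply]; linarith)
      linarith
    · rw [hσ] at hWb heneg hW0 ⊢
      have := hasDerivWithinAt_le_of_eventually_le hWb hq' (by
        simp only [hz.2, hW0, hv0, Pi.neg_apply]; simp) (by
          filter_upwards [heneg] with s hs; simp only [Pi.neg_apply]; linarith)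
      linarith
  refine slope_contradiction h.sign hα hβ hwa hwb h.mu_pos ?_ h.one_le_K h.mu_le_s₀
    (mul_nonneg h.core.kappa_nonneg h.core.eps_pos.le) h.kap_eps ?_ hg1 (h.norm_gradQ_le hx)
    hpb hqb hcond
  · have := bν_le_bT (d := d) h.one_le_K; linarith [bT_le (d := d), h.mu_le]
  · have h1 := bν_mul_le (d := d) h.one_le_K
    have h2 : μ * (bA K₁) ≤ bν d K₁ * (bA K₁ + bB d) := by
      have := h.mu_le; have := eight_le_bA h.one_le_K; have := one_le_bB (d := d)
      have := h.mu_pos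
      exact mul_le_mul h.mu_le (by linarith) (by linarith) (bν_pos h.one_le_K).le
    rw [hA] at h2 h1; linarith

theorem isCompact_dom : IsCompact (dom M K₁ r k x₀) := by
  refine (isCompact_closedBall x₀ r).of_isClosed_subset ?_
    fun x hx => ball_subset_closedBall (h.ball_of_dom hx).1
  have h1 := continuous_polyP M (eLast d)
  have h2 : Continuous fun y : Eu d => tang (y - x₀) :=
    continuous_tang.comp (continuous_id.sub continuous_const)
  exact (isClosed_le h2 continuous_const).inter
    ((isClosed_le continuous_const (h1.add_const k)).inter
      (isClosed_le (h1.add_const k) continuous_const))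

omit h in
theorem continuous_Q_uncurry : Continuous fun p : ℝ × Eu d => Q M σ r k μ x₀ p.1 p.2 := by
  have h1 := continuous_polyP M (eLast d)
  have h2 := continuous_tang (d := d)
  simp only [Q_eq]
  fun_prop

theorem gap_nonneg : ∀ x ∈ dom M K₁ r k x₀, 0 ≤ gap v α β K₁ M a b σ r k μ x₀ (bT d) x := by
  have hT := bT_pos (d := d)
  have hα := h.core.alpha_pos
  have hβ := h.core.beta_nonneg
  refine sliding h.isCompact_dom (t₀ := -1) (by linarith) ?_ ?_ ?_
  · have h1 : ContinuousOn (fun p : ℝ × Eu d => v p.2) (Set.univ ×ˢ dom M K₁ r k x₀) :=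
      h.core.cont.comp continuousOn_snd fun p hp =>
        ball_subset_ball (by norm_num) (h.ball_of_dom hp.2).2
    have h2 : Continuous fun p : ℝ × Eu d => Psi α β a b p.2
        (barF (bA K₁) (bB d) r (σ * μ) (Q M σ r k μ x₀ p.1 p.2)) :=
      (continuous_Psi α β a b).comp (continuous_snd.prodMk
        ((continuous_barF _ _ _ _).comp continuous_Q_uncurry))
    exact continuousOn_const.mul (h1.sub h2.continuousOn)
  · intro x hx
    have h1 := (h.bracket hx le_rfl (by linarith)).2.2 (Or.inr (Or.inr rfl))
    have h2 := h.flat x (h.ball_of_dom hx).1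
    have ⟨hwa, hwb⟩ := h.weights_pos hx
    rw [gap]
    rcases h.sign with hs | hs
    · rw [hs] at h1 h2 ⊢
      have := Psi_mono (a := a) (b := b) (x := x) hα hβ hwa hwb (by linarith :
        barF (bA K₁) (bB d) r (1 * μ) (Q M 1 r k μ x₀ (-1) x) ≤ polyP M (eLast d) x + k)
      linarith
    · rw [hs] at h1 h2 ⊢
      have := Psi_mono (a := a) (b := b) (x := x) hα hβ hwa hwb (by linarith :
        polyP M (eLast d) x + k ≤ barF (bA K₁) (bB d) r (-1 * μ) (Q M (-1) r k μ x₀ (-1) x))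
      linarith
  · rintro t ⟨ht, htT⟩ x hx hgap h0 hcl
    have ht' := htT.le
    have hgt := h.global_touch ht ht' hgap
    -- If `β = 0`, both functions may vanish identically on open sets, where the gap is zero without
    -- any real contact. Since `(t, x)` is a limit of points with negative gap, such contacts are
    -- excluded.
    have hN : 0 < β ∨ (0 ≤ Q M σ r k μ x₀ t x ∧ (σ = -1 → 0 ≤ polyP M (eLast d) x + k ∧
        x ∈ closure {y | 0 < v y})) := by
      rcases hβ.eq_or_lt with hβ0 | hβ0
      swap; · exact Or.inl hβ0
      right
      have hv0 := h.core.nonneg hβ0.symm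
      rcases h.sign with hs | hs
      -- Negative gap with `v ≥ 0` means that the barrier is positive; in the limit `Q ≥ 0`.
      · refine ⟨?_, fun hs' => absurd (hs.symm.trans hs') (by norm_num)⟩
        have hcl' : IsClosed {p : ℝ × Eu d | 0 ≤ barF (bA K₁) (bB d) r (σ * μ)
            (Q M σ r k μ x₀ p.1 p.2)} :=
          isClosed_le continuous_const ((continuous_barF _ _ _ _).comp continuous_Q_uncurry)
        have := closure_minimal (s := {p : ℝ × Eu d | p.2 ∈ dom M K₁ r k x₀ ∧
          gap v α β K₁ M a b σ r k μ x₀ p.1 p.2 < 0}) ?_ hcl' hcl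
        · exact not_lt.1 fun hq => absurd ((h.barF_Q_neg_iff hx ht ht').2 hq) (not_lt.2 this)
        · rintro ⟨s, y⟩ ⟨hyD, hy⟩
          simp only [gap, hs, one_mul] at hy
          have hpos : 0 < Psi α β a b y (barF (bA K₁) (bB d) r (1 * μ) (Q M 1 r k μ x₀ s y)) := by
            rw [one_mul]; linarith [hv0 y]
          rw [Psi_pos_iff hα hβ (h.weights_pos hyD).1 (h.weights_pos hyD).2] at hpos
          simp only [Set.mem_ofPred_eq, hs]
          exact hpos.le
      -- Negative gap with a nonnegative barrier means `v > 0`, so `x` is a limit of positive points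
      -- of `v`; the ordering of the phases and the flatness pass to the limit.
      · have hkey : ∀ p ∈ {p : ℝ × Eu d | p.2 ∈ dom M K₁ r k x₀ ∧
            gap v α β K₁ M a b σ r k μ x₀ p.1 p.2 < 0}, p.2 ∈ dom M K₁ r k x₀ ∧ 0 < v p.2 := by
          rintro ⟨s, y⟩ ⟨hyD, hy⟩
          refine ⟨hyD, ?_⟩
          simp only [gap, hs] at hy
          have : 0 ≤ Psi α β a b y (barF (bA K₁) (bB d) r (-1 * μ) (Q M (-1) r k μ x₀ s y)) := by
            have := (h.weights_pos hyD).1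
            rw [Psi, ← hβ0]
            simp only [zero_mul, sub_zero]
            positivity
          linarith
        have hclx : x ∈ closure {y | y ∈ dom M K₁ r k x₀ ∧ 0 < v y} := by
          have hc2 : IsClosed {p : ℝ × Eu d | p.2 ∈ closure {y | y ∈ dom M K₁ r k x₀ ∧ 0 < v y}} :=
            isClosed_closure.preimage continuous_snd
          exact closure_minimal (s := {p : ℝ × Eu d | p.2 ∈ dom M K₁ r k x₀ ∧
              gap v α β K₁ M a b σ r k μ x₀ p.1 p.2 < 0})
            (t := {p : ℝ × Eu d | p.2 ∈ closure {y | y ∈ dom M K₁ r k x₀ ∧ 0 < v y}})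
            (fun p hp => subset_closure (hkey p hp)) hc2 hcl
        refine ⟨?_, fun _ => ⟨?_, closure_mono (fun y hy => hy.2) hclx⟩⟩
        · refine closure_minimal (s := {y | y ∈ dom M K₁ r k x₀ ∧ 0 < v y})
            (t := {y | 0 ≤ Q M σ r k μ x₀ t y}) (fun y hy => ?_)
            (isClosed_le continuous_const (continuous_Q t)) hclx
          exact ((hgt y (h.ball_of_dom hy.1).2).2 hs hy.2).le
        · refine closure_minimal (s := {y | y ∈ dom M K₁ r k x₀ ∧ 0 < v y})
            (t := {y | 0 ≤ polyP M (eLast d) y + k}) (fun y hy => ?_)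
            (isClosed_le continuous_const ((continuous_polyP M _).add_const k)) hclx
          have h2 := h.flat y (h.ball_of_dom hy.1).1
          rw [hs] at h2
          have h3 : 0 < Psi α β a b y (polyP M (eLast d) y + k) := by linarith [hy.2]
          rw [Psi_pos_iff hα hβ (h.weights_pos hy.1).1 (h.weights_pos hy.1).2] at h3
          exact h3.le
    have hint : dom M K₁ r k x₀ ∈ 𝓝 x := by
      refine h.interior_of_contact ht ht' hx h0 ?_
      rcases hN with hN | hN
      · exact Or.inl hN
      · rcases h.sign with hs | hs
        · exact Or.inr (Or.inl ⟨hs, hN.1⟩)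
        · exact Or.inr (Or.inr ⟨hs, (hN.2 hs).1⟩)
    rcases lt_or_ge 0 (v x) with hv | hv
    · exact h.no_contact_pos ht ht' hgap hx hint h0 hv
    · have hxb : x ∈ ball (0 : Eu d) 1 := ball_subset_ball (by norm_num) (h.ball_of_dom hx).2
      rcases mem_negPhase_or_mem_freeBdry hxb hv with hm | hm
      · exact h.no_contact_neg ht ht' hgap hx hint h0 hm
          (hN.imp_right fun hh => ⟨hh.1, fun hs => (hh.2 hs).2⟩)
      · exact h.no_contact_freeBdry ht ht' hgap hx hint h0 hm (hN.imp_right fun hh => hh.1)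

/-- Improvement of flatness from one side near the free boundary. -/
theorem improve :
    (∀ x ∈ ball x₀ (bν d K₁ * r), 0 ≤ σ * (v x -
      Psi α β a b x (polyP M (eLast d) x + k + σ * (μ * r * bT d / 4)))) ∧
    ∀ x ∈ ball (0 : Eu d) (2 / 3),
      (σ = 1 → 0 < polyP M (eLast d) x + k + μ * r * bT d - μ / r * tang (x - x₀) → 0 < v x) ∧
      (σ = -1 → 0 < v x → 0 < polyP M (eLast d) x + k - μ * r * bT d + μ / r * tang (x - x₀)) := by
  have hT := bT_pos (d := d)
  have hα := h.core.alpha_pos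
  have hβ := h.core.beta_nonneg
  have hr := h.r_pos
  have hν := bν_pos (d := d) h.one_le_K
  have hνT := bν_le_bT (d := d) h.one_le_K
  have hTl := bT_le (d := d)
  refine ⟨fun x hx => ?_, fun x hx => ?_⟩
  · rw [mem_ball, dist_eq_norm] at hx
    have hνr : bν d K₁ * r ≤ 1 / 1000 * r := by gcongr; linarith
    have hκ := h.kap_small
    have hPd := abs_polyP_sub_le_two_mul h.core.symm h.core.map_dir
      (by linarith [h.core.norm_M]) (by linarith [h.norm_x₀] : ‖x₀‖ ≤ 1)
      (by linarith [h.r_le] : ‖x - x₀‖ ≤ 1)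
    have hY : |polyP M (eLast d) x + k| ≤ 4 * bν d K₁ * r := by
      have h1 := abs_le.1 h.near
      have h2 := abs_le.1 h.level
      rw [abs_le] at hPd
      rw [abs_le]
      constructor <;> linarith
    have htg : tang (x - x₀) ≤ (bν d K₁ * r) ^ 2 :=
      (tang_le _).trans (by gcongr)
    have hD : x ∈ dom M K₁ r k x₀ := by
      have hB := one_le_bB (d := d)
      have hνB := bν_mul_bB_le (d := d) h.one_le_K
      have hνT' := bν_le_bTop (d := d) h.one_le_K
      have hTp := bTop_pos (d := d) h.one_le_K
      rw [abs_le] at hY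
      refine ⟨htg.trans ?_, ?_, ?_⟩
      · have : (bν d K₁ * r) ^ 2 ≤ (r / 2) ^ 2 := by gcongr; linarith
        linarith [div_pow r 2 2]
      · have : 4 * bν d K₁ * r ≤ r / (4 * bB d) := by
          rw [le_div_iff₀ (by positivity)]
          have := mul_le_mul_of_nonneg_right hνB hr.le
          linarith
        linarith
      · have : 4 * bν d K₁ * r ≤ bTop d K₁ * r := by gcongr; linarith
        linarith
    have hgain := barF_gain (Q := Q M σ r k μ x₀ (bT d) x) h.one_le_K h.sign hr h.mu_pos h.mu_le
      (tang_nonneg (x - x₀)) htg hY (Q_eq _ x)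
    have hg := h.gap_nonneg x hD
    have ⟨hwa, hwb⟩ := h.weights_pos hD
    rw [gap] at hg
    rcases h.sign with hs | hs
    · rw [hs] at hgain hg ⊢
      have := Psi_mono (a := a) (b := b) (x := x) hα hβ hwa hwb (by linarith :
        polyP M (eLast d) x + k + 1 * (μ * r * bT d / 4) ≤
          barF (bA K₁) (bB d) r (1 * μ) (Q M 1 r k μ x₀ (bT d) x))
      linarith
    · rw [hs] at hgain hg ⊢
      have := Psi_mono (a := a) (b := b) (x := x) hα hβ hwa hwb (by linarith :
          barF (bA K₁) (bB d) r (-1 * μ) (Q M (-1) r k μ x₀ (bT d) x) ≤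
          polyP M (eLast d) x + k + -1 * (μ * r * bT d / 4))
      linarith
  · have hgt := h.global_touch (by linarith) le_rfl h.gap_nonneg x hx
    have hQ := Q_eq (M := M) (σ := σ) (r := r) (k := k) (μ := μ) (x₀ := x₀) (bT d) x
    refine ⟨fun hs hpos => hgt.1 hs ?_, fun hs hpos => ?_⟩
    · rw [hQ, hs]
      have : 1 * μ / r = μ / r := by ring
      rw [this]; linarith
    · have := hgt.2 hs hpos
      rw [hQ, hs] at this
      have e : -1 * μ / r = -(μ / r) := by ring
      rw [e] at this; linarith

end Near


/-! ### Propagation of a gain inside one phase. -/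

section Gain

variable {d : ℕ} {v : Eu d → ℝ} {α β ε κ K₁ s₀ : ℝ} {M : Eu d →L[ℝ] Eu d} {a b : Eu d}

theorem abs_inner_le_of_mem_ball {A x : Eu d} (hA : ‖A‖ ≤ κ) (hx : x ∈ ball (0 : Eu d) 1) :
    |inner ℝ A x| ≤ κ := by
  rw [mem_ball_zero_iff] at hx
  calc _ ≤ ‖A‖ * ‖x‖ := abs_real_inner_le_norm _ _
    _ ≤ κ * 1 := mul_le_mul hA hx.le (norm_nonneg _) ((norm_nonneg _).trans hA)
    _ = κ := mul_one _

/-- A solution and the reference profile have almost the same Laplacian in either phase. -/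
theorem abs_laplacian_sub_le {γ σ : ℝ} (k : ℝ) {A x : Eu d} (hγ : 0 ≤ γ) (hσ : σ = 1 ∨ σ = -1)
    (hM : (M : Eu d →ₗ[ℝ] Eu d).IsSymmetric) (hAM : ‖A‖ * ‖M‖ ≤ κ * ε)
    (hx : x ∈ ball (0 : Eu d) 1) (hv : ContDiffAt ℝ 2 v x)
    (hΔ : |Δ v x - γ * (2 * inner ℝ A (eLast d) - opTrace M)| ≤ γ * (κ * ε)) :
    ContDiffAt ℝ 2 (fun z => σ * (v z - γ * ((1 + inner ℝ A z) * (polyP M (eLast d) z + k)))) x ∧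
    |Δ (fun z => σ * (v z - γ * ((1 + inner ℝ A z) * (polyP M (eLast d) z + k)))) x|
      ≤ γ * (κ * ε) * (d + 4) := by
  have hj : HasJet v x ((InnerProductSpace.toDual ℝ (Eu d)).symm (fderiv ℝ v x)) (Δ v x) :=
    ⟨hv, fun w => by rw [InnerProductSpace.toDual_symm_apply], rfl⟩
  have hw := ((hasJet_const 1 x).add (hasJet_inner A x)).mul
    ((hasJet_polyP hM x).add (hasJet_const k x))
  have hJ := (hj.sub (hw.const_mul γ)).const_mul σ
  refine ⟨hJ.contDiffAt, ?_⟩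
  rw [hJ.laplacian_eq, abs_mul, show |σ| = 1 by rcases hσ with rfl | rfl <;> simp, one_mul]
  rw [mem_ball_zero_iff] at hx
  have h1 : |inner ℝ A x * opTrace M| ≤ (d + 1) * (κ * ε) := by
    rw [abs_mul]
    calc |inner ℝ A x| * |opTrace M| ≤ (‖A‖ * ‖x‖) * ((d + 1) * ‖M‖) :=
          mul_le_mul (abs_real_inner_le_norm _ _) (abs_opTrace_le M) (abs_nonneg _) (by positivity)
      _ ≤ (‖A‖ * 1) * ((d + 1) * ‖M‖) := by gcongr
      _ = (d + 1) * (‖A‖ * ‖M‖) := by ring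
      _ ≤ _ := by gcongr
  have h2 : |inner ℝ A (M x)| ≤ κ * ε := by
    calc _ ≤ ‖A‖ * ‖M x‖ := abs_real_inner_le_norm _ _
      _ ≤ ‖A‖ * (‖M‖ * ‖x‖) := by gcongr; exact M.le_opNorm x
      _ ≤ ‖A‖ * (‖M‖ * 1) := by gcongr
      _ ≤ _ := by rw [mul_one]; exact hAM
  have e : Δ v x - γ * ((1 + inner ℝ A x) * (-opTrace M + 0) +
      (polyP M (eLast d) x + k) * (0 + 0) + 2 * inner ℝ (0 + A) (eLast d - M x + 0))
      = (Δ v x - γ * (2 * inner ℝ A (eLast d) - opTrace M))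
        + γ * (inner ℝ A x * opTrace M + 2 * inner ℝ A (M x)) := by
    simp only [zero_add, add_zero, inner_sub_right]; ring
  rw [e]
  calc _ ≤ |Δ v x - γ * (2 * inner ℝ A (eLast d) - opTrace M)|
        + |γ * (inner ℝ A x * opTrace M + 2 * inner ℝ A (M x))| := abs_add_le _ _
    _ ≤ γ * (κ * ε) + γ * ((d + 1) * (κ * ε) + 2 * (κ * ε)) := by
        rw [abs_mul, abs_of_nonneg hγ]
        gcongr
        calc _ ≤ |inner ℝ A x * opTrace M| + |2 * inner ℝ A (M x)| := abs_add_le _ _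
          _ ≤ _ := by rw [abs_mul 2, abs_two]; gcongr
    _ = _ := by ring

/-- The fraction of a gain at one point that survives along a chain of `N` balls. -/
def gainC (d N : ℕ) : ℝ := harnackConst (Eu d) ^ N / 16

theorem gainC_pos {N : ℕ} : 0 < gainC d N := by
  have := harnackConst_pos (E := Eu d); unfold gainC; positivity

theorem gainC_le {N : ℕ} : gainC d N ≤ 1 / 16 := by
  have h1 := harnackConst_pos (E := Eu d)
  have h2 := harnackConst_le (E := Eu d)
  have : harnackConst (Eu d) ^ N ≤ 1 := pow_le_one₀ h1.le (by linarith)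
  unfold gainC; linarith

/-- A gain at `x` over the profile at level `k` propagates inside one phase. -/
theorem gain {γ σ k ω r : ℝ} {A x y : Eu d} {N : ℕ} (hγ : 0 < γ) (hσ : σ = 1 ∨ σ = -1)
    (hM : (M : Eu d →ₗ[ℝ] Eu d).IsSymmetric) (hA : ‖A‖ ≤ κ) (hAM : ‖A‖ * ‖M‖ ≤ κ * ε)
    (hε : 0 < ε) (hκ : 0 ≤ κ) (hκ2 : κ ≤ 1 / 2) (hκN : κ * (15 * (d + 4)) ≤ gainC d N)
    (hr : 0 < r) (hrω : r ^ 2 ≤ ω) (hxy : dist y x < N * r)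
    (hseg : ∀ p ∈ segment ℝ x y, ∀ z ∈ ball p (5 * r), z ∈ ball (0 : Eu d) 1 ∧
      ContDiffAt ℝ 2 v z ∧ |Δ v z - γ * (2 * inner ℝ A (eLast d) - opTrace M)| ≤ γ * (κ * ε) ∧
      0 ≤ σ * (v z - γ * (1 + inner ℝ A z) * (polyP M (eLast d) z + k)))
    (hx : γ * (1 + inner ℝ A x) * (ε * ω / 2)
      ≤ σ * (v x - γ * (1 + inner ℝ A x) * (polyP M (eLast d) x + k))) :
    0 ≤ σ * (v y - γ * (1 + inner ℝ A y) * (polyP M (eLast d) y + k + σ * (ε * ω * gainC d N))) := by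
  have hω : 0 < ω := lt_of_lt_of_le (by positivity) hrω
  have hxb : x ∈ ball (0 : Eu d) 1 :=
    (hseg x (left_mem_segment ℝ x y) x (mem_ball_self (by positivity))).1
  have hyb : y ∈ ball (0 : Eu d) 1 :=
    (hseg y (right_mem_segment ℝ x y) y (mem_ball_self (by positivity))).1
  have hAx := (abs_le.1 (abs_inner_le_of_mem_ball hA hxb)).1
  have hAy := (abs_le.1 (abs_inner_le_of_mem_ball hA hyb)).2
  have hσσ : σ * σ = 1 := by rcases hσ with rfl | rfl <;> norm_num
  have H := harnack_segment MeasureTheory.volume hr hxy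
    (h := fun z => σ * (v z - γ * ((1 + inner ℝ A z) * (polyP M (eLast d) z + k))))
    (κ := γ * (κ * ε) * (d + 4)) (fun p hp z hz => by
      obtain ⟨h1, h2, h3, h4⟩ := hseg p hp z hz
      have h5 := abs_laplacian_sub_le k hγ.le hσ hM hAM h1 h2 h3
      exact ⟨h5.1, by rw [← mul_assoc γ]; exact h4, h5.2⟩)
  simp only [← mul_assoc γ] at H
  set c := harnackConst (Eu d) ^ N with hc
  have hc0 : 0 < c := by have := harnackConst_pos (E := Eu d); positivity
  have hg : gainC d N = c / 16 := rfl
  have h1 : γ * (ε * ω / 4) ≤ γ * (1 + inner ℝ A x) * (ε * ω / 2) := by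
    have : γ * (1 / 2) * (ε * ω / 2) ≤ γ * (1 + inner ℝ A x) * (ε * ω / 2) := by
      gcongr; linarith
    linarith
  have h2 : c * (γ * (ε * ω / 4)) ≤
      c * (σ * (v x - γ * (1 + inner ℝ A x) * (polyP M (eLast d) x + k))) :=
    mul_le_mul_of_nonneg_left (h1.trans hx) hc0.le
  -- Since `r² ≤ ω`, the error from the Laplacian is of order `κεω`, at most half of what Harnack
  -- transports, `c εω / 4`. The remaining `c εω / 8` equals `2 gainC εω`, and the factor `2` covers
  -- the weight at `y`.
  have h3 : 30 * r ^ 2 * (γ * (κ * ε) * (d + 4)) ≤ γ * (ε * ω) * (c / 8) := by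
    calc _ = γ * ε * r ^ 2 * (2 * (κ * (15 * (d + 4)))) := by ring
      _ ≤ γ * ε * ω * (2 * gainC d N) := by gcongr
      _ = _ := by rw [hg]; ring
  have h4 : γ * (1 + inner ℝ A y) * (ε * ω * gainC d N) ≤ γ * 2 * (ε * ω * gainC d N) := by
    have := gainC_pos (d := d) (N := N)
    gcongr; linarith
  have e : σ * (v y - γ * (1 + inner ℝ A y) * (polyP M (eLast d) y + k + σ * (ε * ω * gainC d N)))
      = σ * (v y - γ * (1 + inner ℝ A y) * (polyP M (eLast d) y + k))
        - γ * (1 + inner ℝ A y) * (ε * ω * gainC d N) := by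
    linear_combination (-γ * (1 + inner ℝ A y) * (ε * ω * gainC d N)) * hσσ
  rw [e]
  rw [hg] at h4 ⊢
  linarith

end Gain

/-- `v` lies between two translates of the profile near `x₀` at scale `r`; if `x₀` is close to the
free boundary, the free boundary is moreover trapped globally between two paraboloids. -/
structure Trap {d : ℕ} (v : Eu d → ℝ) (α β ε c ν : ℝ) (M : Eu d →L[ℝ] Eu d) (a b : Eu d)
    (x₀ : Eu d) (r l m : ℝ) : Prop where
  lower : ∀ x ∈ ball x₀ r, Psi α β a b x (polyP M (eLast d) x + ε * l) ≤ v x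
  upper : ∀ x ∈ ball x₀ r, v x ≤ Psi α β a b x (polyP M (eLast d) x + ε * m)
  glob_lower : |polyP M (eLast d) x₀| ≤ ν * r → ∀ x ∈ ball (0 : Eu d) (2 / 3),
    0 < polyP M (eLast d) x + ε * l - ε * (m - l) * c / (2 * r ^ 2) * tang (x - x₀) → 0 < v x
  glob_upper : |polyP M (eLast d) x₀| ≤ ν * r → ∀ x ∈ ball (0 : Eu d) (2 / 3), 0 < v x →
    0 < polyP M (eLast d) x + ε * m + ε * (m - l) * c / (2 * r ^ 2) * tang (x - x₀)

/-- Smallness of the structural parameters. -/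
structure Small (d : ℕ) (κ K₁ s₀ τ : ℝ) (N : ℕ) : Prop where
  one_le_K : 1 ≤ K₁
  kap_le : κ ≤ bν d K₁
  kap_const : κ * ((d + 1 + 2) * (bA K₁ + 2 * bB d) + 8) ≤ 1 / 4
  kap_gain : κ * (15 * (d + 4)) ≤ gainC d N
  tau_pos : 0 < τ
  tau_le : τ ≤ bν d K₁
  tau_le_s₀ : τ ≤ s₀
  le_N : 32 ≤ bTop d K₁ * N

/-- Ratio of consecutive scales. -/
def scaleC (d : ℕ) (K₁ : ℝ) : ℝ := bν d K₁ / 16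
/-- Relative improvement of flatness from one scale to the next. -/
def decayC (d N : ℕ) : ℝ := gainC d N * bT d / 4

/-! ### Size of the decay constants, and `P` under vertical shifts and along segments. -/

section Decay

variable {d : ℕ} {v : Eu d → ℝ} {α β ε κ K₁ s₀ τ : ℝ} {M : Eu d →L[ℝ] Eu d} {a b : Eu d} {N : ℕ}
  {x₀ : Eu d} {r l m : ℝ}

theorem decayC_pos : 0 < decayC d N := by
  have := gainC_pos (d := d) (N := N); have := bT_pos (d := d); unfold decayC; positivity

theorem decayC_le : decayC d N ≤ gainC d N / 128 := by
  have := gainC_pos (d := d) (N := N); have := bT_le (d := d); unfold decayC; nlinarith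

theorem scaleC_pos (hK : 1 ≤ K₁) : 0 < scaleC d K₁ := by
  have := bν_pos (d := d) hK; unfold scaleC; positivity

theorem scaleC_le (hK : 1 ≤ K₁) : scaleC d K₁ ≤ 1 / 1000 := by
  have := bν_le_bT (d := d) hK; have := bT_le (d := d); unfold scaleC; linarith

theorem polyP_add_smul (hM : (M : Eu d →ₗ[ℝ] Eu d).IsSymmetric) (h0 : M (eLast d) = 0) (x : Eu d)
    (t : ℝ) : polyP M (eLast d) (x + t • eLast d) = polyP M (eLast d) x + t := by
  have h1 := inner_map_eLast hM h0 x
  rw [real_inner_comm] at h1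
  unfold polyP
  rw [map_add, map_smul, h0, smul_zero, add_zero, inner_add_left, inner_smul_left,
    inner_eLast_self, inner_add_left, inner_smul_left]
  rw [h1]; simp; ring

/-- Along a segment, `polyP M e` is almost linear. -/
theorem polyP_segment_ge {x y p : Eu d} {q : ℝ} (hx : q ≤ polyP M (eLast d) x)
    (hM : (M : Eu d →ₗ[ℝ] Eu d).IsSymmetric)
    (hy : q ≤ polyP M (eLast d) y) (hp : p ∈ segment ℝ x y) :
    q - ‖M‖ * ‖x - y‖ ^ 2 ≤ polyP M (eLast d) p := by
  obtain ⟨s, t, hs, ht, hst, rfl⟩ := hp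
  have hsym : inner ℝ y (M x) = inner ℝ x (M y) := by
    have := hM y x
    simp only [ContinuousLinearMap.coe_coe] at this
    rw [← this, real_inner_comm]
  have e : polyP M (eLast d) (s • x + t • y) = s * polyP M (eLast d) x + t * polyP M (eLast d) y
      + 1 / 2 * (s * t) * inner ℝ (x - y) (M (x - y)) := by
    unfold polyP
    simp only [map_add, map_smul, map_sub, inner_add_left, inner_add_right, inner_smul_left,
      inner_smul_right, inner_sub_left, inner_sub_right, hsym]
    obtain rfl : s = 1 - t := by linarith
    simp
    ring
  have h1 : |inner ℝ (x - y) (M (x - y))| ≤ ‖M‖ * ‖x - y‖ ^ 2 := by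
    calc _ ≤ ‖x - y‖ * ‖M (x - y)‖ := abs_real_inner_le_norm _ _
      _ ≤ ‖x - y‖ * (‖M‖ * ‖x - y‖) := by gcongr; exact M.le_opNorm _
      _ = _ := by ring
  have h2 : s * t ≤ 1 := by nlinarith
  have h3 : |1 / 2 * (s * t) * inner ℝ (x - y) (M (x - y))| ≤ ‖M‖ * ‖x - y‖ ^ 2 := by
    rw [abs_mul, abs_of_nonneg (by positivity)]
    calc _ ≤ 1 * |inner ℝ (x - y) (M (x - y))| := by gcongr; linarith
      _ ≤ _ := by rw [one_mul]; exact h1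
  rw [e]
  have h4 := (abs_le.1 h3).1
  have h5 : s * q ≤ s * polyP M (eLast d) x := by gcongr
  have h6 : t * q ≤ t * polyP M (eLast d) y := by gcongr
  have h7 : s * q + t * q = q := by rw [← add_mul, hst, one_mul]
  linarith

end Decay


/-- The lower level `l` for `σ = 1` and the upper level `m` for `σ = -1`. -/
def lev (l m σ : ℝ) : ℝ := (l + m) / 2 - σ * ((m - l) / 2)

/-- The hypotheses of one step of the decay of flatness. -/
structure Step {d : ℕ} (v : Eu d → ℝ) (α β ε κ K₁ s₀ τ : ℝ) (N : ℕ) (M : Eu d →L[ℝ] Eu d)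
    (a b x₀ : Eu d) (r l m : ℝ) : Prop where
  core : Core v α β ε κ K₁ s₀ M a b
  small : Small d κ K₁ s₀ τ N
  trap : Trap v α β ε (gainC d N) (bν d K₁) M a b x₀ r l m
  norm_x₀ : ‖x₀‖ ≤ 1 / 2
  r_pos : 0 < r
  r_le : r ≤ 1 / 8
  r_le_width : r ≤ m - l
  abs_l : |l| ≤ 2
  abs_m : |m| ≤ 2
  eps_le : ε ≤ τ * r ^ 2

/-- One-sided improvement of the level on the side `σ`. -/
def Improved {d : ℕ} (v : Eu d → ℝ) (α β ε K₁ : ℝ) (N : ℕ) (M : Eu d →L[ℝ] Eu d)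
    (a b x₀ : Eu d) (r l m σ : ℝ) : Prop :=
  (∀ x ∈ ball x₀ (scaleC d K₁ * r), 0 ≤ σ * (v x - Psi α β a b x
    (polyP M (eLast d) x + ε * lev l m σ + σ * (ε * (m - l) * decayC d N)))) ∧
  (|polyP M (eLast d) x₀| ≤ bν d K₁ * r → ∀ x ∈ ball (0 : Eu d) (2 / 3),
    (σ = 1 → 0 < polyP M (eLast d) x + ε * lev l m σ + ε * (m - l) * decayC d N
      - ε * (m - l) * gainC d N / r ^ 2 * tang (x - x₀) → 0 < v x) ∧
    (σ = -1 → 0 < v x → 0 < polyP M (eLast d) x + ε * lev l m σ - ε * (m - l) * decayC d N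
      + ε * (m - l) * gainC d N / r ^ 2 * tang (x - x₀)))

/-! ### One step of the decay of flatness. -/

namespace Step

variable {d : ℕ} {v : Eu d → ℝ} {α β ε κ K₁ s₀ τ : ℝ} {M : Eu d →L[ℝ] Eu d} {a b : Eu d} {N : ℕ}
  {x₀ : Eu d} {r l m σ : ℝ} (h : Step v α β ε κ K₁ s₀ τ N M a b x₀ r l m)
include h

theorem width_pos : 0 < m - l := lt_of_lt_of_le h.r_pos h.r_le_width

theorem width_le : m - l ≤ 4 := by
  have h1 := abs_le.1 h.abs_l; have h2 := abs_le.1 h.abs_m; linarith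

theorem eps_le_mul : ε ≤ bν d K₁ * r / 8 := by
  have h1 := h.eps_le
  have h2 := h.r_pos
  have h3 : τ * r ^ 2 ≤ bν d K₁ * (r * (1 / 8)) := by
    have := bν_pos (d := d) h.small.one_le_K
    have := h.small.tau_le; have := h.r_le
    rw [pow_two]
    gcongr
  linarith

theorem abs_lev_le (hσ : σ = 1 ∨ σ = -1) : |lev l m σ| ≤ 2 := by
  rcases hσ with rfl | rfl
  · have e : lev l m 1 = l := by unfold lev; ring
    rw [e]; exact h.abs_l
  · have e : lev l m (-1) = m := by unfold lev; ring
    rw [e]; exact h.abs_m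

theorem abs_eps_lev_le (hσ : σ = 1 ∨ σ = -1) : |ε * lev l m σ| ≤ bν d K₁ * r / 4 := by
  have h1 := h.abs_lev_le hσ
  have h2 := h.core.eps_pos
  have h3 := h.eps_le_mul
  rw [abs_mul, abs_of_pos h2]
  calc ε * |lev l m σ| ≤ ε * 2 := by gcongr
    _ ≤ _ := by linarith

theorem kap_le : κ ≤ 1 / 1000 := by
  have h1 := h.small.kap_le
  have h2 := bν_le_bT (d := d) h.small.one_le_K
  have h3 := bT_le (d := d)
  linarith

theorem ball_subset : ball x₀ r ⊆ ball (0 : Eu d) 1 := fun x hx => by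
  rw [mem_ball, dist_eq_norm] at hx
  rw [mem_ball_zero_iff]
  have h1 := h.norm_x₀
  have h2 := h.r_le
  have h3 : ‖x‖ ≤ ‖x - x₀‖ + ‖x₀‖ := by simpa using norm_add_le (x - x₀) x₀
  linarith

theorem weights {x : Eu d} (hx : x ∈ ball (0 : Eu d) 1) :
    0 < 1 + inner ℝ a x ∧ 0 < 1 + inner ℝ b x := by
  have hk := h.kap_le
  have h1 := (abs_le.1 (abs_inner_le_of_mem_ball h.core.norm_a hx)).1
  have h2 := (abs_le.1 (abs_inner_le_of_mem_ball h.core.norm_b hx)).1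
  constructor <;> linarith

theorem abs_polyP_sub {x y : Eu d} (hx : x ∈ ball x₀ r) (hy : dist y x ≤ 1) :
    |polyP M (eLast d) y - polyP M (eLast d) x| ≤ 2 * dist y x := by
  have h1 := h.ball_subset hx
  rw [mem_ball_zero_iff] at h1
  rw [dist_eq_norm] at *
  exact abs_polyP_sub_le_two_mul h.core.symm h.core.map_dir
    (by linarith [h.core.norm_M, h.kap_le]) h1.le hy

theorem flat (hσ : σ = 1 ∨ σ = -1) {x : Eu d} (hx : x ∈ ball x₀ r) :
    0 ≤ σ * (v x - Psi α β a b x (polyP M (eLast d) x + ε * lev l m σ)) := by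
  rcases hσ with rfl | rfl
  · have e : lev l m 1 = l := by unfold lev; ring
    rw [e]; linarith [h.trap.lower x hx]
  · have e : lev l m (-1) = m := by unfold lev; ring
    rw [e]; linarith [h.trap.upper x hx]

omit h in
/-- At any point, `v` is at least half a width away from one of the two levels. -/
theorem exists_sign (w p : ℝ) (y : ℝ) : ∃ σ : ℝ, (σ = 1 ∨ σ = -1) ∧
    w * (ε * (m - l) / 2) ≤ σ * (y - w * (p + ε * lev l m σ)) := by
  rcases le_total (w * (p + ε * ((l + m) / 2))) y with hy | hy
  · exact ⟨1, Or.inl rfl, by unfold lev; linarith⟩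
  · exact ⟨-1, Or.inr rfl, by unfold lev; linarith⟩

theorem pos_phase {x : Eu d} (hx : x ∈ ball x₀ r) (hp : bν d K₁ * r / 4 < polyP M (eLast d) x) :
    x ∈ posPhase v := by
  have hb := h.ball_subset hx
  have ⟨h1, h2⟩ := h.weights hb
  refine ⟨hb, lt_of_lt_of_le ?_ (h.trap.lower x hx)⟩
  rw [Psi_pos_iff h.core.alpha_pos h.core.beta_nonneg h1 h2]
  have h3 := h.abs_eps_lev_le (σ := 1) (Or.inl rfl)
  have e : lev l m 1 = l := by unfold lev; ring
  rw [e, abs_le] at h3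
  linarith

theorem neg_phase {x : Eu d} (hx : x ∈ ball x₀ r) (hp : polyP M (eLast d) x < -(bν d K₁ * r / 4)) :
    x ∈ negPhase v := by
  rw [negPhase, mem_interior_iff_mem_nhds]
  filter_upwards [isOpen_ball.mem_nhds hx,
    (continuous_polyP M (eLast d)).continuousAt.eventually (gt_mem_nhds hp)] with y hy hyp
  have hb := h.ball_subset hy
  have ⟨h1, h2⟩ := h.weights hb
  refine ⟨hb, (h.trap.upper y hy).trans (not_lt.1 ?_)⟩
  rw [Psi_pos_iff h.core.alpha_pos h.core.beta_nonneg h1 h2]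
  have h3 := h.abs_eps_lev_le (σ := -1) (Or.inr rfl)
  have e : lev l m (-1) = m := by unfold lev; ring
  rw [e, abs_le] at h3
  linarith

/-- The total gain is small compared with the distance to the free boundary in the far case. -/
theorem decay_small : ε * (m - l) * decayC d N ≤ bν d K₁ * r / 8 ∧
    0 ≤ ε * (m - l) * decayC d N := by
  have h1 := h.eps_le_mul
  have h2 := h.core.eps_pos
  have h3 := h.width_pos
  have h4 := h.width_le
  have h5 := decayC_le (d := d) (N := N)
  have h6 := decayC_pos (d := d) (N := N)
  have h7 := gainC_le (d := d) (N := N)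
  refine ⟨?_, by positivity⟩
  calc ε * (m - l) * decayC d N ≤ ε * 4 * (1 / 4) := by gcongr; linarith
    _ ≤ _ := by linarith

theorem width_sq {s : ℝ} (hs : 0 ≤ s) (hsr : s ≤ r) : s ^ 2 ≤ m - l := by
  have h1 := h.r_le_width
  have h2 := h.r_le
  nlinarith [h.r_pos]

theorem mul_decay_le {w V k x : ℝ} (hσ : σ = 1 ∨ σ = -1) (hw : 0 ≤ w)
    (hg : 0 ≤ σ * (V - w * (x + k + σ * (ε * (m - l) * gainC d N)))) :
    0 ≤ σ * (V - w * (x + k + σ * (ε * (m - l) * decayC d N))) := by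
  have hσσ : σ * σ = 1 := by rcases hσ with rfl | rfl <;> norm_num
  have h5 := decayC_le (d := d) (N := N)
  have h6 := gainC_pos (d := d) (N := N)
  have h7 : w * (ε * (m - l) * decayC d N) ≤ w * (ε * (m - l) * gainC d N) := by
    have := h.width_pos; have := h.core.eps_pos
    gcongr; linarith
  linear_combination hg + h7 - (w * (ε * (m - l) * gainC d N) - w * (ε * (m - l) * decayC d N)) * hσσ

/-- With `scaleC = ν/16`, the balls of the Harnack chain stay within distance `6 scaleC r` of `x₀`,
where `P` is still above `νr - 12 scaleC r = νr/4`, beyond the reach of the levels `εl` and `εm`.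
The chain thus stays in the positive phase and starts at `x₀` itself. The global part is vacuous. -/
theorem improved_of_far_pos (hP : bν d K₁ * r < polyP M (eLast d) x₀) :
    ∃ σ : ℝ, (σ = 1 ∨ σ = -1) ∧ Improved v α β ε K₁ N M a b x₀ r l m σ := by
  have hr := h.r_pos
  have hK := h.small.one_le_K
  have hν := bν_pos (d := d) hK
  have hρ := scaleC_pos (d := d) hK
  have hρ1 := scaleC_le (d := d) hK
  have hρν : bν d K₁ * r = 16 * (scaleC d K₁ * r) := by unfold scaleC; ring
  have hρr : 0 < scaleC d K₁ * r := by positivity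
  have hρr' : scaleC d K₁ * r ≤ 1 / 1000 * r := by gcongr
  have hκ := h.kap_le
  obtain ⟨σ, hσ, hpiv⟩ := exists_sign (ε := ε) (l := l) (m := m) (α * (1 + inner ℝ a x₀)) (polyP M (eLast d) x₀) (v x₀)
  have hx₀r : x₀ ∈ ball x₀ r := mem_ball_self hr
  refine ⟨σ, hσ, fun y hy => ?_, fun hn => absurd hP (not_lt.2 ((le_abs_self _).trans hn))⟩
  have hyr : y ∈ ball x₀ r := ball_subset_ball (by linarith) hy
  have hN : (1 : ℝ) ≤ N := by
    have h1 := h.small.le_N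
    have h2 := bTop_le (d := d) hK
    have h3 : bTop d K₁ * N ≤ 1 / 72 * N := by gcongr
    linarith
  have H := gain (v := v) (k := ε * lev l m σ) (N := N) h.core.alpha_pos hσ h.core.symm h.core.norm_a h.core.norm_aM
    h.core.eps_pos h.core.kappa_nonneg (by linarith) h.small.kap_gain hρr
    (h.width_sq hρr.le (by linarith)) (x := x₀) (y := y) (by
      rw [mem_ball] at hy
      have : 1 * (scaleC d K₁ * r) ≤ N * (scaleC d K₁ * r) := by gcongr
      linarith) (fun p hp z hz => by
      have hp' : p ∈ ball x₀ (scaleC d K₁ * r) :=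
        (convex_ball x₀ _).segment_subset (mem_ball_self hρr) hy hp
      have hzd : dist z x₀ < 6 * (scaleC d K₁ * r) := by
        rw [mem_ball] at hz hp'
        linarith [dist_triangle z p x₀]
      have hzr : z ∈ ball x₀ r := by rw [mem_ball]; linarith
      have h1 := (abs_le.1 (h.abs_polyP_sub hx₀r (y := z) (by linarith [h.r_le]))).1
      have h2 : bν d K₁ * r / 4 < polyP M (eLast d) z := by linarith
      have h3 := h.core.pos z (h.pos_phase hzr h2)
      refine ⟨h.ball_subset hzr, h3.1, h3.2, ?_⟩
      have h4 := h.flat hσ hzr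
      have h5 := abs_le.1 (h.abs_eps_lev_le hσ)
      rwa [Psi_of_nonneg (by linarith)] at h4) hpiv
  have H' := h.mul_decay_le hσ (mul_nonneg h.core.alpha_pos.le (h.weights (h.ball_subset hyr)).1.le) H
  have h5 := abs_le.1 (h.abs_eps_lev_le hσ)
  have h6 := h.decay_small
  rw [mem_ball] at hy
  have h1 := (abs_le.1 (h.abs_polyP_sub hx₀r (y := y) (by linarith [h.r_le]))).1
  rwa [Psi_of_nonneg]
  rcases hσ with rfl | rfl <;> linarith

/-- Mirror image of the positive case for `β > 0`. For `β = 0` the profile vanishes here and the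
lower level improves trivially because `v ≥ 0`. -/
theorem improved_of_far_neg (hP : polyP M (eLast d) x₀ < -(bν d K₁ * r)) :
    ∃ σ : ℝ, (σ = 1 ∨ σ = -1) ∧ Improved v α β ε K₁ N M a b x₀ r l m σ := by
  have hr := h.r_pos
  have hK := h.small.one_le_K
  have hν := bν_pos (d := d) hK
  have hρ := scaleC_pos (d := d) hK
  have hρ1 := scaleC_le (d := d) hK
  have hρν : bν d K₁ * r = 16 * (scaleC d K₁ * r) := by unfold scaleC; ring
  have hρr : 0 < scaleC d K₁ * r := by positivity
  have hρr' : scaleC d K₁ * r ≤ 1 / 1000 * r := by gcongr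
  have hκ := h.kap_le
  have hx₀r : x₀ ∈ ball x₀ r := mem_ball_self hr
  have hfar : ¬ |polyP M (eLast d) x₀| ≤ bν d K₁ * r := fun hn => by
    linarith [(abs_le.1 hn).1]
  have hyneg : ∀ σ : ℝ, (σ = 1 ∨ σ = -1) → ∀ y ∈ ball x₀ (scaleC d K₁ * r),
      polyP M (eLast d) y + ε * lev l m σ + σ * (ε * (m - l) * decayC d N) ≤ 0 := by
    intro σ hσ y hy
    have h5 := abs_le.1 (h.abs_eps_lev_le hσ)
    have h6 := h.decay_small
    rw [mem_ball] at hy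
    have h1 := (abs_le.1 (h.abs_polyP_sub hx₀r (y := y) (by linarith [h.r_le]))).2
    rcases hσ with rfl | rfl <;> linarith
  rcases h.core.beta_nonneg.eq_or_lt with hβ | hβ
  · refine ⟨1, Or.inl rfl, fun y hy => ?_, fun hn => absurd hn hfar⟩
    rw [Psi_of_nonpos (hyneg 1 (Or.inl rfl) y hy), ← hβ]
    have := h.core.nonneg hβ.symm y
    linarith
  obtain ⟨σ, hσ, hpiv⟩ := exists_sign (ε := ε) (l := l) (m := m) (β * (1 + inner ℝ b x₀)) (polyP M (eLast d) x₀) (v x₀)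
  refine ⟨σ, hσ, fun y hy => ?_, fun hn => absurd hn hfar⟩
  have hyr : y ∈ ball x₀ r := ball_subset_ball (by linarith) hy
  have hN : (1 : ℝ) ≤ N := by
    have h1 := h.small.le_N
    have h2 := bTop_le (d := d) hK
    have h3 : bTop d K₁ * N ≤ 1 / 72 * N := by gcongr
    linarith
  have H := gain (v := v) (k := ε * lev l m σ) (N := N) hβ hσ h.core.symm h.core.norm_b h.core.norm_bM
    h.core.eps_pos h.core.kappa_nonneg (by linarith) h.small.kap_gain hρr
    (h.width_sq hρr.le (by linarith)) (x := x₀) (y := y) (by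
      rw [mem_ball] at hy
      have : 1 * (scaleC d K₁ * r) ≤ N * (scaleC d K₁ * r) := by gcongr
      linarith) (fun p hp z hz => by
      have hp' : p ∈ ball x₀ (scaleC d K₁ * r) :=
        (convex_ball x₀ _).segment_subset (mem_ball_self hρr) hy hp
      have hzd : dist z x₀ < 6 * (scaleC d K₁ * r) := by
        rw [mem_ball] at hz hp'
        linarith [dist_triangle z p x₀]
      have hzr : z ∈ ball x₀ r := by rw [mem_ball]; linarith
      have h1 := (abs_le.1 (h.abs_polyP_sub hx₀r (y := z) (by linarith [h.r_le]))).2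
      have h2 : polyP M (eLast d) z < -(bν d K₁ * r / 4) := by linarith
      have h3 := h.core.neg hβ z (h.neg_phase hzr h2)
      refine ⟨h.ball_subset hzr, h3.1, h3.2, ?_⟩
      have h4 := h.flat hσ hzr
      have h5 := abs_le.1 (h.abs_eps_lev_le hσ)
      rwa [Psi_of_nonpos (by linarith)] at h4) hpiv
  have H' := h.mul_decay_le hσ (mul_nonneg hβ.le (h.weights (h.ball_subset hyr)).2.le) H
  rwa [Psi_of_nonpos (hyneg σ hσ y hy)]

/-- Harnack along the segment from the pivot to `y`. The segment stays in the positive phase because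
`P` is affine along it up to `‖M‖` times the squared length. -/
theorem top_of_pivot (hσ : σ = 1 ∨ σ = -1) (hP : |polyP M (eLast d) x₀| ≤ bν d K₁ * r)
    (hpiv : α * (1 + inner ℝ a (x₀ + (r / 2) • eLast d)) * (ε * (m - l) / 2)
      ≤ σ * (v (x₀ + (r / 2) • eLast d) - α * (1 + inner ℝ a (x₀ + (r / 2) • eLast d)) *
        (polyP M (eLast d) (x₀ + (r / 2) • eLast d) + ε * lev l m σ))) (y : Eu d)
    (hy : y ∈ ball x₀ r) (hty : tang (y - x₀) ≤ r ^ 2 / 4)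
    (hyk : polyP M (eLast d) y + ε * lev l m σ = bTop d K₁ * r) :
    0 ≤ σ * (v y - α * (1 + inner ℝ a y) *
      (bTop d K₁ * r + σ * (ε * (m - l) * gainC d N / 2))) := by
  have hr := h.r_pos
  have hr8 := h.r_le
  have hK := h.small.one_le_K
  have hν := bν_pos (d := d) hK
  have hνT := bν_le_bTop (d := d) hK
  have hTp := bTop_pos (d := d) hK
  have hTl := bTop_le (d := d) hK
  have hκ := h.kap_le
  have hκ0 := h.core.kappa_nonneg
  have hε := h.core.eps_pos
  have hc := gainC_pos (d := d) (N := N)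
  have hω := h.width_pos
  have hν1 : bν d K₁ ≤ 1 / 1000 := by linarith
  have hcκ := h.small.kap_gain
  have hlevr := h.abs_eps_lev_le hσ
  have hxb : x₀ + (r / 2) • eLast d ∈ ball x₀ (4 / 5 * r) := by
    rw [mem_ball, dist_eq_norm, add_sub_cancel_left, norm_smul, norm_eLast, Real.norm_eq_abs,
      abs_of_pos (by positivity)]
    linarith
  have hPb := polyP_add_smul h.core.symm h.core.map_dir x₀ (r / 2)
  have hPy : |polyP M (eLast d) y - polyP M (eLast d) x₀| ≤ r * (3 / 10) := by
    have h1 := abs_le.1 hP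
    have h2 := abs_le.1 hlevr
    have h3 : bTop d K₁ * r ≤ 1 / 72 * r := by gcongr
    have h4 : bν d K₁ * r ≤ 1 / 1000 * r := by gcongr
    have h5 : 0 < bTop d K₁ * r := by positivity
    rw [abs_le]; constructor <;> linarith
  have hyb := dist_lt_of_tang_le h.core.symm h.core.map_dir hr (by linarith)
    (by linarith [h.core.norm_M]) (by linarith [h.norm_x₀]) hty hPy
  have hdist : dist y (x₀ + (r / 2) • eLast d) ≤ 2 * r := by
    have := dist_triangle_right y (x₀ + (r / 2) • eLast d) x₀
    rw [mem_ball] at hxb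
    linarith
  have hTr : bTop d K₁ * r ≤ r / 72 := by nlinarith
  have hνr : bν d K₁ * r ≤ bTop d K₁ * r / 2000 := by nlinarith
  -- Radius of the balls in the chain. The concentric balls of five times this radius keep `P`
  -- positive, and `32 ≤ bTop * N` makes `N` of them cover the distance `2r`.
  have hs : 0 < bTop d K₁ * r / 16 := by positivity
  have hseg : ∀ p ∈ segment ℝ (x₀ + (r / 2) • eLast d) y,
      bTop d K₁ * r * (9 / 10) ≤ polyP M (eLast d) p := by
    intro p hp
    have h1 := abs_le.1 hP
    have h2 := abs_le.1 hlevr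
    have h3 := polyP_segment_ge (q := bTop d K₁ * r * (95 / 100)) (M := M)
      (x := x₀ + (r / 2) • eLast d) (y := y) (p := p) (by linarith) h.core.symm
      (by linarith) hp
    have h4 : ‖M‖ * ‖x₀ + (r / 2) • eLast d - y‖ ^ 2 ≤ bν d K₁ * r := by
      rw [← dist_eq_norm, dist_comm]
      calc ‖M‖ * dist y (x₀ + (r / 2) • eLast d) ^ 2 ≤ bν d K₁ * (2 * r) ^ 2 := by
            have := h.core.norm_M; have := h.small.kap_le
            gcongr; linarith
        _ ≤ bν d K₁ * r := by
            gcongr; nlinarith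
    linarith
  have H := gain (v := v) (k := ε * lev l m σ) (N := N) h.core.alpha_pos hσ h.core.symm
    h.core.norm_a h.core.norm_aM hε hκ0 (by linarith) hcκ hs
    (h.width_sq hs.le (by linarith)) (x := x₀ + (r / 2) • eLast d) (y := y) (by
      have := h.small.le_N
      have : 32 * (r / 16) ≤ bTop d K₁ * N * (r / 16) := by gcongr
      have e : (N : ℝ) * (bTop d K₁ * r / 16) = bTop d K₁ * N * (r / 16) := by ring
      have hlt : dist y (x₀ + (r / 2) • eLast d) < 2 * r := by
        have := dist_triangle_right y (x₀ + (r / 2) • eLast d) x₀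
        rw [mem_ball] at hxb
        linarith
      linarith) (fun p hp z hz => by
      have hp' : p ∈ ball x₀ (4 / 5 * r) := (convex_ball x₀ _).segment_subset hxb hyb hp
      rw [mem_ball] at hz
      have hzr : z ∈ ball x₀ r := by
        rw [mem_ball] at hp' ⊢
        linarith [dist_triangle z p x₀]
      have hpr : p ∈ ball x₀ r := ball_subset_ball (by linarith) hp'
      have h1 := (abs_le.1 (h.abs_polyP_sub hpr (y := z) (by linarith))).1
      have h2 : bν d K₁ * r / 4 < polyP M (eLast d) z := by
        have := hseg p hp
        linarith
      have h3 := h.core.pos z (h.pos_phase hzr h2)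
      refine ⟨h.ball_subset hzr, h3.1, h3.2, ?_⟩
      have h4 := h.flat hσ hzr
      have h5 := abs_le.1 hlevr
      rwa [Psi_of_nonneg (by linarith)] at h4) hpiv
  have hσσ : σ * σ = 1 := by rcases hσ with rfl | rfl <;> norm_num
  have hw := (h.weights (h.ball_subset hy)).1
  have h7 : α * (1 + inner ℝ a y) * (ε * (m - l) * gainC d N / 2)
      ≤ α * (1 + inner ℝ a y) * (ε * (m - l) * gainC d N) := by
    have := h.core.alpha_pos
    have : 0 < ε * (m - l) * gainC d N := by positivity
    gcongr; linarith
  rw [hyk] at H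
  linear_combination H + h7 - (α * (1 + inner ℝ a y) * (ε * (m - l) * gainC d N / 2)) * hσσ

/-- Here `r ≤ m - l` gives `ε gainC ≤ μ`, so the barrier perturbation dominates all errors of order
`κε`, while `ε ≤ τr²` gives `μ ≤ τr`, so the perturbation is small enough for the barrier. -/
theorem near_of_pivot (hσ : σ = 1 ∨ σ = -1) (hP : |polyP M (eLast d) x₀| ≤ bν d K₁ * r)
    (hpiv : α * (1 + inner ℝ a (x₀ + (r / 2) • eLast d)) * (ε * (m - l) / 2)
      ≤ σ * (v (x₀ + (r / 2) • eLast d) - α * (1 + inner ℝ a (x₀ + (r / 2) • eLast d)) *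
        (polyP M (eLast d) (x₀ + (r / 2) • eLast d) + ε * lev l m σ))) :
    Near v α β ε κ K₁ s₀ M a b σ r (ε * lev l m σ) (ε * (m - l) * gainC d N / r) x₀ := by
  have hr := h.r_pos
  have hr8 := h.r_le
  have hK := h.small.one_le_K
  have hν := bν_pos (d := d) hK
  have hνT := bν_le_bTop (d := d) hK
  have hTp := bTop_pos (d := d) hK
  have hTl := bTop_le (d := d) hK
  have hκ := h.kap_le
  have hκ0 := h.core.kappa_nonneg
  have hε := h.core.eps_pos
  have hc := gainC_pos (d := d) (N := N)
  have hc' := gainC_le (d := d) (N := N)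
  have hω := h.width_pos
  have hω4 := h.width_le
  have hτ := h.small.tau_pos
  have hν1 : bν d K₁ ≤ 1 / 1000 := by linarith
  -- Chosen so that `μr` is exactly the gain on the top surface; only half of it is needed there.
  set μ := ε * (m - l) * gainC d N / r with hμ
  have hμr : μ * r = ε * (m - l) * gainC d N := by rw [hμ]; field_simp
  have hμ0 : 0 < μ := by rw [hμ]; positivity
  have hμτ : μ ≤ τ * r := by
    rw [hμ, div_le_iff₀ hr]
    calc ε * (m - l) * gainC d N ≤ (τ * r ^ 2) * 4 * (1 / 16) := by
          have := h.eps_le; gcongr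
      _ ≤ τ * r ^ 2 := by nlinarith [mul_pos hτ (pow_pos hr 2)]
      _ = _ := by ring
  have hμτ8 : μ ≤ τ / 8 := by nlinarith
  have hkε := h.abs_lev_le hσ
  have hlevε : |ε * lev l m σ| ≤ 2 * ε := by
    rw [abs_mul, abs_of_pos hε]; nlinarith
  have hcκ := h.small.kap_gain
  have hd : (0 : ℝ) ≤ d := d.cast_nonneg
  have hμl : ε * gainC d N ≤ μ := by
    rw [hμ, le_div_iff₀ hr]
    have := h.r_le_width
    calc ε * gainC d N * r ≤ ε * gainC d N * (m - l) := by gcongr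
      _ = _ := by ring
  have hlevr := h.abs_eps_lev_le hσ
  refine ⟨h.core, hσ, hK, h.norm_x₀, hr, hr8, hμ0, ?_, ?_, ?_, h.small.kap_le, ?_, ?_,
    h.small.kap_const, ?_, ?_, hP, fun x hx => h.flat hσ hx, ?_, ?_⟩
  · linarith [h.small.tau_le]
  · linarith [h.small.tau_le_s₀]
  · have := h.small.tau_le; nlinarith
  · rw [lt_div_iff₀ (by positivity)]
    have h1 : κ * (2 * (d + 1) + 5) ≤ gainC d N / 2 := by nlinarith
    calc κ * ε * (2 * (d + 1) + 5) * (2 * r) = ε * (κ * (2 * (d + 1) + 5)) * (2 * r) := by ring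
      _ ≤ ε * (gainC d N / 2) * (2 * (1 / 8)) := by gcongr
      _ < ε * gainC d N := by nlinarith [mul_pos hε hc]
      _ ≤ μ := hμl
  · have h1 : κ ≤ gainC d N / 4 := by nlinarith
    nlinarith
  · have := mul_pos hν hr
    linarith
  · have : ε * (m - l) * gainC d N ≤ ε * 4 * (1 / 16) := by gcongr
    rw [mul_assoc, hμr]
    linarith
  · intro x hx
    have e : μ / (2 * r) = ε * (m - l) * gainC d N / (2 * r ^ 2) := by
      rw [hμ]; field_simp
    rw [e]
    constructor
    · rintro rfl hpos
      refine h.trap.glob_lower hP x hx ?_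
      have e : lev l m 1 = l := by unfold lev; ring
      rwa [e] at hpos
    · rintro rfl hpos
      have e : lev l m (-1) = m := by unfold lev; ring
      rw [e]
      exact h.trap.glob_upper hP x hx hpos
  · intro y hy hty hyk
    rw [hμr]
    exact h.top_of_pivot hσ hP hpiv y hy hty hyk

theorem improved_of_near (hP : |polyP M (eLast d) x₀| ≤ bν d K₁ * r) :
    ∃ σ : ℝ, (σ = 1 ∨ σ = -1) ∧ Improved v α β ε K₁ N M a b x₀ r l m σ := by
  have hr := h.r_pos
  have hν := bν_pos (d := d) h.small.one_le_K
  obtain ⟨σ, hσ, hpiv⟩ := exists_sign (ε := ε) (l := l) (m := m)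
    (α * (1 + inner ℝ a (x₀ + (r / 2) • eLast d)))
    (polyP M (eLast d) (x₀ + (r / 2) • eLast d)) (v (x₀ + (r / 2) • eLast d))
  have H := (h.near_of_pivot hσ hP hpiv).improve
  have e1 : ε * (m - l) * gainC d N / r * r = ε * (m - l) * gainC d N := by field_simp
  have e2 : ε * (m - l) * gainC d N / r / r = ε * (m - l) * gainC d N / r ^ 2 := by field_simp
  have e3 : ε * (m - l) * gainC d N * bT d / 4 = ε * (m - l) * decayC d N := by
    unfold decayC; ring
  have e4 : ε * (m - l) * gainC d N * bT d = 4 * (ε * (m - l) * decayC d N) := by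
    unfold decayC; ring
  rw [e1, e2, e3, e4] at H
  have hpos := h.decay_small.2
  refine ⟨σ, hσ, fun x hx => H.1 x (ball_subset_ball ?_ hx), fun _ x hx => ⟨fun hs hp => ?_,
    fun hs hp => ?_⟩⟩
  · unfold scaleC; nlinarith
  · exact (H.2 x hx).1 hs (by linarith)
  · have := (H.2 x hx).2 hs hp
    linarith

theorem exists_improved :
    ∃ σ : ℝ, (σ = 1 ∨ σ = -1) ∧ Improved v α β ε K₁ N M a b x₀ r l m σ := by
  by_cases hP : |polyP M (eLast d) x₀| ≤ bν d K₁ * r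
  · exact h.improved_of_near hP
  · rcases lt_abs.1 (not_le.1 hP) with h1 | h1
    · exact h.improved_of_far_pos h1
    · exact h.improved_of_far_neg (by linarith)

/-- One step of the decay of flatness. -/
theorem decay :
    Trap v α β ε (gainC d N) (bν d K₁) M a b x₀ (scaleC d K₁ * r) (l + decayC d N * (m - l)) m ∨
    Trap v α β ε (gainC d N) (bν d K₁) M a b x₀ (scaleC d K₁ * r) l (m - decayC d N * (m - l)) := by
  have hr := h.r_pos
  have hK := h.small.one_le_K
  have hν := bν_pos (d := d) hK
  have hρ := scaleC_pos (d := d) hK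
  have hρ1 := scaleC_le (d := d) hK
  have hε := h.core.eps_pos
  have hω := h.width_pos
  have hc := gainC_pos (d := d) (N := N)
  have hc' := gainC_le (d := d) (N := N)
  have hη := decayC_pos (d := d) (N := N)
  have hη' := decayC_le (d := d) (N := N)
  have hsub : ball x₀ (scaleC d K₁ * r) ⊆ ball x₀ r := ball_subset_ball (by nlinarith)
  have hnear : bν d K₁ * (scaleC d K₁ * r) ≤ bν d K₁ * r := by
    gcongr; nlinarith
  -- The paraboloid just produced has twice the opening assumed at scale `r`, yet it is flatter than
  -- the one required at scale `scaleC * r`, since `2 scaleC² ≤ 1 - decayC`.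
  have hcoef : ε * (m - l) * gainC d N / r ^ 2 ≤
      ε * ((1 - decayC d N) * (m - l)) * gainC d N / (2 * (scaleC d K₁ * r) ^ 2) := by
    rw [div_le_div_iff₀ (by positivity) (by positivity)]
    have h1 : 2 * scaleC d K₁ ^ 2 ≤ 1 - decayC d N := by nlinarith
    calc ε * (m - l) * gainC d N * (2 * (scaleC d K₁ * r) ^ 2)
        = ε * (m - l) * gainC d N * r ^ 2 * (2 * scaleC d K₁ ^ 2) := by ring
      _ ≤ ε * (m - l) * gainC d N * r ^ 2 * (1 - decayC d N) := by gcongr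
      _ = _ := by ring
  have hcoef' : ε * (m - l) * gainC d N / (2 * r ^ 2) ≤
      ε * ((1 - decayC d N) * (m - l)) * gainC d N / (2 * (scaleC d K₁ * r) ^ 2) := by
    refine le_trans ?_ hcoef
    have : r ^ 2 ≤ 2 * r ^ 2 := by nlinarith
    gcongr
  have hpos := h.decay_small.2
  obtain ⟨σ, hσ, h1, h2⟩ := h.exists_improved
  rcases hσ with rfl | rfl
  · left
    have e : lev l m 1 = l := by unfold lev; ring
    have e2 : m - (l + decayC d N * (m - l)) = (1 - decayC d N) * (m - l) := by ring
    rw [e] at h1 h2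
    refine ⟨fun x hx => ?_, fun x hx => h.trap.upper x (hsub hx), fun hn x hx hp => ?_,
      fun hn x hx hp => ?_⟩
    · have := h1 x hx
      have e3 : ε * (l + decayC d N * (m - l)) = ε * l + 1 * (ε * (m - l) * decayC d N) := by ring
      rw [e3, ← add_assoc]
      linarith
    · rw [e2] at hp
      refine (h2 (hn.trans hnear) x hx).1 rfl ?_
      have := mul_le_mul_of_nonneg_right hcoef (tang_nonneg (x - x₀))
      linarith
    · rw [e2]
      have h3 := h.trap.glob_upper (hn.trans hnear) x hx hp
      have := mul_le_mul_of_nonneg_right hcoef' (tang_nonneg (x - x₀))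
      linarith
  · right
    have e : lev l m (-1) = m := by unfold lev; ring
    have e2 : m - decayC d N * (m - l) - l = (1 - decayC d N) * (m - l) := by ring
    rw [e] at h1 h2
    refine ⟨fun x hx => h.trap.lower x (hsub hx), fun x hx => ?_, fun hn x hx hp => ?_,
      fun hn x hx hp => ?_⟩
    · have := h1 x hx
      have e3 : polyP M (eLast d) x + ε * (m - decayC d N * (m - l))
        = polyP M (eLast d) x + ε * m + -1 * (ε * (m - l) * decayC d N) := by ring
      rw [e3]
      linarith
    · rw [e2] at hp
      refine h.trap.glob_lower (hn.trans hnear) x hx ?_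
      have := mul_le_mul_of_nonneg_right hcoef' (tang_nonneg (x - x₀))
      linarith
    · rw [e2]
      have h3 := (h2 (hn.trans hnear) x hx).2 rfl hp
      have := mul_le_mul_of_nonneg_right hcoef (tang_nonneg (x - x₀))
      linarith

end Step


/-! ### Iteration over geometric scales: dichotomy and Hölder estimate. -/

section Iteration

variable {d : ℕ} {v : Eu d → ℝ} {α β ε κ K₁ s₀ τ : ℝ} {M : Eu d →L[ℝ] Eu d} {a b : Eu d} {N : ℕ}

/-- A small change of the weights is compensated by a small change of the level. -/
theorem Psi_le_Psi_add {x x' : Eu d} {y t : ℝ} (hα : 0 ≤ α) (hβ : 0 ≤ β)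
    (ha : |inner ℝ a x' - inner ℝ a x| * |y| ≤ (1 + inner ℝ a x) * t)
    (hb : |inner ℝ b x' - inner ℝ b x| * |y| ≤ (1 + inner ℝ b x) * t)
    (hax : 0 ≤ 1 + inner ℝ a x) (hbx' : 0 ≤ 1 + inner ℝ b x')
    (ht : 0 ≤ t) :
    Psi α β a b x' y ≤ Psi α β a b x (y + t) := by
  rcases le_or_gt 0 y with hy | hy
  · rw [Psi_of_nonneg hy, Psi_of_nonneg (by linarith)]
    rw [← abs_mul] at ha
    have := mul_le_mul_of_nonneg_left ((le_abs_self _).trans ha) hα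
    linarith
  · rw [Psi_of_nonpos hy.le]
    rcases le_or_gt (y + t) 0 with h1 | h1
    · rw [Psi_of_nonpos h1]
      rw [← abs_mul] at hb
      have := mul_le_mul_of_nonneg_left ((le_abs_self _).trans hb) hβ
      linarith
    · rw [Psi_of_nonneg h1.le]
      have h2 : β * (1 + inner ℝ b x') * y ≤ 0 := mul_nonpos_of_nonneg_of_nonpos (by positivity) hy.le
      have h3 : 0 ≤ α * (1 + inner ℝ a x) * (y + t) := by positivity
      linarith

theorem Psi_sub_le_Psi {x x' : Eu d} {y t : ℝ} (hα : 0 ≤ α) (hβ : 0 ≤ β)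
    (ha : |inner ℝ a x' - inner ℝ a x| * |y| ≤ (1 + inner ℝ a x) * t)
    (hb : |inner ℝ b x' - inner ℝ b x| * |y| ≤ (1 + inner ℝ b x) * t)
    (hax' : 0 ≤ 1 + inner ℝ a x') (hbx : 0 ≤ 1 + inner ℝ b x)
    (ht : 0 ≤ t) :
    Psi α β a b x (y - t) ≤ Psi α β a b x' y := by
  rcases le_or_gt y 0 with hy | hy
  · rw [Psi_of_nonpos hy, Psi_of_nonpos (by linarith)]
    rw [← abs_mul] at hb
    have := mul_le_mul_of_nonneg_left ((neg_abs_le _).trans' (neg_le_neg hb)) hβ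
    linarith
  · rw [Psi_of_nonneg hy.le]
    rcases le_or_gt 0 (y - t) with h1 | h1
    · rw [Psi_of_nonneg h1]
      rw [← abs_mul] at ha
      have := mul_le_mul_of_nonneg_left ((neg_abs_le _).trans' (neg_le_neg ha)) hα
      linarith
    · rw [Psi_of_nonpos h1.le]
      have h2 : β * (1 + inner ℝ b x) * (y - t) ≤ 0 :=
        mul_nonpos_of_nonneg_of_nonpos (by positivity) h1.le
      have h3 : 0 ≤ α * (1 + inner ℝ a x') * y := by positivity
      linarith

/-- A vertical translate of the profile is close to the profile at a shifted level. -/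
theorem polyV_shift (hc : Core v α β ε κ K₁ s₀ M a b) (hκ : κ ≤ 1 / 1000) (hε : ε ≤ 1 / 2)
    {s : ℝ} (hs : |s| ≤ 1) {x : Eu d} (hx : x ∈ ball (0 : Eu d) 1) :
    polyV α β M (eLast d) a b (x + (s * ε) • eLast d)
      ≤ Psi α β a b x (polyP M (eLast d) x + ε * (s + 6 * κ)) ∧
    Psi α β a b x (polyP M (eLast d) x + ε * (s - 6 * κ))
      ≤ polyV α β M (eLast d) a b (x + (s * ε) • eLast d) := by
  have hε0 := hc.eps_pos
  have hκ0 := hc.kappa_nonneg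
  rw [polyV_eq_Psi, polyP_add_smul hc.symm hc.map_dir]
  have hP : |polyP M (eLast d) x| ≤ 3 / 2 := by
    have h1 := abs_polyP_sub_le hc.symm hc.map_dir x 0
    have h2 : polyP M (eLast d) 0 = 0 := by simp [polyP]
    have h3 := abs_inner_eLast_le x
    have h4 := norm_tproj_le x
    rw [mem_ball_zero_iff] at hx
    rw [sub_zero, norm_zero, zero_add, h2, sub_zero] at h1
    have h5 : ‖M‖ * ‖tproj d x‖ * ‖tproj d x‖ ≤ 1 / 1000 * 1 * 1 := by
      have := hc.norm_M
      gcongr <;> linarith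
    rw [abs_le] at *
    constructor <;> linarith
  have hsε : |s * ε| ≤ ε := by
    rw [abs_mul, abs_of_pos hε0]; nlinarith
  have hy : |polyP M (eLast d) x + s * ε| ≤ 2 := by
    have := abs_add_le (polyP M (eLast d) x) (s * ε)
    linarith
  have key : ∀ A : Eu d, ‖A‖ ≤ κ → (99 / 100 ≤ 1 + inner ℝ A x) ∧
      0 ≤ 1 + inner ℝ A (x + (s * ε) • eLast d) ∧
      |inner ℝ A (x + (s * ε) • eLast d) - inner ℝ A x| * |polyP M (eLast d) x + s * ε|
        ≤ (1 + inner ℝ A x) * (6 * κ * ε) := by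
    intro A hA
    have h1 := (abs_le.1 (abs_inner_le_of_mem_ball hA hx)).1
    have h2 : |inner ℝ A (x + (s * ε) • eLast d) - inner ℝ A x| ≤ κ * ε := by
      rw [inner_add_right, add_sub_cancel_left, inner_smul_right, abs_mul, mul_comm κ]
      have h3 := abs_real_inner_le_norm A (eLast d)
      rw [norm_eLast, mul_one] at h3
      exact mul_le_mul hsε (h3.trans hA) (abs_nonneg _) hε0.le
    have h4 : κ * ε ≤ 1 / 1000 * (1 / 2) := by gcongr
    refine ⟨by linarith, by have := (abs_le.1 h2).1; linarith, ?_⟩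
    calc _ ≤ (κ * ε) * 2 := by gcongr
      _ ≤ (99 / 100) * (6 * κ * ε) := by nlinarith [mul_nonneg hκ0 hε0.le]
      _ ≤ _ := by gcongr; linarith
  obtain ⟨a1, a2, a3⟩ := key a hc.norm_a
  obtain ⟨b1, b2, b3⟩ := key b hc.norm_b
  have e1 : polyP M (eLast d) x + ε * (s + 6 * κ) = polyP M (eLast d) x + s * ε + 6 * κ * ε := by
    ring
  have e2 : polyP M (eLast d) x + ε * (s - 6 * κ) = polyP M (eLast d) x + s * ε - 6 * κ * ε := by
    ring
  rw [e1, e2]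
  exact ⟨Psi_le_Psi_add hc.alpha_pos.le hc.beta_nonneg a3 b3 (by linarith) b2
    (by positivity), Psi_sub_le_Psi hc.alpha_pos.le hc.beta_nonneg a3 b3 a2 (by linarith)
    (by positivity)⟩

/-- The hypotheses of the iteration: flatness in the unit ball and small parameters. -/
structure Start {d : ℕ} (v : Eu d → ℝ) (α β ε κ K₁ s₀ τ : ℝ) (N : ℕ) (M : Eu d →L[ℝ] Eu d)
    (a b : Eu d) : Prop where
  core : Core v α β ε κ K₁ s₀ M a b
  small : Small d κ K₁ s₀ τ N
  kap_decay : 24 * κ ≤ decayC d N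
  eps_le : ε ≤ τ * (1 / 8) ^ 2
  lower : ∀ x ∈ ball (0 : Eu d) 1, polyV α β M (eLast d) a b (x - ε • eLast d) ≤ v x
  upper : ∀ x ∈ ball (0 : Eu d) 1, v x ≤ polyV α β M (eLast d) a b (x + ε • eLast d)

namespace Start

variable (h : Start v α β ε κ K₁ s₀ τ N M a b)
include h

theorem kap_le : κ ≤ 1 / 1000 := by
  have h1 := h.small.kap_le
  have h2 := bν_le_bT (d := d) h.small.one_le_K
  have h3 := bT_le (d := d)
  linarith

theorem tau_le_one : τ ≤ 1 := by
  have h1 := h.small.tau_le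
  have h2 := bν_le_bT (d := d) h.small.one_le_K
  have h3 := bT_le (d := d)
  linarith

theorem eps_le_half : ε ≤ 1 / 2 := by
  have h1 := h.eps_le
  have h2 := h.tau_le_one
  nlinarith

/-- A vertical translate of the profile also shifts the argument of the weights; this costs `6κ` in
the level, hence the initial levels `±(1 + 6κ)`. Flatness in the whole of `B₁` gives the global
statement even without the paraboloids. -/
theorem step_zero {x₀ : Eu d} (hx₀ : ‖x₀‖ ≤ 1 / 2) :
    Step v α β ε κ K₁ s₀ τ N M a b x₀ (1 / 8) (-(1 + 6 * κ)) (1 + 6 * κ) := by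
  have hκ := h.kap_le
  have hκ0 := h.core.kappa_nonneg
  have hε := h.core.eps_pos
  have hc := gainC_pos (d := d) (N := N)
  have hlow : ∀ x ∈ ball (0 : Eu d) 1,
      Psi α β a b x (polyP M (eLast d) x + ε * (-(1 + 6 * κ))) ≤ v x := by
    intro x hx
    have h1 := (polyV_shift h.core hκ h.eps_le_half (s := -1) (by norm_num) hx).2
    have h2 := h.lower x hx
    rw [neg_one_mul, neg_smul, ← sub_eq_add_neg] at h1
    rw [show -(1 + 6 * κ) = -1 - 6 * κ by ring]
    exact h1.trans h2
  have hup : ∀ x ∈ ball (0 : Eu d) 1,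
      v x ≤ Psi α β a b x (polyP M (eLast d) x + ε * (1 + 6 * κ)) := by
    intro x hx
    have h1 := (polyV_shift h.core hκ h.eps_le_half (s := 1) (by norm_num) hx).1
    have h2 := h.upper x hx
    rw [one_mul] at h1
    exact h2.trans h1
  have hsub : ball x₀ (1 / 8) ⊆ ball (0 : Eu d) 1 := fun x hx => by
    rw [mem_ball, dist_eq_norm] at hx
    rw [mem_ball_zero_iff]
    have h3 : ‖x‖ ≤ ‖x - x₀‖ + ‖x₀‖ := by simpa using norm_add_le (x - x₀) x₀
    linarith
  have hw : ∀ x ∈ ball (0 : Eu d) 1, 0 < 1 + inner ℝ a x ∧ 0 < 1 + inner ℝ b x := fun x hx => by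
    have h1 := (abs_le.1 (abs_inner_le_of_mem_ball h.core.norm_a hx)).1
    have h2 := (abs_le.1 (abs_inner_le_of_mem_ball h.core.norm_b hx)).1
    constructor <;> linarith
  have hcoef : 0 ≤ ε * (1 + 6 * κ - -(1 + 6 * κ)) * gainC d N / (2 * (1 / 8) ^ 2) := by
    have : 0 ≤ 1 + 6 * κ - -(1 + 6 * κ) := by linarith
    positivity
  refine ⟨h.core, h.small, ⟨fun x hx => hlow x (hsub hx), fun x hx => hup x (hsub hx),
    fun _ x hx hp => ?_, fun _ x hx hp => ?_⟩, hx₀, by norm_num, le_rfl, by linarith, ?_, ?_,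
    h.eps_le⟩
  · have hx1 : x ∈ ball (0 : Eu d) 1 := ball_subset_ball (by norm_num) hx
    refine lt_of_lt_of_le ?_ (hlow x hx1)
    rw [Psi_pos_iff h.core.alpha_pos h.core.beta_nonneg (hw x hx1).1 (hw x hx1).2]
    have := mul_nonneg hcoef (tang_nonneg (x - x₀))
    linarith
  · have hx1 : x ∈ ball (0 : Eu d) 1 := ball_subset_ball (by norm_num) hx
    have h1 := lt_of_lt_of_le hp (hup x hx1)
    rw [Psi_pos_iff h.core.alpha_pos h.core.beta_nonneg (hw x hx1).1 (hw x hx1).2] at h1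
    have := mul_nonneg hcoef (tang_nonneg (x - x₀))
    linarith
  · rw [abs_neg, abs_of_pos (by linarith)]; linarith
  · rw [abs_of_pos (by linarith)]; linarith

/-- The improvement of flatness at the origin. -/
theorem dichotomy {η : ℝ} (hη : 0 < η) (hη1 : η ≤ decayC d N) (hη2 : η ≤ scaleC d K₁ / 8) :
    (∀ x ∈ ball (0 : Eu d) η,
      v x ≤ polyV α β M (eLast d) a b (x + ((1 - η) * ε) • eLast d)) ∨
    ∀ x ∈ ball (0 : Eu d) η,
      polyV α β M (eLast d) a b (x - ((1 - η) * ε) • eLast d) ≤ v x := by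
  have hκ := h.kap_le
  have hκ0 := h.core.kappa_nonneg
  have hε := h.core.eps_pos
  have hρ := scaleC_le (d := d) h.small.one_le_K
  have hkd := h.kap_decay
  have hw : ∀ x ∈ ball (0 : Eu d) 1, 0 < 1 + inner ℝ a x ∧ 0 < 1 + inner ℝ b x := fun x hx => by
    have h1 := (abs_le.1 (abs_inner_le_of_mem_ball h.core.norm_a hx)).1
    have h2 := (abs_le.1 (abs_inner_le_of_mem_ball h.core.norm_b hx)).1
    constructor <;> linarith
  have hsub1 : ball (0 : Eu d) η ⊆ ball 0 1 := ball_subset_ball (by linarith)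
  have hsub2 : ball (0 : Eu d) η ⊆ ball 0 (scaleC d K₁ * (1 / 8)) :=
    ball_subset_ball (by linarith)
  have hs : |1 - η| ≤ 1 := by rw [abs_le]; constructor <;> linarith
  -- The step gains `2 decayC (1 + 6κ)`; the two conversions between translates and levels cost `12κ
  -- ≤ decayC / 2`, which leaves at least `η`.
  have hkey : -(1 + 6 * κ) + decayC d N * (1 + 6 * κ - -(1 + 6 * κ)) ≥ -(1 - η) + 6 * κ := by
    nlinarith
  rcases (h.step_zero (x₀ := 0) (by simp)).decay with H | H
  · right
    intro x hx
    have h1 := H.lower x (hsub2 hx)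
    have h2 := (polyV_shift h.core hκ h.eps_le_half (s := -(1 - η)) (by rwa [abs_neg]) (hsub1 hx)).1
    rw [neg_mul, neg_smul, ← sub_eq_add_neg] at h2
    refine (h2.trans (Psi_mono h.core.alpha_pos h.core.beta_nonneg (hw x (hsub1 hx)).1
      (hw x (hsub1 hx)).2 ?_)).trans h1
    have := mul_le_mul_of_nonneg_left hkey hε.le
    linarith
  · left
    intro x hx
    have h1 := H.upper x (hsub2 hx)
    have h2 := (polyV_shift h.core hκ h.eps_le_half (s := 1 - η) hs (hsub1 hx)).2
    refine h1.trans ((Psi_mono h.core.alpha_pos h.core.beta_nonneg (hw x (hsub1 hx)).1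
      (hw x (hsub1 hx)).2 ?_).trans h2)
    have := mul_le_mul_of_nonneg_left hkey hε.le
    linarith

/-- The radius decreases by the factor `scaleC`, the width only by `1 - decayC ≥ scaleC`, so `r ≤ m
- l` is preserved. The only obstruction to continuing is `ε ≤ τr²`. -/
theorem exists_step {x₀ : Eu d} (hx₀ : ‖x₀‖ ≤ 1 / 2) (k : ℕ)
    (hk : ε ≤ τ * (scaleC d K₁ ^ k / 8) ^ 2) :
    ∃ l m : ℝ, Step v α β ε κ K₁ s₀ τ N M a b x₀ (scaleC d K₁ ^ k / 8) l m ∧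
      m - l = (1 - decayC d N) ^ k * (2 * (1 + 6 * κ)) ∧ -(1 + 6 * κ) ≤ l ∧ m ≤ 1 + 6 * κ := by
  have hρ := scaleC_pos (d := d) h.small.one_le_K
  have hρ1 := scaleC_le (d := d) h.small.one_le_K
  have hη := decayC_pos (d := d) (N := N)
  have hη' := decayC_le (d := d) (N := N)
  have hc' := gainC_le (d := d) (N := N)
  have hκ := h.kap_le
  have hκ0 := h.core.kappa_nonneg
  have hτ := h.small.tau_pos
  induction k with
  | zero =>
    refine ⟨-(1 + 6 * κ), 1 + 6 * κ, ?_, by ring, le_rfl, le_rfl⟩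
    have := h.step_zero hx₀
    simpa using this
  | succ k ih =>
    obtain ⟨l, m, hS, hlm, hl, hm⟩ := ih (hk.trans (by
      have : scaleC d K₁ ^ (k + 1) ≤ scaleC d K₁ ^ k :=
        pow_le_pow_of_le_one hρ.le (by linarith) k.le_succ
      gcongr))
    have hω := hS.width_pos
    have hωη : 0 ≤ decayC d N * (m - l) := by positivity
    have hω' : (1 - decayC d N) * (m - l) = (1 - decayC d N) ^ (k + 1) * (2 * (1 + 6 * κ)) := by
      rw [hlm]; ring
    have hω0 : 0 < (1 - decayC d N) * (m - l) := mul_pos (by linarith) hω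
    have hr : scaleC d K₁ * (scaleC d K₁ ^ k / 8) = scaleC d K₁ ^ (k + 1) / 8 := by ring
    have hpos : 0 < scaleC d K₁ ^ (k + 1) / 8 := by positivity
    have hle8 : scaleC d K₁ ^ (k + 1) / 8 ≤ 1 / 8 := by
      have : scaleC d K₁ ^ (k + 1) ≤ 1 := pow_le_one₀ hρ.le (by linarith)
      linarith
    have hrω : scaleC d K₁ ^ (k + 1) / 8 ≤ (1 - decayC d N) * (m - l) := by
      rw [← hr]
      exact mul_le_mul (by linarith) hS.r_le_width hS.r_pos.le (by linarith)
    rcases hS.decay with H | H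
    · rw [hr] at H
      have e : m - (l + decayC d N * (m - l)) = (1 - decayC d N) * (m - l) := by ring
      refine ⟨l + decayC d N * (m - l), m, ⟨h.core, h.small, H, hx₀, hpos, hle8, by rwa [e], ?_, ?_,
        hk⟩, by rw [e, hω'], by linarith, hm⟩
      · rw [abs_le]; constructor <;> linarith
      · rw [abs_le]; constructor <;> linarith
    · rw [hr] at H
      have e : m - decayC d N * (m - l) - l = (1 - decayC d N) * (m - l) := by ring
      refine ⟨l, m - decayC d N * (m - l), ⟨h.core, h.small, H, hx₀, hpos, hle8, by rwa [e], ?_, ?_,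
        hk⟩, by rw [e, hω'], hl, by linarith⟩
      · rw [abs_le]; constructor <;> linarith
      · rw [abs_le]; constructor <;> linarith

end Start

/-- The Hölder exponent produced by the decay of flatness. -/
def holderExp (d : ℕ) (K₁ : ℝ) (N : ℕ) : ℝ := Real.log (1 - decayC d N) / Real.log (scaleC d K₁)

/-- The Hölder constant produced by the decay of flatness. -/
def holderC (d : ℕ) (K₁ : ℝ) (N : ℕ) : ℝ := 60 * (9 / scaleC d K₁) ^ holderExp d K₁ N

theorem holderExp_mem (hK : 1 ≤ K₁) : 0 < holderExp d K₁ N ∧ holderExp d K₁ N < 1 := by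
  have hρ := scaleC_pos (d := d) hK
  have hρ1 := scaleC_le (d := d) hK
  have hη := decayC_pos (d := d) (N := N)
  have hη' := decayC_le (d := d) (N := N)
  have hc' := gainC_le (d := d) (N := N)
  have h1 : Real.log (1 - decayC d N) < 0 := Real.log_neg (by linarith) (by linarith)
  have h2 : Real.log (scaleC d K₁) < 0 := Real.log_neg hρ (by linarith)
  refine ⟨div_pos_of_neg_of_neg h1 h2, ?_⟩
  rw [holderExp, div_lt_one_of_neg h2]
  exact Real.log_lt_log hρ (by linarith)

theorem scaleC_rpow_holderExp (hK : 1 ≤ K₁) :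
    scaleC d K₁ ^ holderExp d K₁ N = 1 - decayC d N := by
  have hρ := scaleC_pos (d := d) hK
  have hρ1 := scaleC_le (d := d) hK
  have hη' := decayC_le (d := d) (N := N)
  have hc' := gainC_le (d := d) (N := N)
  have h2 : Real.log (scaleC d K₁) < 0 := Real.log_neg hρ (by linarith)
  rw [Real.rpow_def_of_pos hρ, holderExp, mul_div_cancel₀ _ h2.ne, Real.exp_log (by linarith)]

/-- Hölder estimate at scales above `√(ε/τ)` for a function controlled by the trapping levels. -/
theorem Start.holder (h : Start v α β ε κ K₁ s₀ τ N M a b) {w : Eu d → ℝ} {S : Set (Eu d)}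
    (hw : ∀ x ∈ S, ∀ y ∈ S, ‖x‖ ≤ 1 / 2 → ‖y‖ ≤ 1 / 2 → ∀ r l m : ℝ,
      Step v α β ε κ K₁ s₀ τ N M a b x r l m → dist y x < r → |w x - w y| ≤ 15 * (m - l))
    (hb : ∀ x ∈ S, ‖x‖ ≤ 1 / 2 → |w x| ≤ 3) {x y : Eu d} (hx : x ∈ S) (hy : y ∈ S)
    (hx2 : ‖x‖ ≤ 1 / 2) (hy2 : ‖y‖ ≤ 1 / 2) (hxy : √(ε / τ) ≤ ‖x - y‖) :
    |w x - w y| ≤ holderC d K₁ N * ‖x - y‖ ^ holderExp d K₁ N := by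
  have hρ := scaleC_pos (d := d) h.small.one_le_K
  have hρ1 := scaleC_le (d := d) h.small.one_le_K
  have hκ := h.kap_le
  have hκ0 := h.core.kappa_nonneg
  have hε := h.core.eps_pos
  have hτ := h.small.tau_pos
  obtain ⟨hθ, -⟩ := holderExp_mem (d := d) (N := N) h.small.one_le_K
  have hη' := decayC_le (d := d) (N := N)
  have hc' := gainC_le (d := d) (N := N)
  set R := ‖x - y‖ with hR
  have hR0 : 0 < R := lt_of_lt_of_le (Real.sqrt_pos.2 (by positivity)) hxy
  have hRε : ε / τ ≤ R ^ 2 := (Real.sqrt_le_left hR0.le).1 hxy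
  have hC : holderC d K₁ N * R ^ holderExp d K₁ N
      = 60 * (9 * R / scaleC d K₁) ^ holderExp d K₁ N := by
    rw [holderC, mul_assoc, ← Real.mul_rpow (by positivity) hR0.le]
    rw [div_mul_eq_mul_div]
  rw [hC]
  rcases le_or_gt (1 / 9) R with h8 | h8
  · have h1 : (1 : ℝ) ≤ (9 * R / scaleC d K₁) ^ holderExp d K₁ N := by
      refine Real.one_le_rpow ?_ hθ.le
      rw [le_div_iff₀ hρ]; linarith
    have h2 := hb x hx hx2
    have h3 := hb y hy hy2
    have h4 := abs_sub (w x) (w y)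
    linarith
  -- The factor `9` instead of `8` makes `R < scaleC ^ k / 8` strict, so that `y` lies in the open
  -- ball at step `k`; at that step the width is comparable to `R ^ θ`.
  · obtain ⟨k, hk1, hk2⟩ := exists_nat_pow_near_of_lt_one (x := 9 * R) (y := scaleC d K₁)
      (by positivity) (by linarith) hρ (by linarith)
    have hRk : R < scaleC d K₁ ^ k / 8 := by linarith
    obtain ⟨l, m, hS, hlm, -, -⟩ := h.exists_step hx2 k (by
      rw [div_le_iff₀ hτ] at hRε
      have : R ^ 2 * τ ≤ (scaleC d K₁ ^ k / 8) ^ 2 * τ := by gcongr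
      linarith)
    have h1 := hw x hx y hy hx2 hy2 _ _ _ hS (by rw [dist_comm, dist_eq_norm]; exact hRk)
    have h2 : (1 - decayC d N) ^ k ≤ (9 * R / scaleC d K₁) ^ holderExp d K₁ N := by
      rw [← scaleC_rpow_holderExp (d := d) h.small.one_le_K, ← Real.rpow_natCast,
        ← Real.rpow_mul hρ.le, mul_comm, Real.rpow_mul hρ.le, Real.rpow_natCast]
      refine Real.rpow_le_rpow (by positivity) ?_ hθ.le
      rw [le_div_iff₀ hρ, ← pow_succ]
      exact hk1.le
    have h3 : (1 - decayC d N) ^ k * (2 * (1 + 6 * κ)) ≤ (1 - decayC d N) ^ k * 4 := by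
      have : 0 ≤ 1 - decayC d N := by linarith
      gcongr; linarith
    linarith

end Iteration


/-! ### From trapping levels to the renormalization. -/

section Renorm

variable {d : ℕ} {v : Eu d → ℝ} {α β ε κ K₁ s₀ τ : ℝ} {M : Eu d →L[ℝ] Eu d} {a b : Eu d} {N : ℕ}
  {x₀ : Eu d} {r l m : ℝ}

namespace Step

variable (h : Step v α β ε κ K₁ s₀ τ N M a b x₀ r l m)
include h

theorem level_of_pos {z : Eu d} (hz : z ∈ ball x₀ r) (hv : 0 < v z) :
    0 < polyP M (eLast d) z + ε * m := by
  have ⟨h1, h2⟩ := h.weights (h.ball_subset hz)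
  rw [← Psi_pos_iff h.core.alpha_pos h.core.beta_nonneg h1 h2]
  exact lt_of_lt_of_le hv (h.trap.upper z hz)

theorem level_of_nonpos {z : Eu d} (hz : z ∈ ball x₀ r) (hv : v z ≤ 0) :
    polyP M (eLast d) z + ε * l ≤ 0 := by
  have ⟨h1, h2⟩ := h.weights (h.ball_subset hz)
  rw [← not_lt, ← Psi_pos_iff h.core.alpha_pos h.core.beta_nonneg h1 h2, not_lt]
  exact (h.trap.lower z hz).trans hv

theorem level_of_mem {z : Eu d} (hz : z ∈ ball x₀ r) (hv : z ∈ posPhase v ∪ freeBdry v) :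
    0 ≤ polyP M (eLast d) z + ε * m := by
  rcases hv with hv | hv
  · exact (h.level_of_pos hz hv.2).le
  · have hcl : z ∈ closure (ball x₀ r ∩ posPhase v) :=
      isOpen_ball.inter_closure ⟨hz, frontier_subset_closure hv.1⟩
    exact closure_minimal (s := ball x₀ r ∩ posPhase v)
      (t := {y | 0 ≤ polyP M (eLast d) y + ε * m}) (fun y hy => (h.level_of_pos hy.1 hy.2.2).le)
      (isClosed_le continuous_const ((continuous_polyP M _).add_const _)) hcl

/-- Subtracting the linear reference and dividing by `αε` turns a level `εl` or `εm` into `l` or `m`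
times the weight. If the lower level has `P + εl < 0`, the bound follows from `v ≥ 0` instead. -/
theorem renorm_pos {z : Eu d} (hz : z ∈ ball x₀ r) (hv : z ∈ posPhase v ∪ freeBdry v) :
    (1 + inner ℝ a z) * l ≤ (v z - α * (1 + inner ℝ a z) * polyP M (eLast d) z) / (α * ε) ∧
    (v z - α * (1 + inner ℝ a z) * polyP M (eLast d) z) / (α * ε) ≤ (1 + inner ℝ a z) * m := by
  have hα := h.core.alpha_pos
  have hε := h.core.eps_pos
  have hw := (h.weights (h.ball_subset hz)).1
  have hαw : 0 < α * (1 + inner ℝ a z) := by positivity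
  rw [le_div_iff₀ (by positivity), div_le_iff₀ (by positivity)]
  have h1 := h.trap.upper z hz
  rw [Psi_of_nonneg (h.level_of_mem hz hv)] at h1
  refine ⟨?_, by linarith⟩
  have h2 : 0 ≤ v z := by
    rcases hv with hv | hv
    · exact hv.2.le
    · exact (eq_zero_of_mem_freeBdry h.core.cont hv).ge
  rcases le_or_gt 0 (polyP M (eLast d) z + ε * l) with h3 | h3
  · have := h.trap.lower z hz
    rw [Psi_of_nonneg h3] at this
    linarith
  · have := mul_neg_of_pos_of_neg hαw h3
    linarith

theorem renorm_neg (hβ : 0 < β) {z : Eu d} (hz : z ∈ ball x₀ r) (hv : v z ≤ 0) :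
    (1 + inner ℝ b z) * l ≤ (v z - β * (1 + inner ℝ b z) * polyP M (eLast d) z) / (β * ε) ∧
    (v z - β * (1 + inner ℝ b z) * polyP M (eLast d) z) / (β * ε) ≤ (1 + inner ℝ b z) * m := by
  have hε := h.core.eps_pos
  have hw := (h.weights (h.ball_subset hz)).2
  have hβw : 0 < β * (1 + inner ℝ b z) := by positivity
  rw [le_div_iff₀ (by positivity), div_le_iff₀ (by positivity)]
  have h1 := h.trap.lower z hz
  rw [Psi_of_nonpos (h.level_of_nonpos hz hv)] at h1
  refine ⟨by linarith, ?_⟩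
  rcases le_or_gt (polyP M (eLast d) z + ε * m) 0 with h3 | h3
  · have := h.trap.upper z hz
    rw [Psi_of_nonpos h3] at this
    linarith
  · have := mul_pos hβw h3
    linarith

/-- Difference of two values that are controlled by the same or by nearby weights. -/
theorem abs_sub_le_of_weights {p q s t : ℝ} (hp : (1 + s) * l ≤ p ∧ p ≤ (1 + s) * m)
    (hq : (1 + t) * l ≤ q ∧ q ≤ (1 + t) * m) (hs : |s| ≤ 1) (ht : |t| ≤ 1)
    (hst : |s - t| ≤ 13 / 2 * r) : |p - q| ≤ 15 * (m - l) := by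
  have hω := h.width_pos
  have hrω := h.r_le_width
  have hl := h.abs_l
  have hm := h.abs_m
  -- Changing the weight costs at most `13r ≤ 13(m - l)`, and the width counts with a weight of at
  -- most `2`; together `15`.
  have h1 : |(s - t) * l| ≤ 13 * r := by
    rw [abs_mul]
    calc _ ≤ 13 / 2 * r * 2 := by have := h.r_pos; gcongr
      _ = _ := by ring
  have h2 : (1 + s) * (m - l) ≤ 2 * (m - l) := by gcongr; linarith [(abs_le.1 hs).2]
  have h3 : (1 + t) * (m - l) ≤ 2 * (m - l) := by gcongr; linarith [(abs_le.1 ht).2]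
  rw [abs_le] at h1 ⊢
  constructor <;> linarith

theorem abs_inner_sub_le {A x y : Eu d} (hA : ‖A‖ ≤ κ) (hxy : dist y x < r) :
    |inner ℝ A x - inner ℝ A y| ≤ 13 / 2 * r := by
  have hκ := h.kap_le
  rw [← inner_sub_right]
  rw [dist_comm, dist_eq_norm] at hxy
  calc _ ≤ ‖A‖ * ‖x - y‖ := abs_real_inner_le_norm _ _
    _ ≤ 1 * r := by gcongr; linarith
    _ ≤ _ := by linarith [h.r_pos]

theorem norm_bound {A z : Eu d} (hA : ‖A‖ ≤ κ) (hz : ‖z‖ ≤ 1 / 2) : |inner ℝ A z| ≤ 1 := by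
  have hκ := h.kap_le
  have := abs_inner_le_of_mem_ball hA (x := z) (by rw [mem_ball_zero_iff]; linarith)
  linarith

/-- Near the free boundary the weights of both phases are close to `1`. -/
theorem abs_inner_sub_le_of_cross (ha : ‖a‖ ≤ √ε) (hb : ‖b - inner ℝ b (eLast d) • eLast d‖ ≤ √ε)
    (hM : ‖M‖ ≤ √ε) {x y : Eu d} (hx : ‖x‖ ≤ 1 / 2) (hy : ‖y‖ ≤ 1 / 2)
    (hxr : x ∈ ball x₀ r) (hxy : dist y x < r)
    (hPx : 0 ≤ polyP M (eLast d) x + ε * m) (hPy : polyP M (eLast d) y + ε * l ≤ 0) :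
    |inner ℝ a x - inner ℝ b y| ≤ 13 / 2 * r := by
  have hr := h.r_pos
  have hε := h.core.eps_pos
  have hr8 := h.r_le
  have hτ1 : τ ≤ 1 := by
    have h1 := h.small.tau_le
    have h2 := bν_le_bT (d := d) h.small.one_le_K
    have h3 := bT_le (d := d)
    linarith
  have hεr : ε ≤ r ^ 2 := h.eps_le.trans (by nlinarith [pow_pos hr 2])
  -- `a`, `b'` and `M` are of order `√ε`, hence of order `r`. The component `bₙ` is merely bounded,
  -- but the two points lie in different phases at distance less than `r`, so `yₙ` is of order `r`.
  have hsε : √ε ≤ r := Real.sqrt_le_iff.2 ⟨hr.le, hεr⟩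
  have hεr' : ε ≤ r / 8 := by nlinarith
  have hPxy := abs_le.1 (h.abs_polyP_sub hxr (y := y) (by linarith))
  have hm := abs_le.1 h.abs_m
  have hl := abs_le.1 h.abs_l
  have hεm : ε * m ≤ r / 4 := by nlinarith
  have hεl : -(r / 4) ≤ ε * l := by nlinarith
  have hPy' : |polyP M (eLast d) y| ≤ 9 / 4 * r := by
    rw [abs_le]; constructor <;> linarith
  have hyn : |inner ℝ (eLast d) y| ≤ 3 * r := by
    have e : inner ℝ (eLast d) y = polyP M (eLast d) y + 1 / 2 * inner ℝ y (M y) := by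
      rw [polyP, real_inner_comm]; ring
    have h1 : |inner ℝ y (M y)| ≤ r := by
      calc _ ≤ ‖y‖ * ‖M y‖ := abs_real_inner_le_norm _ _
        _ ≤ ‖y‖ * (‖M‖ * ‖y‖) := by gcongr; exact M.le_opNorm y
        _ ≤ 1 * (r * 1) := by gcongr <;> linarith
        _ = r := by ring
    rw [e, abs_le]
    rw [abs_le] at hPy' h1
    constructor <;> linarith
  have h1 : |inner ℝ a x| ≤ r := by
    calc _ ≤ ‖a‖ * ‖x‖ := abs_real_inner_le_norm _ _
      _ ≤ r * 1 := by gcongr <;> linarith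
      _ = r := mul_one r
  have h2 : |inner ℝ b y| ≤ 4 * r := by
    have e : inner ℝ b y = inner ℝ (b - inner ℝ b (eLast d) • eLast d) y
        + inner ℝ b (eLast d) * inner ℝ (eLast d) y := by
      rw [inner_sub_left, inner_smul_left]; simp
    have h3 : |inner ℝ (b - inner ℝ b (eLast d) • eLast d) y| ≤ r := by
      calc _ ≤ ‖b - inner ℝ b (eLast d) • eLast d‖ * ‖y‖ := abs_real_inner_le_norm _ _
        _ ≤ r * 1 := by gcongr <;> linarith
        _ = r := mul_one r
    have h4 : |inner ℝ b (eLast d) * inner ℝ (eLast d) y| ≤ 3 * r := by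
      rw [abs_mul]
      have h5 := abs_real_inner_le_norm b (eLast d)
      rw [norm_eLast, mul_one] at h5
      calc _ ≤ 1 * (3 * r) := by
            gcongr; linarith [h.core.norm_b, h.kap_le]
        _ = _ := one_mul _
    rw [e]
    exact (abs_add_le _ _).trans (by linarith)
  rw [abs_le] at *
  constructor <;> linarith

theorem abs_le_three {p s : ℝ} (hp : (1 + s) * l ≤ p ∧ p ≤ (1 + s) * m) (hs : |s| ≤ 1 / 2) :
    |p| ≤ 3 := by
  have hl := abs_le.1 h.abs_l
  have hm := abs_le.1 h.abs_m
  rw [abs_le] at *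
  constructor <;> nlinarith

end Step

/-- Hölder estimate for the renormalization in the two-phase case. -/
theorem Start.holder_renorm (h : Start v α β ε κ K₁ s₀ τ N M a b) (hβ : 0 < β) (ha : ‖a‖ ≤ √ε)
    (hb : ‖b - inner ℝ b (eLast d) • eLast d‖ ≤ √ε) (hM : ‖M‖ ≤ √ε) {x y : Eu d}
    (hx : ‖x‖ ≤ 1 / 2) (hy : ‖y‖ ≤ 1 / 2) (hxy : √(ε / τ) ≤ ‖x - y‖) :
    |renorm v α β M a b ε x - renorm v α β M a b ε y|
      ≤ holderC d K₁ N * ‖x - y‖ ^ holderExp d K₁ N := by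
  have hren : ∀ z : Eu d, ‖z‖ ≤ 1 / 2 → (z ∈ posPhase v ∪ freeBdry v ∧ renorm v α β M a b ε z
      = (v z - α * (1 + inner ℝ a z) * polyP M (eLast d) z) / (α * ε)) ∨
      (v z ≤ 0 ∧ renorm v α β M a b ε z
      = (v z - β * (1 + inner ℝ b z) * polyP M (eLast d) z) / (β * ε)) := by
    intro z hz
    have hz1 : z ∈ ball (0 : Eu d) 1 := by rw [mem_ball_zero_iff]; linarith
    by_cases h1 : z ∈ posPhase v ∪ freeBdry v
    · exact Or.inl ⟨h1, by rw [renorm, if_pos h1]⟩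
    · right
      have h2 : v z ≤ 0 := by
        by_contra h3
        exact h1 (Or.inl ⟨hz1, not_le.1 h3⟩)
      have h3 : z ∈ negPhase v := by
        rcases mem_negPhase_or_mem_freeBdry hz1 h2 with h4 | h4
        · exact h4
        · exact absurd (Or.inr h4) h1
      exact ⟨h2, by rw [renorm, if_neg h1, if_pos ⟨h3, hβ⟩]⟩
  refine h.holder (S := Set.univ) (fun x _ y _ hx hy r l m hS hxy => ?_) (fun x _ hx => ?_)
    trivial trivial hx hy hxy
  · have hxr : x ∈ ball x r := mem_ball_self hS.r_pos
    have hyr : y ∈ ball x r := hxy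
    rcases hren x hx with ⟨hx1, hx2⟩ | ⟨hx1, hx2⟩ <;> rcases hren y hy with ⟨hy1, hy2⟩ | ⟨hy1, hy2⟩ <;>
      rw [hx2, hy2]
    · exact hS.abs_sub_le_of_weights (hS.renorm_pos hxr hx1) (hS.renorm_pos hyr hy1)
        (hS.norm_bound h.core.norm_a hx) (hS.norm_bound h.core.norm_a hy)
        (hS.abs_inner_sub_le h.core.norm_a hxy)
    · exact hS.abs_sub_le_of_weights (hS.renorm_pos hxr hx1) (hS.renorm_neg hβ hyr hy1)
        (hS.norm_bound h.core.norm_a hx) (hS.norm_bound h.core.norm_b hy)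
        (hS.abs_inner_sub_le_of_cross ha hb hM hx hy hxr hxy (hS.level_of_mem hxr hx1)
          (hS.level_of_nonpos hyr hy1))
    · rw [abs_sub_comm]
      exact hS.abs_sub_le_of_weights (hS.renorm_pos hyr hy1) (hS.renorm_neg hβ hxr hx1)
        (hS.norm_bound h.core.norm_a hy) (hS.norm_bound h.core.norm_b hx)
        (hS.abs_inner_sub_le_of_cross ha hb hM hy hx hyr (by rwa [dist_comm])
          (hS.level_of_mem hyr hy1) (hS.level_of_nonpos hxr hx1))
    · exact hS.abs_sub_le_of_weights (hS.renorm_neg hβ hxr hx1) (hS.renorm_neg hβ hyr hy1)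
        (hS.norm_bound h.core.norm_b hx) (hS.norm_bound h.core.norm_b hy)
        (hS.abs_inner_sub_le h.core.norm_b hxy)
  · have hS := h.step_zero hx
    have hxr : x ∈ ball x (1 / 8) := mem_ball_self hS.r_pos
    have hx1 : x ∈ ball (0 : Eu d) 1 := by rw [mem_ball_zero_iff]; linarith
    have hκ := hS.kap_le
    rcases hren x hx with ⟨h1, h2⟩ | ⟨h1, h2⟩ <;> rw [h2]
    · exact hS.abs_le_three (hS.renorm_pos hxr h1)
        ((abs_inner_le_of_mem_ball h.core.norm_a hx1).trans (by linarith))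
    · exact hS.abs_le_three (hS.renorm_neg hβ hxr h1)
        ((abs_inner_le_of_mem_ball h.core.norm_b hx1).trans (by linarith))

/-- Hölder estimate for the renormalization in the positive phase. -/
theorem Start.holder_renorm_pos (h : Start v α β ε κ K₁ s₀ τ N M a b) {x y : Eu d}
    (hxS : x ∈ posPhase v ∪ freeBdry v) (hyS : y ∈ posPhase v ∪ freeBdry v)
    (hx : ‖x‖ ≤ 1 / 2) (hy : ‖y‖ ≤ 1 / 2) (hxy : √(ε / τ) ≤ ‖x - y‖) :
    |renorm v α β M a b ε x - renorm v α β M a b ε y|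
      ≤ holderC d K₁ N * ‖x - y‖ ^ holderExp d K₁ N := by
  refine h.holder (S := posPhase v ∪ freeBdry v) (fun x hx1 y hy1 hx hy r l m hS hxy => ?_)
    (fun x hx1 hx => ?_) hxS hyS hx hy hxy
  · rw [renorm, if_pos hx1, renorm, if_pos hy1]
    exact hS.abs_sub_le_of_weights (hS.renorm_pos (mem_ball_self hS.r_pos) hx1)
      (hS.renorm_pos hxy hy1)
      (hS.norm_bound h.core.norm_a hx) (hS.norm_bound h.core.norm_a hy)
      (hS.abs_inner_sub_le h.core.norm_a hxy)
  · have hS := h.step_zero hx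
    have hb : x ∈ ball (0 : Eu d) 1 := by rw [mem_ball_zero_iff]; linarith
    rw [renorm, if_pos hx1]
    exact hS.abs_le_three (hS.renorm_pos (mem_ball_self hS.r_pos) hx1)
      ((abs_inner_le_of_mem_ball h.core.norm_a hb).trans (by linarith [hS.kap_le]))

end Renorm


/-- The universal parameters used for both cases. -/
structure Params (d : ℕ) (L K B K' K₁ s₀ κ δ τ : ℝ) (N : ℕ) : Prop where
  small : Small d κ K₁ s₀ τ N
  kap_pos : 0 < κ
  kap_decay : 24 * κ ≤ decayC d N
  L_nonneg : 0 ≤ L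
  B_eq : B = L + 1
  K_le : K ≤ K'
  one_le_K' : 1 ≤ K'
  K₁_eq : K₁ = 2 * (2 * (K' * B) + K' * B ^ 2) + 1
  s₀_eq : s₀ * (8 * B) = 1
  kap_B : κ * (100 * B) ≤ 1
  del_pos : 0 < δ
  del_eq : δ * (416 * (K' * B ^ 2)) = κ ^ 2

namespace Params

variable {d : ℕ} {L K B K' K₁ s₀ κ δ τ : ℝ} {N : ℕ} (hp : Params d L K B K' K₁ s₀ κ δ τ N)
include hp

theorem one_le_B : 1 ≤ B := by rw [hp.B_eq]; linarith [hp.L_nonneg]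

theorem kap_le : κ ≤ 1 / 100 := by
  have h1 := hp.kap_B; have h2 := hp.one_le_B; have h3 := hp.kap_pos; nlinarith

theorem del_le : δ ≤ κ ^ 2 / 416 := by
  have h1 := hp.del_eq
  have h2 : 1 ≤ K' * B ^ 2 := by
    have := hp.one_le_B; have := hp.one_le_K'
    nlinarith [one_le_pow₀ (n := 2) this]
  have h3 := mul_le_mul_of_nonneg_left h2 hp.del_pos.le
  linarith

theorem del_le_kap : 40000 * δ ≤ κ := by
  have h1 := hp.del_le; have h2 := hp.kap_le; have h3 := hp.kap_pos; nlinarith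

theorem s₀_pos : 0 < s₀ := by
  have h1 := hp.s₀_eq; have h2 := hp.one_le_B
  by_contra h
  nlinarith [not_lt.1 h]

theorem s₀_le : s₀ ≤ 1 / 8 := by
  have h1 := hp.s₀_eq; have h2 := hp.one_le_B; have h3 := hp.s₀_pos; nlinarith

end Params

/-! ### Linearization of the free boundary condition. -/

section Scalar

/-- Square of the relative change of slope. -/
theorem sq_deviation_le {σ β B t s δ e ε : ℝ} (hσ : σ = 1 ∨ σ = -1) (hβ : 0 ≤ β) (hβB : β ≤ B)
    (ht : |t| ≤ 7 * δ * e) (ht8 : |t| ≤ 1 / 8) (he : e ^ 2 = ε) (hs : 0 ≤ s)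
    (hs8 : s ≤ 1 / 8) :
    (β * (1 + t) * (1 + σ * s) - β) ^ 2 ≤ B ^ 2 * (98 * δ ^ 2 * ε + s) := by
  have hσσ : σ * σ = 1 := by rcases hσ with rfl | rfl <;> norm_num
  have ht2 : t ^ 2 ≤ 49 * δ ^ 2 * ε := by
    rw [← he, ← sq_abs]
    calc |t| ^ 2 ≤ (7 * δ * e) ^ 2 := by gcongr
      _ = _ := by ring
  have e1 : (β * (1 + t) * (1 + σ * s) - β) ^ 2 = β ^ 2 * (t + σ * s * (1 + t)) ^ 2 := by ring
  have e2 : (t + σ * s * (1 + t)) ^ 2 ≤ 2 * t ^ 2 + s := by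
    have h1 : (t + σ * s * (1 + t)) ^ 2 ≤ 2 * t ^ 2 + 2 * (σ * s * (1 + t)) ^ 2 := by
      nlinarith [sq_nonneg (t - σ * s * (1 + t))]
    have h2 : (σ * s * (1 + t)) ^ 2 = s * (s * (1 + t) ^ 2) := by
      linear_combination (s ^ 2 * (1 + t) ^ 2) * hσσ
    have h3 : (1 + t) ^ 2 ≤ 2 := by
      have := abs_le.1 ht8; nlinarith
    have h4 : s * (1 + t) ^ 2 ≤ 1 / 8 * 2 := by gcongr
    have h5 : s * (s * (1 + t) ^ 2) ≤ s * (1 / 8 * 2) := by gcongr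
    linarith
  rw [e1]
  have h0 : 0 ≤ 2 * t ^ 2 + s := by positivity
  calc β ^ 2 * (t + σ * s * (1 + t)) ^ 2 ≤ B ^ 2 * (2 * t ^ 2 + s) := by gcongr
    _ ≤ _ := mul_le_mul_of_nonneg_left (by linarith) (by positivity)

/-- Comparison of the slope given by the free boundary condition with that of the profile. -/
theorem slope_compare {d : ℕ} {L K B K' K₁ s₀ κ δ τ : ℝ} {N : ℕ}
    (hp : Params d L K B K' K₁ s₀ κ δ τ N)
    {σ α β ε Gy Gp R t A s xa xb e : ℝ} (hσ : σ = 1 ∨ σ = -1) (hε : 0 < ε) (he : e ^ 2 = ε)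
    (he0 : 0 ≤ e) (he1 : e ≤ 1)
    (hG : Gy = α + Gp * (β * (1 + t) * (1 + σ * s) - β) + R)
    (hA : α * A = α * xa + β * Gp * (t - xb))
    (hR : |R| ≤ K' * (β * (1 + t) * (1 + σ * s) - β) ^ 2) (hGp : |Gp| ≤ K') (hβ : 0 ≤ β)
    (hβB : β ≤ B) (hα : 1 ≤ α) (ht : |t| ≤ 7 * δ * e) (hxa : |xa| ≤ 6 * δ * ε)
    (hxb : |xb| ≤ 6 * δ ^ 2 * ε) (hA2 : |A| ≤ 1 / 2) (hs : 0 ≤ s) (hs0 : s ≤ s₀) :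
    σ * (Gy - α * (1 + A) * (1 + σ * (K₁ * s + κ * ε))) ≤ 0 := by
  have hσσ : σ * σ = 1 := by rcases hσ with rfl | rfl <;> norm_num
  have hσa : |σ| = 1 := by rcases hσ with rfl | rfl <;> simp
  have hδ := hp.del_pos
  have hκ := hp.kap_pos
  have hκ1 := hp.kap_le
  have hδκ := hp.del_le_kap
  have hB := hp.one_le_B
  have hK := hp.one_le_K'
  have hs8 : s ≤ 1 / 8 := hs0.trans hp.s₀_le
  have ht8 : |t| ≤ 1 / 8 := by
    have : 7 * δ * e ≤ 7 * δ * 1 := by gcongr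
    linarith
  have hsq := sq_deviation_le hσ hβ hβB ht ht8 he hs hs8
  have hR2 : σ * R ≤ K' * B ^ 2 * (98 * δ ^ 2 * ε + s) := by
    calc σ * R ≤ |σ * R| := le_abs_self _
      _ = |R| := by rw [abs_mul, hσa, one_mul]
      _ ≤ K' * (B ^ 2 * (98 * δ ^ 2 * ε + s)) := hR.trans (by gcongr)
      _ = _ := by ring
  have ht1 : |1 + t| ≤ 2 := by
    have := abs_le.1 ht8
    exact abs_le.2 ⟨by linarith, by linarith⟩
  have h1 : Gp * β * s * (1 + t) ≤ 2 * (K' * B) * s := by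
    calc Gp * β * s * (1 + t) ≤ |Gp * β * s * (1 + t)| := le_abs_self _
      _ = |Gp| * β * s * |1 + t| := by
          rw [abs_mul, abs_mul, abs_mul, abs_of_nonneg hβ, abs_of_nonneg hs]
      _ ≤ K' * B * s * 2 := by gcongr
      _ = _ := by ring
  have h2 : -(σ * (α * xa)) ≤ α * (6 * δ * ε) := by
    calc -(σ * (α * xa)) ≤ |σ * (α * xa)| := neg_le_abs _
      _ = α * |xa| := by rw [abs_mul, hσa, one_mul, abs_mul, abs_of_nonneg (by linarith)]
      _ ≤ _ := by gcongr
  have h3 : σ * (β * Gp * xb) ≤ K' * B ^ 2 * (6 * δ ^ 2 * ε) := by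
    calc σ * (β * Gp * xb) ≤ |σ * (β * Gp * xb)| := le_abs_self _
      _ = β * |Gp| * |xb| := by
          rw [abs_mul, hσa, one_mul, abs_mul, abs_mul, abs_of_nonneg hβ]
      _ ≤ B * K' * (6 * δ ^ 2 * ε) := by gcongr
      _ = K' * B * (6 * δ ^ 2 * ε) := by ring
      _ ≤ K' * B ^ 2 * (6 * δ ^ 2 * ε) := by
          have : B ≤ B ^ 2 := le_self_pow₀ hB two_ne_zero
          gcongr
  have hK₁ : 0 ≤ K₁ := by linarith [hp.small.one_le_K]
  -- The weight `1 + A ≥ 1/2` accounts for the outer factor `2` in the definition of `K₁`.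
  have h4 : α * (1 / 2) * (K₁ * s + κ * ε) ≤ α * (1 + A) * (K₁ * s + κ * ε) := by
    gcongr; linarith [(abs_le.1 hA2).1]
  have h5 : 1 * (1 / 2) * (K₁ * s) ≤ α * (1 / 2) * (K₁ * s) := by gcongr
  -- `104 = 98 + 6` collects the `δ²ε` terms of the Taylor remainder and of `xb`; `δ` was fixed with
  -- `416 = 4 · 104`.
  have h6 : K' * B ^ 2 * (104 * δ ^ 2 * ε) ≤ α * (κ * ε / 4) := by
    have e1 : K' * B ^ 2 * (104 * δ ^ 2 * ε) = κ * (δ * κ) * ε / 4 := by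
      linear_combination (δ * ε / 4) * hp.del_eq
    rw [e1]
    have : κ * (δ * κ) ≤ κ * 1 := by gcongr; nlinarith
    calc κ * (δ * κ) * ε / 4 ≤ 1 * (κ * 1 * ε / 4) := by rw [one_mul]; gcongr
      _ ≤ α * (κ * 1 * ε / 4) := by gcongr
      _ = _ := by ring
  have h7 : α * (6 * δ * ε) ≤ α * (κ * ε / 4) := by
    have : 6 * δ ≤ κ / 4 := by linarith
    calc α * (6 * δ * ε) ≤ α * (κ / 4 * ε) := by gcongr
      _ = _ := by ring
  -- By `hA`, the first order term `Gp β t` of `G` cancels against `αA`, up to the normal parts `xa`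
  -- and `xb`. Without this cancellation an error of order `√ε` would remain.
  have e3 : σ * (Gy - α * (1 + A) * (1 + σ * (K₁ * s + κ * ε)))
      = Gp * β * s * (1 + t) + σ * R - σ * (α * xa) + σ * (β * Gp * xb)
        - α * (1 + A) * (K₁ * s + κ * ε) := by
    rw [hG]
    linear_combination (-σ) * hA
      + (Gp * β * s * (1 + t) - α * (1 + A) * (K₁ * s + κ * ε)) * hσσ
  rw [e3]
  rw [hp.K₁_eq] at h4 h5
  rw [hp.K₁_eq]
  linear_combination h1 + hR2 + h2 + h3 + h4 + h5 + h6 + h7 + (1 / 2) * hs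

/-- First-order Taylor estimate for `G`. -/
theorem AdmissibleG.taylor {L K K' : ℝ} {G : ℝ → ℝ} (h : AdmissibleG L K G) (hK : K ≤ K')
    {s t : ℝ} (hs : s ∈ Set.Icc 0 (L + 1)) (ht : t ∈ Set.Icc 0 (L + 1)) :
    |G t - G s - derivG G s * (t - s)| ≤ K' * (t - s) ^ 2 := by
  have hsub : Set.Icc 0 (L + 1) ⊆ Set.Ici (0 : ℝ) := Set.Icc_subset_Ici_self
  have hG1 : ∀ x ∈ Set.Icc 0 (L + 1), HasDerivWithinAt G (derivG G x) (Set.Icc 0 (L + 1)) x :=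
    fun x hx => ((h.contDiffOn.differentiableOn (by norm_num) x (hsub hx)).hasDerivWithinAt).mono hsub
  have hd : ContDiffOn ℝ 1 (derivG G) (Set.Ici 0) :=
    h.contDiffOn.derivWithin (uniqueDiffOn_Ici 0) (by norm_num)
  have hG2 : ∀ x ∈ Set.Icc 0 (L + 1), HasDerivWithinAt (derivG G)
      (iteratedDerivWithin 2 G (Set.Ici 0) x) (Set.Icc 0 (L + 1)) x := fun x hx => by
    have h1 := (hd.differentiableOn (by norm_num) x (hsub hx)).hasDerivWithinAt.mono hsub
    have e : iteratedDerivWithin 2 G (Set.Ici 0) = derivWithin (derivG G) (Set.Ici 0) := by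
      rw [show (2 : ℕ) = 1 + 1 from rfl, iteratedDerivWithin_succ, iteratedDerivWithin_one]
      rfl
    rw [e]; exact h1
  have hdG : ∀ x ∈ Set.Icc 0 (L + 1), |derivG G x - derivG G s| ≤ K' * |x - s| := fun x hx =>
    (convex_Icc 0 (L + 1)).norm_image_sub_le_of_norm_hasDerivWithin_le hG2
      (fun y hy => ((h.bound y hy).2.2).trans hK) hs hx
  have hconv : Convex ℝ (Set.uIcc s t) := convex_uIcc s t
  have hsubu : Set.uIcc s t ⊆ Set.Icc 0 (L + 1) := Set.ordConnected_Icc.uIcc_subset hs ht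
  have hK0 : 0 ≤ K' := ((abs_nonneg _).trans (h.bound s hs).1).trans hK
  have key := hconv.norm_image_sub_le_of_norm_hasDerivWithin_le
    (f := fun x => G x - derivG G s * x) (f' := fun x => derivG G x - derivG G s)
    (C := K' * |t - s|) (x := s) (y := t) (fun x hx => by
      have h1 := ((hG1 x (hsubu hx)).mono hsubu).fun_sub
        (((hasDerivWithinAt_id x (Set.uIcc s t))).const_mul (derivG G s))
      simpa using h1) (fun x hx => (hdG x (hsubu hx)).trans (by
        have := Set.abs_sub_left_of_mem_uIcc hx
        gcongr)) Set.left_mem_uIcc Set.right_mem_uIcc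
  rw [Real.norm_eq_abs, Real.norm_eq_abs] at key
  have e1 : G t - derivG G s * t - (G s - derivG G s * s) = G t - G s - derivG G s * (t - s) := by
    ring
  rw [e1] at key
  refine key.trans (le_of_eq ?_)
  rw [mul_assoc, abs_mul_abs_self]; ring

end Scalar


/-! ### Both cases satisfy the common hypotheses. -/

section Instances

variable {d : ℕ} {γ : ℝ} {L : NNReal} {Λ K β₁ ε δ : ℝ} {G : ℝ → ℝ} {fp fm u : Eu d → ℝ} {α β : ℝ}
  {M : Eu d →L[ℝ] Eu d} {a b : Eu d} {B K' K₁ s₀ κ τ : ℝ} {N : ℕ}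

/-- Bounds on the coefficients of the profile, common to both cases. -/
theorem FlatB1.coeff {v : Eu d → ℝ} (h : FlatB1 v α β M (eLast d) a b ε δ) (hδ : 0 < δ)
    (hδκ : 40000 * δ ≤ κ) (hκ : κ ≤ 1 / 100) (hε : 0 < ε) (hε1 : ε ≤ 1) :
    ‖a‖ ≤ κ ∧ ‖b‖ ≤ κ ∧ ‖M‖ ≤ κ ∧ ‖a‖ * ‖M‖ ≤ κ * ε ∧ ‖b‖ * ‖M‖ ≤ κ * ε ∧ ‖M‖ ^ 2 ≤ κ * ε := by
  have hs : √ε ≤ 1 := Real.sqrt_le_one.2 hε1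
  have hss : √ε * √ε = ε := Real.mul_self_sqrt hε.le
  have hs0 : 0 ≤ √ε := Real.sqrt_nonneg _
  have hδs : δ * √ε ≤ δ * 1 := by gcongr
  have hδ2 : δ ^ 2 ≤ δ := by nlinarith
  have hb : ‖b‖ ≤ δ * √ε + |inner ℝ b (eLast d)| := by
    have e : b = (b - inner ℝ b (eLast d) • eLast d) + inner ℝ b (eLast d) • eLast d := by abel
    calc ‖b‖ = ‖(b - inner ℝ b (eLast d) • eLast d) + inner ℝ b (eLast d) • eLast d‖ := by
          rw [← e]
      _ ≤ _ := by
          refine (norm_add_le _ _).trans ?_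
          rw [norm_smul, norm_eLast, mul_one, Real.norm_eq_abs]
          have := h.norm_b'
          linarith
  have hprod : (δ * √ε) * (δ * √ε) = δ ^ 2 * ε := by
    linear_combination δ ^ 2 * hss
  have hδε : δ ^ 2 * ε ≤ δ * ε := by gcongr
  have hδκε : δ * ε ≤ κ / 2 * ε := by gcongr; linarith
  have hκε : 0 < κ * ε := mul_pos (by linarith) hε
  refine ⟨by linarith [h.norm_a], by linarith [h.abs_bn], by linarith [h.norm_M], ?_, ?_, ?_⟩
  · calc ‖a‖ * ‖M‖ ≤ (δ * √ε) * (δ * √ε) :=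
          mul_le_mul h.norm_a h.norm_M (norm_nonneg _) (by positivity)
      _ ≤ κ * ε := by linarith
  · calc ‖b‖ * ‖M‖ ≤ (δ * √ε + |inner ℝ b (eLast d)|) * ‖M‖ := by gcongr
      _ = (δ * √ε) * ‖M‖ + |inner ℝ b (eLast d)| * ‖M‖ := by ring
      _ ≤ (δ * √ε) * (δ * √ε) + δ ^ 2 * ε :=
          add_le_add (mul_le_mul_of_nonneg_left h.norm_M (by positivity)) h.abs_bn_mul
      _ ≤ κ * ε := by linarith
  · calc ‖M‖ ^ 2 ≤ (δ * √ε) ^ 2 := pow_le_pow_left₀ (norm_nonneg _) h.norm_M 2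
      _ ≤ κ * ε := by rw [pow_two]; linarith

/-- Splitting off the last coordinate: `a·x = a·(x - x_n e_n) + x_n a_n`. -/
theorem inner_eq_add (A x : Eu d) : inner ℝ A x
    = inner ℝ A (x - inner ℝ x (eLast d) • eLast d)
      + inner ℝ x (eLast d) * inner ℝ A (eLast d) := by
  rw [inner_sub_right, inner_smul_right]; ring

/-- Height of points close to the zero level of `polyP`. -/
theorem abs_last_le {x : Eu d} (hx : ‖x‖ ≤ 1) (hP : |polyP M (eLast d) x| ≤ 5 * ε) :
    |inner ℝ x (eLast d)| ≤ 5 * ε + ‖M‖ / 2 := by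
  have e : inner ℝ x (eLast d) = polyP M (eLast d) x + 1 / 2 * inner ℝ x (M x) := by
    rw [polyP]; ring
  have h1 : |inner ℝ x (M x)| ≤ ‖M‖ := by
    calc _ ≤ ‖x‖ * ‖M x‖ := abs_real_inner_le_norm _ _
      _ ≤ ‖x‖ * (‖M‖ * ‖x‖) := by gcongr; exact M.le_opNorm x
      _ ≤ 1 * (‖M‖ * 1) := by gcongr
      _ = ‖M‖ := by ring
  rw [e]
  rw [abs_le] at *
  constructor <;> linarith

/-- The products `x_n a_n` and `x_n b_n` are of order `ε` near the free boundary. -/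
theorem FlatB1.abs_last_mul_le {v : Eu d → ℝ} (h : FlatB1 v α β M (eLast d) a b ε δ) (hδ : 0 < δ)
    (hδ1 : δ ≤ 1) (hε : 0 < ε) (hε1 : ε ≤ 1) {x : Eu d} (hx : ‖x‖ ≤ 1)
    (hP : |polyP M (eLast d) x| ≤ 5 * ε) :
    |inner ℝ x (eLast d) * inner ℝ a (eLast d)| ≤ 6 * δ * ε ∧
    |inner ℝ x (eLast d) * inner ℝ b (eLast d)| ≤ 6 * δ ^ 2 * ε ∧
    |inner ℝ b x| ≤ 7 * δ * √ε := by
  have hs : √ε ≤ 1 := Real.sqrt_le_one.2 hε1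
  have hss : √ε * √ε = ε := Real.mul_self_sqrt hε.le
  have hs0 : 0 ≤ √ε := Real.sqrt_nonneg _
  have hεs : ε ≤ √ε := by nlinarith
  have hn := abs_last_le (M := M) hx hP
  have hM := h.norm_M
  have hn6 : |inner ℝ x (eLast d)| ≤ 6 * √ε := by
    have : δ * √ε ≤ 1 * √ε := by gcongr
    linarith
  have h2 : |inner ℝ x (eLast d) * inner ℝ b (eLast d)| ≤ 6 * δ ^ 2 * ε := by
    rw [abs_mul]
    calc |inner ℝ x (eLast d)| * |inner ℝ b (eLast d)|
        ≤ (5 * ε + ‖M‖ / 2) * |inner ℝ b (eLast d)| := by gcongr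
      _ = 5 * ε * |inner ℝ b (eLast d)| + |inner ℝ b (eLast d)| * ‖M‖ / 2 := by ring
      _ ≤ 5 * ε * δ ^ 2 + δ ^ 2 * ε / 2 := by
          have := h.abs_bn
          have := h.abs_bn_mul
          gcongr
      _ ≤ _ := by nlinarith [mul_pos (pow_pos hδ 2) hε]
  refine ⟨?_, h2, ?_⟩
  · rw [abs_mul]
    have h1 := abs_real_inner_le_norm a (eLast d)
    rw [norm_eLast, mul_one] at h1
    calc _ ≤ (6 * √ε) * (δ * √ε) :=
          mul_le_mul hn6 (h1.trans h.norm_a) (abs_nonneg _) (by positivity)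
      _ = 6 * δ * ε := by linear_combination 6 * δ * hss
  · have h3 : |inner ℝ (b - inner ℝ b (eLast d) • eLast d) x| ≤ δ * √ε := by
      calc _ ≤ ‖b - inner ℝ b (eLast d) • eLast d‖ * ‖x‖ := abs_real_inner_le_norm _ _
        _ ≤ (δ * √ε) * 1 := mul_le_mul h.norm_b' hx (norm_nonneg _) (by positivity)
        _ = _ := mul_one _
    have e : inner ℝ b x = inner ℝ (b - inner ℝ b (eLast d) • eLast d) x
        + inner ℝ x (eLast d) * inner ℝ b (eLast d) := by
      rw [inner_sub_left, inner_smul_left, real_inner_comm x (eLast d)]; simp; ring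
    have h4 : δ ^ 2 * ε ≤ δ * √ε := by
      have : δ ^ 2 ≤ δ := by nlinarith
      gcongr
    rw [e]
    exact (abs_add_le _ _).trans (by linarith)

/-- The slope of the negative phase is at most slightly larger than the Lipschitz constant. -/
theorem TwoPhaseCase.beta_le_add (h : TwoPhaseCase γ L Λ K β₁ ε δ G fp fm u α β M a b)
    (hp : Params d L K B K' K₁ s₀ κ δ τ N) (hε : 0 < ε) (hεB : ε * (100 * B) ≤ 1) :
    β ≤ L + 1 / 4 := by
  have hB := hp.one_le_B
  have hκ := hp.kap_le
  have hκ0 := hp.kap_pos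
  have hε1 : ε ≤ 1 / 100 := by nlinarith
  have hc := h.flat.coeff hp.del_pos hp.del_le_kap hp.kap_le hε (by linarith)
  have hβ := h.beta_pos
  -- At `-eₙ/2` the Lipschitz bound gives `u ≥ -L/2`, while flatness puts `u` below roughly `-β/2`.
  -- The resulting bound on `β` keeps the slopes that occur in the range `[0, L + 1]` where `G` is
  -- controlled.
  set y : Eu d := (-(1 / 2) : ℝ) • eLast d with hy
  have hyn : ‖y‖ = 1 / 2 := by rw [hy, norm_smul, norm_eLast]; norm_num
  have hyb : y ∈ ball (0 : Eu d) 1 := by rw [mem_ball_zero_iff, hyn]; norm_num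
  have h0 : u 0 = 0 := eq_zero_of_mem_freeBdry h.lipschitz.continuousOn h.zero_mem
  have h1 : -(L / 2) ≤ u y := by
    have := h.lipschitz.dist_le_mul y hyb 0 (mem_ball_self one_pos)
    rw [dist_zero_right, hyn, Real.dist_eq, h0, sub_zero] at this
    linarith [neg_abs_le (u y)]
  have e : y + ε • eLast d = (0 : Eu d) + (-(1 / 2) + ε) • eLast d := by
    rw [hy, zero_add, add_smul]
  have hP0 : polyP M (eLast d) 0 = 0 := by simp [polyP]
  have h2 := h.flat.upper y hyb
  rw [e, polyV_eq_Psi, polyP_add_smul h.mem_class.symm h.mem_class.map_dir, hP0, zero_add,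
    zero_add, Psi_of_nonpos (by linarith)] at h2
  have h3 : |inner ℝ b ((-(1 / 2) + ε) • eLast d)| ≤ κ := by
    refine abs_inner_le_of_mem_ball hc.2.1 ?_
    rw [mem_ball_zero_iff, norm_smul, norm_eLast, mul_one, Real.norm_eq_abs, abs_lt]
    constructor <;> linarith
  have h4 : β * (1 - κ) * (1 / 2 - ε) ≤ β * (1 + inner ℝ b ((-(1 / 2) + ε) • eLast d)) * (1 / 2 - ε) := by
    have := (abs_le.1 h3).1
    gcongr
    · linarith
    · linarith
  have h5 : β * (1 - κ) * (1 - 2 * ε) ≤ L := by linarith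
  have h6 : κ * B ≤ 1 / 100 := by linarith [hp.kap_B]
  have h7 : ε * B ≤ 1 / 100 := by linarith
  have hBL := hp.B_eq
  have h8 : 1 - κ - 2 * ε ≤ (1 - κ) * (1 - 2 * ε) := by nlinarith
  have h9 : β * (1 - κ - 2 * ε) ≤ L := by
    calc _ ≤ β * ((1 - κ) * (1 - 2 * ε)) := by gcongr
      _ ≤ L := by linarith
  by_contra hcon
  have h10 : (B - 3 / 4) * (1 - κ - 2 * ε) ≤ β * (1 - κ - 2 * ε) := by
    have : B - 3 / 4 ≤ β := by linarith [not_le.1 hcon]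
    gcongr
    linarith
  nlinarith

theorem NegSlope.nonneg {x₀ ν : Eu d} {q : ℝ} (h : NegSlope u x₀ ν q) (h0 : u x₀ = 0) : 0 ≤ q := by
  refine hasDerivWithinAt_le_of_eventually_le (hasDerivWithinAt_const (0 : ℝ) (Set.Ici 0) (0 : ℝ)) h
    (by simp [h0]) (Eventually.of_forall fun t => le_max_right _ _)

/-- The two-phase hypotheses provide a `Core`. -/
theorem TwoPhaseCase.core (h : TwoPhaseCase γ L Λ K β₁ ε δ G fp fm u α β M a b)
    (hp : Params d L K B K' K₁ s₀ κ δ τ N) (hε : 0 < ε) (hεB : ε * (100 * B) ≤ 1) :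
    Core u α β ε κ K₁ s₀ M a b := by
  have hB := hp.one_le_B
  have hκ := hp.kap_le
  have hκ0 := hp.kap_pos
  have hδ := hp.del_pos
  have hδκ := hp.del_le_kap
  have hε1 : ε ≤ 1 / 100 := by nlinarith
  have hβ := h.beta_pos
  have hBL := hp.B_eq
  have hβL := h.beta_le_add hp hε hεB
  have hβm : β ∈ Set.Icc (0 : ℝ) (L + 1) := ⟨hβ.le, by linarith⟩
  have hαG := h.mem_class.eq_slope hβ.ne'
  have hα1 : 1 ≤ α := by
    rw [hαG, ← h.admissible.map_zero]
    exact h.admissible.strictMonoOn.monotoneOn (Set.mem_Ici.2 le_rfl) (Set.mem_Ici.2 hβ.le) hβ.le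
  obtain ⟨c1, c2, c3, c4, c5, c6⟩ := h.flat.coeff hδ hδκ hκ hε (by linarith)
  have hcont := h.lipschitz.continuousOn
  refine ⟨h.mem_class.alpha_pos, hβ.le, hε, hκ0.le, hcont, h.mem_class.symm, h.mem_class.map_dir,
    c1, c2, c3, c4, c5, c6, fun x hx => ?_, fun _ x hx => ?_, fun h0 => absurd h0 hβ.ne', ?_⟩
  · refine ⟨h.solves_pos.1.contDiffAt ((isOpen_posPhase hcont).mem_nhds hx), ?_⟩
    have e : α * (2 * inner ℝ a (eLast d) - opTrace M) = fp 0 := by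
      rw [← h.mem_class.eq_pos]; ring
    rw [h.solves_pos.2 x hx, e]
    calc _ ≤ δ * ε := h.osc_fp x hx.1
      _ ≤ κ * ε := by gcongr; linarith
      _ ≤ α * (κ * ε) := le_mul_of_one_le_left (by positivity) hα1
  · refine ⟨h.solves_neg.1.contDiffAt (isOpen_interior.mem_nhds hx), ?_⟩
    have e : β * (2 * inner ℝ b (eLast d) - opTrace M) = fm 0 := by
      rw [← h.mem_class.eq_neg hβ.ne']; ring
    rw [h.solves_neg.2 x hx, e]
    calc _ ≤ β * δ * ε := h.osc_fm x (interior_subset hx).1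
      _ = β * (δ * ε) := by ring
      _ ≤ β * (κ * ε) := by gcongr; linarith
  · intro σ hσ c ξ N' x₀ hT hpos hneg hP
    have hx₀ : x₀ ∈ freeBdry u ∩ ball 0 (2 / 3) := by
      rcases hσ with rfl | rfl
      · exact (hpos rfl).1
      · exact (hneg rfl).1
    have hx1 : x₀ ∈ ball (0 : Eu d) 1 := hx₀.1.2
    have hxn : ‖x₀‖ ≤ 1 := (mem_ball_zero_iff.1 hx1).le
    have hux : u x₀ = 0 := eq_zero_of_mem_freeBdry hcont hx₀.1
    obtain ⟨p, q, hp1, hq1, hpq⟩ : ∃ p q : ℝ, PosSlope u x₀ (quadNormal ξ N' x₀) p ∧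
        NegSlope u x₀ (quadNormal ξ N' x₀) q ∧ σ * (p - G q) ≤ 0 := by
      rcases hσ with rfl | rfl
      · obtain ⟨p, q, h1, h2, h3⟩ := (h.fb_cond c ξ N' hT x₀).1 (hpos rfl)
        exact ⟨p, q, h1, h2, by linarith⟩
      · obtain ⟨p, q, h1, h2, h3⟩ := (h.fb_cond c ξ N' hT x₀).2 (hneg rfl)
        exact ⟨p, q, h1, h2, by linarith⟩
    refine ⟨p, q, hp1, hq1, fun s hs hs0 hle => ?_⟩
    have hq0 := hq1.nonneg hux
    obtain ⟨hxa, hxb, ht⟩ := h.flat.abs_last_mul_le hδ (by linarith) hε (by linarith) hxn hP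
    have hbx := abs_le.1 (abs_inner_le_of_mem_ball c2 hx1)
    have hs8 := hs0.trans hp.s₀_le
    -- The largest (for `σ = -1`, smallest) negative slope compatible with the premise. Monotonicity
    -- of `G` replaces `q` by it, and it stays within the range of the Taylor estimate.
    set y := β * (1 + inner ℝ b x₀) * (1 + σ * s) with hy
    have hy0 : 0 ≤ y := by
      have h1 : 0 ≤ 1 + inner ℝ b x₀ := by linarith
      have h2 : 0 ≤ 1 + σ * s := by rcases hσ with rfl | rfl <;> linarith
      rw [hy]; positivity
    have hyL : y ≤ L + 1 := by
      have h1 : 1 + σ * s ≤ 1 + s₀ := by rcases hσ with rfl | rfl <;> linarith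
      have h2 : y ≤ (B - 3 / 4) * (1 + κ) * (1 + s₀) := by
        have := hp.s₀_pos
        have h3 : 0 ≤ 1 + inner ℝ b x₀ := by linarith
        calc y ≤ β * (1 + inner ℝ b x₀) * (1 + s₀) := by rw [hy]; gcongr
          _ ≤ _ := by
            have h4 : β ≤ B - 3 / 4 := by linarith
            have h5 : 1 + inner ℝ b x₀ ≤ 1 + κ := by linarith
            gcongr
            linarith
      have h6 := hp.s₀_eq
      have h7 := hp.kap_B
      have h8 := hp.s₀_pos
      have h9 := hp.s₀_le
      have h10 : (B - 3 / 4) * (1 + κ) * (1 + s₀) ≤ B - 3 / 4 + B * κ * (1 + s₀) + B * s₀ := by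
        nlinarith [mul_pos hκ0 h8]
      have h11 : B * κ * (1 + s₀) ≤ 1 / 100 * 2 := by
        have : B * κ ≤ 1 / 100 := by linarith
        gcongr
        linarith
      linarith
    have hGm : σ * (p - G y) ≤ 0 := by
      rcases hσ with rfl | rfl
      · have h1 : G q ≤ G y := h.admissible.strictMonoOn.monotoneOn (Set.mem_Ici.2 hq0)
          (Set.mem_Ici.2 hy0) (by linarith)
        linarith
      · have h1 : G y ≤ G q := h.admissible.strictMonoOn.monotoneOn (Set.mem_Ici.2 hy0)
          (Set.mem_Ici.2 hq0) (by linarith)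
        linarith
    have hRt := h.admissible.taylor hp.K_le hβm ⟨hy0, hyL⟩
    rw [← hαG] at hRt
    have hnx : inner ℝ (x₀ - inner ℝ x₀ (eLast d) • eLast d) (eLast d) = (0 : ℝ) := by
      rw [inner_sub_left, inner_smul_left, inner_eLast_self]; simp
    have htan := h.mem_class.eq_tangential _ hnx
    have hax := inner_eq_add a x₀
    have hbx' := inner_eq_add b x₀
    have key := slope_compare hp (σ := σ) (α := α) (β := β) (ε := ε) (Gy := G y)
      (Gp := derivG G β) (R := G y - α - derivG G β * (y - β)) (t := inner ℝ b x₀)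
      (A := inner ℝ a x₀) (s := s) (xa := inner ℝ x₀ (eLast d) * inner ℝ a (eLast d))
      (xb := inner ℝ x₀ (eLast d) * inner ℝ b (eLast d)) (e := √ε) hσ hε
      (Real.sq_sqrt hε.le) (Real.sqrt_nonneg _) (Real.sqrt_le_one.2 (by linarith))
      (by rw [← hy]; ring)
      (by rw [hax, hbx']; linear_combination htan)
      hRt (((h.admissible.bound β hβm).2.1).trans hp.K_le) hβ.le (by linarith) hα1 ht hxa hxb
      ((abs_inner_le_of_mem_ball c1 hx1).trans (by linarith)) hs hs0
    linarith

theorem posPhase_max : posPhase (fun x => max (u x) 0) = posPhase u := by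
  ext x; simp [posPhase]

theorem freeBdry_max : freeBdry (fun x => max (u x) 0) = freeBdry u := by
  rw [freeBdry, posPhase_max, freeBdry]

/-- The one-phase hypotheses provide a `Core`. -/
theorem OnePhaseCase.core (h : OnePhaseCase γ L Λ K β₁ ε δ G fp u α M a)
    (hp : Params d L K B K' K₁ s₀ κ δ τ N) (hε : 0 < ε) (hε1 : ε ≤ 1) :
    Core (fun x => max (u x) 0) α 0 ε κ K₁ s₀ M a 0 := by
  have hκ := hp.kap_le
  have hκ0 := hp.kap_pos
  have hδ := hp.del_pos
  have hδκ := hp.del_le_kap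
  have hα1 := h.one_le_alpha
  obtain ⟨c1, c2, c3, c4, c5, c6⟩ := h.flat.coeff hδ hδκ hκ hε hε1
  have hcontu := h.lipschitz.continuousOn
  have hcont : ContinuousOn (fun x => max (u x) 0) (ball 0 1) := hcontu.sup continuousOn_const
  refine ⟨h.mem_class.alpha_pos, le_rfl, hε, hκ0.le, hcont, h.mem_class.symm, h.mem_class.map_dir,
    c1, c2, c3, c4, c5, c6, fun x hx => ?_, fun h0 => absurd h0 (lt_irrefl _),
    fun _ x => le_max_right _ _, ?_⟩
  · rw [posPhase_max] at hx
    have hev : (fun x => max (u x) 0) =ᶠ[𝓝 x] u := by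
      filter_upwards [(isOpen_posPhase hcontu).mem_nhds hx] with y hy
      exact max_eq_left hy.2.le
    refine ⟨(h.solves_pos.1.contDiffAt ((isOpen_posPhase hcontu).mem_nhds hx)).congr_of_eventuallyEq
      hev, ?_⟩
    have e : α * (2 * inner ℝ a (eLast d) - opTrace M) = fp 0 := by
      rw [← h.mem_class.eq_pos]; ring
    rw [(InnerProductSpace.laplacian_congr_nhds hev).eq_of_nhds, h.solves_pos.2 x hx, e]
    calc _ ≤ δ * ε := h.osc_fp x hx.1
      _ ≤ κ * ε := by gcongr; linarith
      _ ≤ α * (κ * ε) := le_mul_of_one_le_left (by positivity) hα1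
  · intro σ hσ c ξ N' x₀ hT hpos hneg hP
    have hTP : ∀ {x : Eu d}, TouchesPos (fun x => max (u x) 0) c ξ N' x → TouchesPos u c ξ N' x := by
      intro x hx
      refine ⟨by rw [← freeBdry_max]; exact hx.1, hx.2.1, fun y hy hlt => ?_⟩
      simpa using hx.2.2 y hy hlt
    have hTN : ∀ {x : Eu d}, TouchesNeg (fun x => max (u x) 0) c ξ N' x → TouchesNeg u c ξ N' x := by
      intro x hx
      refine ⟨by rw [← freeBdry_max]; exact hx.1, hx.2.1, fun y hy hlt => hx.2.2 y hy ?_⟩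
      simpa using hlt
    have hx₀ : x₀ ∈ freeBdry u ∩ ball 0 (2 / 3) := by
      rcases hσ with rfl | rfl
      · exact (hTP (hpos rfl)).1
      · exact (hTN (hneg rfl)).1
    have hx1 : x₀ ∈ ball (0 : Eu d) 1 := hx₀.1.2
    have hxn : ‖x₀‖ ≤ 1 := (mem_ball_zero_iff.1 hx1).le
    obtain ⟨p, hp1, hpα⟩ : ∃ p : ℝ, PosSlope u x₀ (quadNormal ξ N' x₀) p ∧
        σ * (p - α) ≤ √δ * ε := by
      rcases hσ with rfl | rfl
      · obtain ⟨p, h1, h2⟩ := (h.fb_cond c ξ N' hT x₀).1 (hTP (hpos rfl))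
        exact ⟨p, h1, by linarith⟩
      · obtain ⟨p, h1, h2⟩ := (h.fb_cond c ξ N' hT x₀).2 (hTN (hneg rfl))
        exact ⟨p, h1, by linarith⟩
    -- The positive part has zero slope on the negative side, and with `β = 0` the premise on `q`
    -- holds automatically.
    refine ⟨p, 0, ?_, ?_, fun s hs _ _ => ?_⟩
    · unfold PosSlope at hp1 ⊢
      simpa using hp1
    · unfold NegSlope
      have e : (fun t : ℝ => max (-max (u (x₀ - t • quadNormal ξ N' x₀)) 0) 0) = fun _ => (0 : ℝ) := by
        funext t
        exact max_eq_right (by linarith [le_max_right (u (x₀ - t • quadNormal ξ N' x₀)) 0])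
      rw [e]
      exact hasDerivWithinAt_const _ _ _
    · obtain ⟨hxa, -, -⟩ := h.flat.abs_last_mul_le hδ (by linarith) hε hε1 hxn hP
      have hnx : inner ℝ (x₀ - inner ℝ x₀ (eLast d) • eLast d) (eLast d) = (0 : ℝ) := by
        rw [inner_sub_left, inner_smul_left, inner_eLast_self]; simp
      have htan := h.mem_class.eq_tangential _ hnx
      have hax := inner_eq_add a x₀
      -- For `β = 0` the compatibility condition says that `a` has no tangential component, so
      -- `a·x₀` is of order `δε` near the free boundary.
      have ha0 : inner ℝ a (x₀ - inner ℝ x₀ (eLast d) • eLast d) = (0 : ℝ) := by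
        rw [zero_mul, zero_mul] at htan
        exact (mul_eq_zero.1 htan).resolve_left (by linarith)
      rw [ha0, zero_add] at hax
      rw [← hax] at hxa
      have hsδ : √δ ≤ κ / 8 := by
        refine Real.sqrt_le_iff.2 ⟨by positivity, ?_⟩
        have := hp.del_le
        nlinarith [sq_nonneg κ]
      have hσa : |σ| = 1 := by rcases hσ with rfl | rfl <;> simp
      have hσσ : σ * σ = 1 := by rcases hσ with rfl | rfl <;> norm_num
      have h1 : -(σ * (α * inner ℝ a x₀)) ≤ α * (6 * δ * ε) := by
        calc _ ≤ |σ * (α * inner ℝ a x₀)| := neg_le_abs _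
          _ = α * |inner ℝ a x₀| := by
            rw [abs_mul, hσa, one_mul, abs_mul, abs_of_nonneg (by linarith)]
          _ ≤ _ := by gcongr
      have h2 : α * (6 * δ * ε) ≤ α * (κ / 8 * ε) := by gcongr; linarith
      have h3 : √δ * ε ≤ α * (κ / 8 * ε) := by
        calc √δ * ε ≤ κ / 8 * ε := by gcongr
          _ ≤ _ := le_mul_of_one_le_left (by positivity) hα1
      have hA := (abs_le.1 (abs_inner_le_of_mem_ball c1 hx1)).1
      have hK₁ : 0 ≤ K₁ := by linarith [hp.small.one_le_K]
      have h4 : α * (1 / 2) * (κ * ε) ≤ α * (1 + inner ℝ a x₀) * (K₁ * s + κ * ε) := by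
        have h5 : 0 ≤ κ * ε := by positivity
        have h6 : α * (1 / 2) ≤ α * (1 + inner ℝ a x₀) := by gcongr; linarith
        have h7 : 0 ≤ α * (1 / 2) := by positivity
        exact mul_le_mul h6 (by linarith [mul_nonneg hK₁ hs]) h5 (h7.trans h6)
      have hκε : 0 ≤ α * (κ * ε) := by positivity
      linear_combination hpα + h1 + h2 + h3 + h4 + (1 / 4) * hκε
        + (-α * (1 + inner ℝ a x₀) * (K₁ * s + κ * ε)) * hσσ

end Instances


/-! ### Choice of the universal constants and conclusion. -/

theorem exists_params (d : ℕ) {L : ℝ} (hL : 0 ≤ L) (K : ℝ) :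
    ∃ (B K' K₁ s₀ κ δ τ : ℝ) (N : ℕ), Params d L K B K' K₁ s₀ κ δ τ N := by
  set B := L + 1 with hB
  set K' := max K 1 with hK'
  have hB1 : 1 ≤ B := by linarith
  have hK1 : 1 ≤ K' := le_max_right _ _
  set K₁ := 2 * (2 * (K' * B) + K' * B ^ 2) + 1 with hK₁
  have hK₁1 : 1 ≤ K₁ := by
    have : 0 ≤ 2 * (K' * B) + K' * B ^ 2 := by positivity
    linarith
  have hT := bTop_pos (d := d) hK₁1
  have hν := bν_pos (d := d) hK₁1
  -- The order of choice matters: `K₁` from `L` and `K`, then the barrier constants, then the length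
  -- `N` of the Harnack chain with its gain and decay, then `κ`, and finally `δ` in terms of `κ`;
  -- `τ` needs only the barrier constants and `s₀`.
  set N := ⌈32 / bTop d K₁⌉₊ with hN
  have hg := gainC_pos (d := d) (N := N)
  have hη := decayC_pos (d := d) (N := N)
  have hbB := one_le_bB (d := d)
  have hbA := eight_le_bA hK₁1
  set X := ((d : ℝ) + 1 + 2) * (bA K₁ + 2 * bB d) + 8 with hX
  have hX0 : 0 < X := by positivity
  set κ := min (bν d K₁) (min (1 / (4 * X)) (min (gainC d N / (15 * (d + 4)))
    (min (decayC d N / 24) (1 / (100 * B))))) with hκ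
  have hκ0 : 0 < κ := by
    refine lt_min hν (lt_min (by positivity) (lt_min (by positivity) (lt_min (by positivity) ?_)))
    positivity
  have k1 : κ ≤ bν d K₁ := min_le_left _ _
  have k2 : κ ≤ 1 / (4 * X) := (min_le_right _ _).trans (min_le_left _ _)
  have k3 : κ ≤ gainC d N / (15 * (d + 4)) :=
    (min_le_right _ _).trans ((min_le_right _ _).trans (min_le_left _ _))
  have k4 : κ ≤ decayC d N / 24 := (min_le_right _ _).trans
    ((min_le_right _ _).trans ((min_le_right _ _).trans (min_le_left _ _)))
  have k5 : κ ≤ 1 / (100 * B) := (min_le_right _ _).trans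
    ((min_le_right _ _).trans ((min_le_right _ _).trans (min_le_right _ _)))
  rw [le_div_iff₀ (by positivity)] at k2 k3 k4 k5
  refine ⟨B, K', K₁, 1 / (8 * B), κ, κ ^ 2 / (416 * (K' * B ^ 2)),
    min (bν d K₁) (1 / (8 * B)), N, ⟨hK₁1, k1, by linarith, k3, lt_min hν (by positivity),
      min_le_left _ _, min_le_right _ _, ?_⟩, hκ0, by linarith, hL, rfl, le_max_left _ _, hK1, rfl,
    ?_, k5, by positivity, ?_⟩
  · have := Nat.le_ceil (32 / bTop d K₁)
    rw [div_le_iff₀ hT] at this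
    linarith
  · field_simp
  · have : 0 < K' * B ^ 2 := by positivity
    field_simp

section Final

variable {d : ℕ} {γ : ℝ} {L : NNReal} {Λ K β₁ ε δ : ℝ} {G : ℝ → ℝ} {fp fm u : Eu d → ℝ} {α β : ℝ}
  {M : Eu d →L[ℝ] Eu d} {a b : Eu d} {B K' K₁ s₀ κ τ : ℝ} {N : ℕ}

theorem TwoPhaseCase.start (h : TwoPhaseCase γ L Λ K β₁ ε δ G fp fm u α β M a b)
    (hp : Params d L K B K' K₁ s₀ κ δ τ N) (hε : 0 < ε) (hεB : ε * (100 * B) ≤ 1)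
    (hετ : ε ≤ τ * (1 / 8) ^ 2) : Start u α β ε κ K₁ s₀ τ N M a b :=
  ⟨h.core hp hε hεB, hp.small, hp.kap_decay, hετ, h.flat.lower, h.flat.upper⟩

theorem OnePhaseCase.start (h : OnePhaseCase γ L Λ K β₁ ε δ G fp u α M a)
    (hp : Params d L K B K' K₁ s₀ κ δ τ N) (hε : 0 < ε) (hε1 : ε ≤ 1)
    (hετ : ε ≤ τ * (1 / 8) ^ 2) : Start (fun x => max (u x) 0) α 0 ε κ K₁ s₀ τ N M a 0 :=
  ⟨h.core hp hε hε1, hp.small, hp.kap_decay, hετ, h.flat.lower, h.flat.upper⟩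

theorem renorm_max (hu : ContinuousOn u (ball 0 1)) {x : Eu d} (hx : x ∈ posPhase u ∪ freeBdry u) :
    renorm (fun x => max (u x) 0) α β M a b ε x = renorm u α β M a b ε x := by
  have h0 : 0 ≤ u x := by
    rcases hx with h | h
    · exact h.2.le
    · exact (eq_zero_of_mem_freeBdry hu h).ge
  rw [renorm, posPhase_max, freeBdry_max, if_pos hx, renorm, if_pos hx, max_eq_left h0]

end Final

end TwoPhaseFB
end

theorem lemma5p1 (d : ℕ) (hd : 1 ≤ d) (γ : ℝ) (hγ0 : 0 < γ) (hγ1 : γ < 1)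
    (L : NNReal) (Λ K β₁ : ℝ) (hβ₁ : 0 ≤ β₁) :
    ∃ εbar δbar η C θ : ℝ, ∃ σ : ℝ → ℝ,
      0 < εbar ∧ 0 < δbar ∧ 0 < η ∧ η < 1 ∧ 0 < C ∧ 0 < θ ∧ θ < 1 ∧
      Tendsto σ (𝓝[>] 0) (𝓝 0) ∧
      -- two-phase case
      (∀ (ε : ℝ) (G : ℝ → ℝ) (fp fm u : TwoPhaseFB.Eu d → ℝ) (α β : ℝ)
          (M : TwoPhaseFB.Eu d →L[ℝ] TwoPhaseFB.Eu d) (a b : TwoPhaseFB.Eu d),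
        0 < ε → ε ≤ εbar →
        TwoPhaseFB.TwoPhaseCase γ L Λ K β₁ ε δbar G fp fm u α β M a b →
        ((∀ x ∈ ball (0 : TwoPhaseFB.Eu d) η,
            u x ≤ TwoPhaseFB.polyV α β M (TwoPhaseFB.eLast d) a b
              (x + ((1 - η) * ε) • TwoPhaseFB.eLast d)) ∨
          (∀ x ∈ ball (0 : TwoPhaseFB.Eu d) η,
            TwoPhaseFB.polyV α β M (TwoPhaseFB.eLast d) a b
              (x - ((1 - η) * ε) • TwoPhaseFB.eLast d) ≤ u x)) ∧
        ∀ x ∈ ball (0 : TwoPhaseFB.Eu d) (1 / 2), ∀ y ∈ ball (0 : TwoPhaseFB.Eu d) (1 / 2),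
          σ ε ≤ ‖x - y‖ →
          |TwoPhaseFB.renorm u α β M a b ε x - TwoPhaseFB.renorm u α β M a b ε y|
            ≤ C * ‖x - y‖ ^ θ) ∧
      -- one-phase case
      (∀ (ε : ℝ) (G : ℝ → ℝ) (fp u : TwoPhaseFB.Eu d → ℝ) (α : ℝ)
          (M : TwoPhaseFB.Eu d →L[ℝ] TwoPhaseFB.Eu d) (a : TwoPhaseFB.Eu d),
        0 < ε → ε ≤ εbar →
        TwoPhaseFB.OnePhaseCase γ L Λ K β₁ ε δbar G fp u α M a →
        ((∀ x ∈ ball (0 : TwoPhaseFB.Eu d) η,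
            max (u x) 0 ≤ TwoPhaseFB.polyV α 0 M (TwoPhaseFB.eLast d) a 0
              (x + ((1 - η) * ε) • TwoPhaseFB.eLast d)) ∨
          (∀ x ∈ ball (0 : TwoPhaseFB.Eu d) η,
            TwoPhaseFB.polyV α 0 M (TwoPhaseFB.eLast d) a 0
              (x - ((1 - η) * ε) • TwoPhaseFB.eLast d) ≤ max (u x) 0)) ∧
        ∀ x ∈ ball (0 : TwoPhaseFB.Eu d) (1 / 2) ∩
            (TwoPhaseFB.posPhase u ∪ TwoPhaseFB.freeBdry u),
          ∀ y ∈ ball (0 : TwoPhaseFB.Eu d) (1 / 2) ∩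
            (TwoPhaseFB.posPhase u ∪ TwoPhaseFB.freeBdry u),
          σ ε ≤ ‖x - y‖ →
          |TwoPhaseFB.renorm u α 0 M a 0 ε x - TwoPhaseFB.renorm u α 0 M a 0 ε y|
            ≤ C * ‖x - y‖ ^ θ) := by
  obtain ⟨B, K', K₁, s₀, κ, δ, τ, N, hp⟩ := TwoPhaseFB.exists_params d L.coe_nonneg K
  have hK := hp.small.one_le_K
  have hρ := TwoPhaseFB.scaleC_pos (d := d) hK
  have hρ1 := TwoPhaseFB.scaleC_le (d := d) hK
  have hdec := TwoPhaseFB.decayC_pos (d := d) (N := N)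
  have hτ := hp.small.tau_pos
  have hB := hp.one_le_B
  have hκ := hp.kap_le
  have hδκ := hp.del_le_kap
  obtain ⟨hθ0, hθ1⟩ := TwoPhaseFB.holderExp_mem (d := d) (N := N) hK
  have hη : 0 < min (TwoPhaseFB.decayC d N) (TwoPhaseFB.scaleC d K₁ / 8) :=
    lt_min hdec (by positivity)
  have hεbar : ∀ ε : ℝ, ε ≤ min (τ * (1 / 8) ^ 2) (1 / (100 * B)) →
      ε ≤ τ * (1 / 8) ^ 2 ∧ ε * (100 * B) ≤ 1 := fun ε h =>
    ⟨h.trans (min_le_left _ _), (le_div_iff₀ (by positivity)).1 (h.trans (min_le_right _ _))⟩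
  -- `εbar` is small enough for the first step at radius `1/8`; the cutoff `√(ε / τ)` is the scale
  -- below which the iteration is not available.
  refine ⟨min (τ * (1 / 8) ^ 2) (1 / (100 * B)), δ,
    min (TwoPhaseFB.decayC d N) (TwoPhaseFB.scaleC d K₁ / 8), TwoPhaseFB.holderC d K₁ N,
    TwoPhaseFB.holderExp d K₁ N, fun ε => √(ε / τ), lt_min (by positivity) (by positivity),
    hp.del_pos, hη, (min_le_right _ _).trans_lt (by linarith), ?_, hθ0, hθ1, ?_, ?_, ?_⟩
  · unfold TwoPhaseFB.holderC
    have : 0 < 9 / TwoPhaseFB.scaleC d K₁ := by positivity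
    positivity
  · have hc : Continuous fun ε : ℝ => √(ε / τ) := by fun_prop
    have := hc.tendsto 0
    simp only [zero_div, Real.sqrt_zero] at this
    exact this.mono_left nhdsWithin_le_nhds
  · intro ε G fp fm u α β M a b hε hεle h
    obtain ⟨hε1, hε2⟩ := hεbar ε hεle
    have hS := h.start hp hε hε2 hε1
    refine ⟨hS.dichotomy hη (min_le_left _ _) (min_le_right _ _), fun x hx y hy hxy => ?_⟩
    have hδs : δ * √ε ≤ √ε := mul_le_of_le_one_left (Real.sqrt_nonneg _) (by linarith)
    exact hS.holder_renorm h.beta_pos (h.flat.norm_a.trans hδs) (h.flat.norm_b'.trans hδs)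
      (h.flat.norm_M.trans hδs) (mem_ball_zero_iff.1 hx).le (mem_ball_zero_iff.1 hy).le hxy
  · intro ε G fp u α M a hε hεle h
    obtain ⟨hε1, hε2⟩ := hεbar ε hεle
    have hS := h.start hp hε (by nlinarith) hε1
    refine ⟨hS.dichotomy hη (min_le_left _ _) (min_le_right _ _), fun x hx y hy hxy => ?_⟩
    have hu := h.lipschitz.continuousOn
    -- On the closed positive phase inside `B₁` the function agrees with its positive part, so the
    -- renormalizations coincide.
    rw [← TwoPhaseFB.renorm_max hu hx.2, ← TwoPhaseFB.renorm_max hu hy.2]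
    rw [← TwoPhaseFB.posPhase_max, ← TwoPhaseFB.freeBdry_max] at hx hy
    exact hS.holder_renorm_pos hx.2 hy.2 (mem_ball_zero_iff.1 hx.1).le
      (mem_ball_zero_iff.1 hy.1).le hxy
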